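/- **Model.** Let $n\ge 2$, let $X\subset\mathbb R^n$ be closed and convex, let $x_*\in X$ be $s$-sparse ($s\ge1$), and let $x_0\in X$ satisfy $\|x_*-x_0\|_1\le R$, $R>0$. One observes $(\phi_i,\eta_i)$ with $\eta_i=\mathfrak r(\phi_i^Tx_*)+\sigma\xi_i$, $\sigma>0$, where the pairs $(\phi_i,\xi_i)$ are i.i.d., $\phi_i\in\mathbb R^n$ and $\xi_i\in\mathbb R$ are independent, $\|\phi_i\|_\infty\le\bar\nu$ a.s., $\mathbf E\,e^{\xi_i^2}\le e$, $\mathbf E\{\xi_i\phi_i\}=0$ (e.g. $\xi_i$ is centred), $\Sigma=\mathbf E\{\phi_i\phi_i^T\}\succeq\kappa_\Sigma I$ with $\kappa_\Sigma>0$, and $\mathfrak r:\mathbb R\to\mathbb R$ is non-decreasing with $\underline r|u-v|\le|\mathfrak r(u)-\mathfrak r(v)|\le\bar r|u-v|$ for all $u,v$, $\underline r>0$. Put $\nabla G(x,(\phi,\eta))=\phi(\mathfrak r(\phi^Tx)-\eta)$, $\rho=1/(\kappa_\Sigma\underline r)$, $\nu=\bar r\bar\nu^2$, $\sigma_*=\sigma\bar\nu$.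 **One stage.** Let $\theta(x)=\frac{c_n}{p}\|x\|_p^p$ with $p=c_n=2$ if $n=2$, and $p=1+1/\ln n$, $c_n=e\ln n$ if $n\ge3$; $\Theta=\max_{\|z\|_1\le1}\theta(z)$; and, for a centre $y_0\in X$ and a radius $r>0$, $\vartheta(z)=r^2\theta((z-y_0)/r)$ and $V(x,z)=\vartheta(z)-\vartheta(x)-\langle\nabla\vartheta(x),z-x\rangle$. $\mathrm{CSMD}(y_0,\gamma,\kappa,r,m,L)$ is the average $\frac1m\sum_{i=0}^{m-1}y_i$ of the iterates $$y_i=\operatorname{argmin}_{z\in X,\ \|z-y_0\|_1\le r}\big\{\gamma\langle H_i,z\rangle+\gamma\kappa\|z\|_1+V(y_{i-1},z)\big\},$$ where $H_i$ is the average of $\nabla G(y_{i-1},\cdot)$ over $L$ new observations. **Algorithm** (CSMD-SR, sample budget $N$, confidence parameter $t$). Every "$\asymp$" below stands for an equality with an absolute constant factor (up to rounding to an integer). *Preliminary phase.* Set $m_0\asymp s\rho\nu(\Theta+t)$. Starting from $x_0$, run $\overline K_1=\min\{\lceil\frac12\log_2\frac{R^2\nu}{a\rho\sigma_*^2s}\rceil_+,\lfloor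 N/m_0\rfloor\}$ stages ($a$ an absolute constant). With $R_k=2^{-k}R$, stage $k$ is CSMD with centre the current point, $\gamma=(4\nu)^{-1}$, $\kappa\asymp R_{k-1}/(\rho s)$, radius $R_{k-1}$, $m=m_0$ and $L=1$; its output is the new current point. *Asymptotic phase.* Put $r_k\asymp2^{-k}\sigma_*\sqrt{\rho s/\nu}$. As long as the remaining budget suffices, run stages $k=1,2,\dots$, each of them CSMD with centre the current point, radius $r_{k-1}$, $\kappa\asymp2^{-k}\sigma_*(\rho\nu s)^{-1/2}$, and: $\gamma\asymp4^{-k}\nu^{-1}$, $m=m_k\asymp4^ks\rho\nu(\Theta+t)$, $L=1$ in the standard version, with output $\widehat x_N$; $\gamma=(4\nu)^{-1}$, $m=m_0$, $L=\ell_k\asymp4^k\Theta$ in the minibatch version, with output $\widehat x^{(b)}_N$. **Proposition 3.** The absolute constants in the algorithm can be chosen so that, for suitable absolute constants $c,C,c_0>0$, the following holds in every such model. Put $$\Lambda=\frac{\underline r\kappa_\Sigma}{\bar r\bar\nu^2}\cdot\frac{N}{s(\ln n+t)}.$$ If $t\ge c_0\sqrt{\ln N}$, $N\ge m_0$ and $$\min\Big\{\ln\frac{R^2\,\bar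 r\,\underline r\,\kappa_\Sigma}{\sigma^2s},\ \Lambda\Big\}\le e^{t},$$ then, with probability at least $1-Ce^{-t}\ln N$, $$\|\widehat x_N-x_*\|_1\le C\Big(R\,e^{-c\Lambda}+\frac{\sigma\bar\nu s}{\underline r\kappa_\Sigma}\sqrt{\frac{\ln n+t}{N}}\Big),$$ and, with probability at least $1-Ce^{-t}\ln N$, $$\|\widehat x^{(b)}_N-x_*\|_1\le C\Big(R\,e^{-c\Lambda}+\frac{\sigma\bar\nu s}{\underline r\kappa_\Sigma}\sqrt{\frac{\ln n\,(\ln n+t)}{N}}\Big).$$ -/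

import Mathlib

open MeasureTheory ProbabilityTheory

namespace CSMDSR

/-- The norm of `x` in `ℓ₁`. -/
noncomputable def l1 {n : ℕ} (x : Fin n → ℝ) : ℝ := ∑ j, |x j|

/-- The exponent `p` of the distance-generating function: `2` if `n = 2`,
and `1 + 1 / ln n` if `n ≥ 3`. -/
noncomputable def dgfExp (n : ℕ) : ℝ := if n = 2 then 2 else 1 + 1 / Real.log n

/-- The factor of the distance-generating function: `2` if `n = 2`, and `e ln n` if `n ≥ 3`. -/
noncomputable def dgfCoef (n : ℕ) : ℝ := if n = 2 then 2 else Real.exp 1 * Real.log n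

/-- The distance-generating function `θ(x) = (c / p) ‖x‖_p ^ p`. -/
noncomputable def dgf {n : ℕ} (x : Fin n → ℝ) : ℝ :=
  dgfCoef n / dgfExp n * ∑ j, |x j| ^ dgfExp n

/-- `Θ`, the maximum of `θ` over the unit ball of `ℓ₁`. -/
noncomputable def dgfMax (n : ℕ) : ℝ := sSup ((dgf (n := n)) '' {z | l1 z ≤ 1})

/-- The localized function `z ↦ R² θ((z - x₀) / R)`. -/
noncomputable def localDgf {n : ℕ} (R : ℝ) (x₀ z : Fin n → ℝ) : ℝ :=
  R ^ 2 * dgf (R⁻¹ • (z - x₀))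

/-- The Bregman divergence `V_{x₀}(x, z)` of the localized distance-generating function. -/
noncomputable def bregman {n : ℕ} (R : ℝ) (x₀ x z : Fin n → ℝ) : ℝ :=
  localDgf R x₀ z - localDgf R x₀ x - fderiv ℝ (localDgf R x₀) x (z - x)

/-- `X_R(x₀)`, the points of `X` at `ℓ₁`-distance at most `R` from `x₀`. -/
def localBall {n : ℕ} (X : Set (Fin n → ℝ)) (R : ℝ) (x₀ : Fin n → ℝ) : Set (Fin n → ℝ) :=
  {z | z ∈ X ∧ l1 (z - x₀) ≤ R}

/-- The composite proximal mapping: the minimizer over `z ∈ X_R(x₀)` of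
`⟨ζ, z⟩ + h(z) + V_{x₀}(x, z)`. It exists and is unique for the closed convex `X ∋ x₀`, the
convex continuous `h` and the radius `R > 0` with which it is used. -/
noncomputable def compProx {n : ℕ} (X : Set (Fin n → ℝ)) (R : ℝ) (x₀ : Fin n → ℝ)
    (h : (Fin n → ℝ) → ℝ) (ζ x : Fin n → ℝ) : Fin n → ℝ :=
  Classical.epsilon fun z => z ∈ localBall X R x₀ ∧
    IsMinOn (fun y => ζ ⬝ᵥ y + h y + bregman R x₀ x y) (localBall X R x₀) z

/-- The stochastic gradient `∇G(x, (φ, η)) = φ (𝔯(φᵀ x) - η)`. -/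
def stochGrad {n : ℕ} (act : ℝ → ℝ) (x : Fin n → ℝ) (o : (Fin n → ℝ) × ℝ) : Fin n → ℝ :=
  (act (o.1 ⬝ᵥ x) - o.2) • o.1

/-- The average of the stochastic gradients at `x` over the observations `o 0, …, o (L - 1)`. -/
noncomputable def batchGrad {n : ℕ} (act : ℝ → ℝ) (L : ℕ) (o : ℕ → (Fin n → ℝ) × ℝ)
    (x : Fin n → ℝ) : Fin n → ℝ :=
  (L : ℝ)⁻¹ • ∑ l ∈ Finset.range L, stochGrad act x (o l)

/-- The iterates of the `L`-minibatch composite stochastic mirror descent with the constant step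
size `γ` and the penalty `κ ‖·‖₁`, on `X_R(x₀)`; each iteration uses `L` new observations of `o`. -/
noncomputable def csmdIter {n : ℕ} (X : Set (Fin n → ℝ)) (act : ℝ → ℝ) (x₀ : Fin n → ℝ)
    (γ κ R : ℝ) (L : ℕ) (o : ℕ → (Fin n → ℝ) × ℝ) : ℕ → (Fin n → ℝ)
  | 0 => x₀
  | i + 1 =>
    compProx X R x₀ (fun z => γ * (κ * l1 z))
      (γ • batchGrad act L (fun l => o (i * L + l)) (csmdIter X act x₀ γ κ R L o i))
      (csmdIter X act x₀ γ κ R L o i)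

/-- `CSMD(x₀, γ, κ, R, m, L)`, the average of the iterates `0, …, m - 1`. -/
noncomputable def csmd {n : ℕ} (X : Set (Fin n → ℝ)) (act : ℝ → ℝ) (x₀ : Fin n → ℝ)
    (γ κ R : ℝ) (m L : ℕ) (o : ℕ → (Fin n → ℝ) × ℝ) : Fin n → ℝ :=
  (m : ℝ)⁻¹ • ∑ i ∈ Finset.range m, csmdIter X act x₀ γ κ R L o i

/-- The numerical parameters of the problem that the algorithm is given. -/
structure Params where
  /-- sparsity level -/
  s : ℕ
  /-- total number of observations -/
  N : ℕ
  /-- initial radius -/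
  R : ℝ
  /-- confidence level -/
  t : ℝ
  /-- noise level -/
  sig : ℝ
  /-- bound for the uniform norm of the regressors -/
  nuBar : ℝ
  /-- lower bound for the covariance matrix of the regressors -/
  kapSig : ℝ
  /-- modulus of strong monotonicity of the activation function -/
  rLow : ℝ
  /-- Lipschitz constant of the activation function -/
  rUp : ℝ

/-- The absolute constants in those parameters of the algorithm that are prescribed only up to an
absolute constant factor. -/
structure Tuning where
  /-- length of a preliminary stage -/
  aLen : ℝ
  /-- threshold at which the preliminary phase ends -/
  aStop : ℝ
  /-- penalty, preliminary phase -/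
  aPen : ℝ
  /-- initial radius of the asymptotic phase -/
  aRad : ℝ
  /-- stage length, asymptotic phase -/
  aLenAs : ℝ
  /-- step size, asymptotic phase -/
  aStepAs : ℝ
  /-- penalty, asymptotic phase -/
  aPenAs : ℝ
  /-- penalty, asymptotic phase with minibatches -/
  aPenMb : ℝ
  /-- size of the minibatches -/
  aBatch : ℝ
  aLen_pos : 0 < aLen
  aStop_pos : 0 < aStop
  aPen_pos : 0 < aPen
  aRad_pos : 0 < aRad
  aLenAs_pos : 0 < aLenAs
  aStepAs_pos : 0 < aStepAs
  aPenAs_pos : 0 < aPenAs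
  aPenMb_pos : 0 < aPenMb
  aBatch_pos : 0 < aBatch

namespace Params

variable (q : Params)

/-- `ρ = 1 / (κ_Σ r̲)`. -/
noncomputable def rho : ℝ := (q.kapSig * q.rLow)⁻¹

/-- The Lipschitz constant `ν = r̄ ν̄²` of the stochastic gradient. -/
noncomputable def nu : ℝ := q.rUp * q.nuBar ^ 2

/-- `σ_* = σ ν̄`. -/
noncomputable def sigStar : ℝ := q.sig * q.nuBar

/-- The length `m₀ ≍ s ρ ν (Θ + t)` of the stages of the preliminary phase. -/
noncomputable def m0 (a : Tuning) (n : ℕ) : ℕ :=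
  ⌈a.aLen * (q.s * q.rho * q.nu * (dgfMax n + q.t))⌉₊

/-- The number of stages of the preliminary phase, `≍ ln (R² ν / (ρ σ_*² s)) ∧ N / m₀`.
It is `0` (the preliminary phase is skipped) exactly when `R ≲ σ_* √(ρ s / ν)` or `N < m₀`. -/
noncomputable def K1 (a : Tuning) (n : ℕ) : ℕ :=
  min ⌈(1 / 2 : ℝ) *
      Real.logb 2 (q.R ^ 2 * q.nu / (a.aStop * (q.rho * q.sigStar ^ 2 * q.s)))⌉₊
    (q.N / q.m0 a n)

/-- The radius of stage `k + 1` of the preliminary phase. -/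
noncomputable def radPre (k : ℕ) : ℝ := q.R / 2 ^ k

/-- The radius `r_k ≍ 2^{-k} σ_* √(ρ s / ν)` after `k` stages of the asymptotic phase. -/
noncomputable def radAs (a : Tuning) (k : ℕ) : ℝ :=
  a.aRad * (q.sigStar * √(q.rho * q.s / q.nu)) / 2 ^ k

/-- The length `m_k ≍ 4^k m₀` of stage `k ≥ 1` of the asymptotic phase. -/
noncomputable def mAs (a : Tuning) (n k : ℕ) : ℕ :=
  ⌈a.aLenAs * (4 ^ k * (q.s * q.rho * q.nu * (dgfMax n + q.t)))⌉₊

/-- The batch size `ℓ_k ≍ 4^k Θ` of stage `k ≥ 1` of the asymptotic phase with minibatches. -/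
noncomputable def batch (a : Tuning) (n k : ℕ) : ℕ := ⌈a.aBatch * (4 ^ k * dgfMax n)⌉₊

/-- The size `2^{-k} σ_* (ρ ν s)^{-1/2}` of the penalty in stage `k ≥ 1` of the asymptotic phase. -/
noncomputable def penAs (k : ℕ) : ℝ := q.sigStar / √(q.rho * q.nu * q.s) / 2 ^ k

/-- The number of observations left after the preliminary phase. -/
noncomputable def budget (a : Tuning) (n : ℕ) : ℕ := q.N - q.m0 a n * q.K1 a n

end Params

/-- The number of stages that a loop performs which runs the stages `1, 2, …`, of which stage `k`
uses `cost k` observations, as long as the remaining budget suffices for the next stage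
(all costs are positive). -/
def numStages (cost : ℕ → ℕ) (B : ℕ) : ℕ :=
  Nat.findGreatest (fun K => ∑ k ∈ Finset.range K, cost (k + 1) ≤ B) B

/-- The approximate solution after `k` stages of the preliminary phase. -/
noncomputable def prePoint {n : ℕ} (a : Tuning) (q : Params) (X : Set (Fin n → ℝ)) (act : ℝ → ℝ)
    (x₀ : Fin n → ℝ) (o : ℕ → (Fin n → ℝ) × ℝ) : ℕ → (Fin n → ℝ)
  | 0 => x₀
  | k + 1 =>
    csmd X act (prePoint a q X act x₀ o k) (1 / (4 * q.nu))
      (a.aPen * (q.radPre k / (q.rho * q.s))) (q.radPre k) (q.m0 a n) 1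
      (fun i => o (k * q.m0 a n + i))

/-- The approximate solution after `k` stages of the asymptotic phase without minibatches. -/
noncomputable def asPoint {n : ℕ} (a : Tuning) (q : Params) (X : Set (Fin n → ℝ)) (act : ℝ → ℝ)
    (x₀ : Fin n → ℝ) (o : ℕ → (Fin n → ℝ) × ℝ) : ℕ → (Fin n → ℝ)
  | 0 => prePoint a q X act x₀ o (q.K1 a n)
  | k + 1 =>
    csmd X act (asPoint a q X act x₀ o k) (a.aStepAs / (4 ^ (k + 1) * q.nu))
      (a.aPenAs * q.penAs (k + 1)) (q.radAs a k) (q.mAs a n (k + 1)) 1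
      (fun i => o (q.m0 a n * q.K1 a n + ∑ j ∈ Finset.range k, q.mAs a n (j + 1) + i))

/-- The approximate solution after `k` stages of the asymptotic phase with minibatches. -/
noncomputable def mbPoint {n : ℕ} (a : Tuning) (q : Params) (X : Set (Fin n → ℝ)) (act : ℝ → ℝ)
    (x₀ : Fin n → ℝ) (o : ℕ → (Fin n → ℝ) × ℝ) : ℕ → (Fin n → ℝ)
  | 0 => prePoint a q X act x₀ o (q.K1 a n)
  | k + 1 =>
    csmd X act (mbPoint a q X act x₀ o k) (1 / (4 * q.nu))
      (a.aPenMb * q.penAs (k + 1)) (q.radAs a k) (q.m0 a n) (Params.batch a n (k + 1))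
      (fun i => o (q.m0 a n * q.K1 a n +
        ∑ j ∈ Finset.range k, q.m0 a n * Params.batch a n (j + 1) + i))

/-- The output `x̂_N` of the multistage algorithm CSMD-SR on the observations `o`. -/
noncomputable def output {n : ℕ} (a : Tuning) (q : Params) (X : Set (Fin n → ℝ)) (act : ℝ → ℝ)
    (x₀ : Fin n → ℝ) (o : ℕ → (Fin n → ℝ) × ℝ) : Fin n → ℝ :=
  asPoint a q X act x₀ o (numStages (fun k => q.mAs a n k) (q.budget a n))

/-- The output of the variant of CSMD-SR with minibatches in the asymptotic phase. -/
noncomputable def outputMb {n : ℕ} (a : Tuning) (q : Params) (X : Set (Fin n → ℝ)) (act : ℝ → ℝ)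
    (x₀ : Fin n → ℝ) (o : ℕ → (Fin n → ℝ) × ℝ) : Fin n → ℝ :=
  mbPoint a q X act x₀ o (numStages (fun k => q.m0 a n * Params.batch a n k) (q.budget a n))

/-- The exponent `(r̲ κ_Σ / (r̄ ν̄²)) N / (s (ln n + t))`. -/
noncomputable def linRate (q : Params) (n : ℕ) : ℝ :=
  q.rLow * q.kapSig / (q.rUp * q.nuBar ^ 2) * (q.N / (q.s * (Real.log n + q.t)))

end CSMDSR

/-! The core is a halving property: a stage of CSMD that starts at ℓ₁-distance at most R from x_*,
uses the penalty R/(16ρs) and is long enough ends at distance at most R/2, outside an event of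
probability 3exp(-2t). The rest is a count of stages.

Deterministic half. θ is strongly convex with an absolute modulus for the ℓ₁ norm on the ℓ₁ ball
(`dgf_bregman_ge`), while its maximum Θ is only of order ln n. The three-point inequality of the
proximal step yields a regret bound (`Model.step_le`, `Model.sum_step_le`). Since 𝔯 is monotone and
Lipschitz, the squared noiseless gradient is at most ν times the gap (𝔯(φᵀx) - 𝔯(φᵀx_*))φᵀ(x - x_*)
(`Model.norm_driftAvg_sq_le`). For γν ≤ 1/4 half of the gap absorbs it, and only the additive noise
ξφ remains. Strong monotonicity bounds the gap below by r̲(φᵀ(x - x_*))². The resulting bound for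
the quadratic error plus penalty becomes an ℓ₁ bound by Cauchy-Schwarz on the support of x_*
(`Model.l1_le_of_penalized`, `Model.csmd_halving`).

Probabilistic half. Three sums have to be controlled: the lower deviations of the quadratic forms
(φᵀv)², the martingale of the ξφᵀv, and the squared norms of the averaged noise. In each case the
exponential of the compensated sum has integral at most 1, because every new observation (or batch)
is independent of the past, and Markov's inequality gives the tail exp(-τ)
(`Model.measure_csmd_le`).

Counting. As long as R_k exceeds σ_*√(ρs/ν) up to a constant, stages of the fixed length m₀ suffice,
so the error decays exponentially in the number of samples; this is the term R exp(-cΛ). Below that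
level each halving needs four times as many samples as the previous one, so the final radius is of
order N^(-1/2). Up to one stage, one of the two phases uses half of the budget, and its accuracy
supplies the corresponding term (`Model.error_bound`). With τ = 2t, the union bound over at most
2exp(t) preliminary and ln N asymptotic stages costs a multiple of exp(-t) ln N. -/

namespace CSMDSR

/-! ### The `ℓ₁` norm -/

theorem l1_nonneg {n : ℕ} (x : Fin n → ℝ) : 0 ≤ l1 x := Finset.sum_nonneg fun _ _ => abs_nonneg _

theorem l1_zero {n : ℕ} : l1 (0 : Fin n → ℝ) = 0 := by simp [l1]

theorem l1_smul {n : ℕ} (c : ℝ) (x : Fin n → ℝ) : l1 (c • x) = |c| * l1 x := by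
  simp [l1, abs_mul, Finset.mul_sum]

theorem l1_add_le {n : ℕ} (x y : Fin n → ℝ) : l1 (x + y) ≤ l1 x + l1 y := by
  rw [l1, l1, l1, ← Finset.sum_add_distrib]
  exact Finset.sum_le_sum fun j _ => abs_add_le _ _

theorem l1_neg {n : ℕ} (x : Fin n → ℝ) : l1 (-x) = l1 x := by simp [l1]

theorem l1_sub_comm {n : ℕ} (x y : Fin n → ℝ) : l1 (x - y) = l1 (y - x) := by
  rw [← l1_neg, neg_sub]

theorem l1_sub_le {n : ℕ} (x y z : Fin n → ℝ) : l1 (x - z) ≤ l1 (x - y) + l1 (y - z) := by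
  have := l1_add_le (x - y) (y - z)
  rwa [sub_add_sub_cancel] at this

theorem l1_le_add_sub {n : ℕ} (x y : Fin n → ℝ) : l1 x ≤ l1 y + l1 (x - y) := by
  have := l1_add_le y (x - y)
  rwa [add_sub_cancel] at this

theorem continuous_l1 {n : ℕ} : Continuous (l1 (n := n)) := by
  unfold l1; fun_prop

theorem convexOn_l1 {n : ℕ} : ConvexOn ℝ Set.univ (l1 (n := n)) := by
  refine ⟨convex_univ, fun x _ y _ a b ha hb _ => ?_⟩
  refine (l1_add_le _ _).trans_eq ?_
  rw [l1_smul, l1_smul, abs_of_nonneg ha, abs_of_nonneg hb]; rfl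

theorem abs_le_l1 {n : ℕ} (x : Fin n → ℝ) (j : Fin n) : |x j| ≤ l1 x :=
  Finset.single_le_sum (f := fun j => |x j|) (fun _ _ => abs_nonneg _) (Finset.mem_univ j)

theorem abs_dotProduct_le {n : ℕ} {a : Fin n → ℝ} {B : ℝ} (ha : ∀ j, |a j| ≤ B) (x : Fin n → ℝ) :
    |a ⬝ᵥ x| ≤ B * l1 x := by
  rw [dotProduct, l1, Finset.mul_sum]
  refine (Finset.abs_sum_le_sum_abs _ _).trans (Finset.sum_le_sum fun j _ => ?_)
  rw [abs_mul]
  exact mul_le_mul_of_nonneg_right (ha j) (abs_nonneg _)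

/-! ### The power `|u| ^ p` -/

/-- The derivative of `u ↦ |u| ^ p`. -/
noncomputable def absPowDeriv (p u : ℝ) : ℝ := p * |u| ^ (p - 2) * u

theorem continuous_absPowDeriv {p : ℝ} (hp : 1 < p) : Continuous (absPowDeriv p) := by
  have h : absPowDeriv p = deriv fun u : ℝ => |u| ^ p :=
    funext fun u => (hasDerivAt_abs_rpow u hp).deriv.symm
  rw [h]
  exact (contDiff_norm_rpow (E := ℝ) hp).continuous_deriv le_rfl

theorem absPowDeriv_neg (p u : ℝ) : absPowDeriv p (-u) = -absPowDeriv p u := by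
  simp [absPowDeriv]

theorem absPowDeriv_zero (p : ℝ) : absPowDeriv p 0 = 0 := by simp [absPowDeriv]

theorem absPowDeriv_of_nonneg {p u : ℝ} (hp : 1 < p) (hu : 0 ≤ u) :
    absPowDeriv p u = p * u ^ (p - 1) := by
  rcases hu.eq_or_lt with rfl | hu
  · rw [absPowDeriv_zero, Real.zero_rpow (by linarith), mul_zero]
  · rw [absPowDeriv, abs_of_pos hu, mul_assoc, ← Real.rpow_add_one hu.ne']
    ring_nf

/-- `absPowDeriv p u - p (p - 1) w ^ (p - 2) u` is monotone on `[0, w]`. -/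
theorem monotoneOn_absPowDeriv_sub {p w : ℝ} (hp : 1 < p) (hp2 : p ≤ 2) :
    MonotoneOn (fun u => absPowDeriv p u - p * (p - 1) * w ^ (p - 2) * u) (Set.Icc 0 w) := by
  have key : ∀ u ∈ Set.Ioo 0 w, HasDerivAt
      (fun u => absPowDeriv p u - p * (p - 1) * w ^ (p - 2) * u)
      (p * ((p - 1) * u ^ (p - 2)) - p * (p - 1) * w ^ (p - 2)) u := by
    intro u hu
    have h1 : HasDerivAt (fun u : ℝ => p * u ^ (p - 1)) (p * ((p - 1) * u ^ (p - 2))) u := by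
      have := (Real.hasDerivAt_rpow_const (x := u) (p := p - 1) (Or.inl hu.1.ne')).const_mul p
      rwa [show p - 1 - 1 = p - 2 by ring] at this
    have h2 : HasDerivAt (absPowDeriv p) (p * ((p - 1) * u ^ (p - 2))) u :=
      h1.congr_of_eventuallyEq (by
        filter_upwards [lt_mem_nhds hu.1] with v hv using absPowDeriv_of_nonneg hp hv.le)
    have h3 := h2.sub ((hasDerivAt_id u).const_mul (p * (p - 1) * w ^ (p - 2)))
    rw [mul_one] at h3
    exact h3
  -- For p < 2 the second derivative of the power blows up at 0, so the sign is tested in the open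
  -- interval and continuity covers the endpoints.
  refine monotoneOn_of_deriv_nonneg (convex_Icc 0 w) ?_ ?_ ?_
  · exact ((continuous_absPowDeriv hp).sub (continuous_const.mul continuous_id)).continuousOn
  · rw [interior_Icc]
    exact fun u hu => (key u hu).differentiableAt.differentiableWithinAt
  · rw [interior_Icc]
    intro u hu
    rw [(key u hu).deriv]
    have : w ^ (p - 2) ≤ u ^ (p - 2) :=
      Real.rpow_le_rpow_of_nonpos hu.1 hu.2.le (by linarith)
    have h3 : 0 ≤ p * (p - 1) := by nlinarith
    nlinarith [mul_le_mul_of_nonneg_left this h3]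

/-- The function is odd and vanishes at 0, so its monotonicity on [0, w] is reflected to [-w, 0].
This avoids differentiating across 0. -/
theorem monotoneOn_absPowDeriv_sub_symm {p w : ℝ} (hp : 1 < p) (hp2 : p ≤ 2) :
    MonotoneOn (fun u => absPowDeriv p u - p * (p - 1) * w ^ (p - 2) * u) (Set.Icc (-w) w) := by
  have h := monotoneOn_absPowDeriv_sub (w := w) hp hp2
  set g : ℝ → ℝ := fun u => absPowDeriv p u - p * (p - 1) * w ^ (p - 2) * u with hg
  have hodd : ∀ u, g (-u) = - g u := fun u => by simp only [hg, absPowDeriv_neg]; ring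
  have h0 : g 0 = 0 := by simp [hg, absPowDeriv_zero]
  intro a ha b hb hab
  rcases le_total 0 a with ha0 | ha0
  · exact h ⟨ha0, ha.2⟩ ⟨ha0.trans hab, hb.2⟩ hab
  · have hw : 0 ≤ w := by linarith [ha.1]
    have ha' : g a ≤ 0 := by
      have := h ⟨le_rfl, hw⟩ ⟨neg_nonneg.2 ha0, by linarith [ha.1]⟩ (neg_nonneg.2 ha0)
      rw [hodd, h0] at this; linarith
    rcases le_total 0 b with hb0 | hb0
    · have := h ⟨le_rfl, hw⟩ ⟨hb0, hb.2⟩ hb0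
      rw [h0] at this; linarith
    · have := h ⟨neg_nonneg.2 hb0, by linarith [hb.1]⟩ ⟨neg_nonneg.2 ha0, by linarith [ha.1]⟩
        (neg_le_neg hab)
      rw [hodd, hodd] at this; linarith

/-- Strong convexity of `|u| ^ p` on `[-w, w]`. -/
theorem abs_rpow_bregman_ge {p u v w : ℝ} (hp : 1 < p) (hp2 : p ≤ 2) (hu : |u| ≤ w)
    (hv : |v| ≤ w) :
    p * (p - 1) / 2 * w ^ (p - 2) * (v - u) ^ 2 ≤ |v| ^ p - |u| ^ p - absPowDeriv p u * (v - u) := by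
  set K := p * (p - 1) * w ^ (p - 2) with hK
  -- Convexity of `g` on [-w, w] is the claim: the tangent line of `g` at `u` lies below `g v`.
  set g : ℝ → ℝ := fun u => |u| ^ p - K / 2 * u ^ 2 with hg
  have hd : ∀ x, HasDerivAt g (absPowDeriv p x - K * x) x := by
    intro x
    have := (hasDerivAt_abs_rpow x hp).sub ((hasDerivAt_pow 2 x).const_mul (K / 2))
    refine this.congr_deriv ?_
    rw [absPowDeriv]; push_cast; ring
  have hconv : ConvexOn ℝ (Set.Icc (-w) w) g := by
    refine MonotoneOn.convexOn_of_deriv (convex_Icc _ _)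
      (fun x _ => (hd x).continuousAt.continuousWithinAt)
      (fun x _ => (hd x).differentiableAt.differentiableWithinAt) ?_
    have : deriv g = fun x => absPowDeriv p x - K * x := funext fun x => (hd x).deriv
    rw [this]
    exact (monotoneOn_absPowDeriv_sub_symm hp hp2).mono interior_subset
  have hu' := abs_le.1 hu
  have hv' := abs_le.1 hv
  have key : g u + (absPowDeriv p u - K * u) * (v - u) ≤ g v := by
    rcases lt_trichotomy u v with h | h | h
    · have := hconv.le_slope_of_hasDerivAt hu' hv' h (hd u)
      rw [slope_def_field, le_div_iff₀ (by linarith)] at this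
      linarith
    · subst h; simp
    · have := hconv.slope_le_of_hasDerivAt hv' hu' h (hd u)
      rw [slope_def_field, div_le_iff₀ (by linarith)] at this
      linarith
  simp only [hg] at key
  nlinarith

/-! ### The distance-generating function -/

theorem one_lt_log {n : ℕ} (hn : 3 ≤ n) : 1 < Real.log n := by
  rw [Real.lt_log_iff_exp_lt (by positivity)]
  have : (3 : ℝ) ≤ n := by exact_mod_cast hn
  linarith [Real.exp_one_lt_d9]

theorem one_lt_dgfExp {n : ℕ} (hn : 2 ≤ n) : 1 < dgfExp n := by
  unfold dgfExp
  split_ifs with h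
  · norm_num
  · have := one_lt_log (n := n) (by omega)
    have : 0 < 1 / Real.log n := by positivity
    linarith

theorem dgfExp_le_two {n : ℕ} (hn : 2 ≤ n) : dgfExp n ≤ 2 := by
  unfold dgfExp
  split_ifs with h
  · norm_num
  · have h1 := one_lt_log (n := n) (by omega)
    have : 1 / Real.log n ≤ 1 := by rw [div_le_one (by linarith)]; exact h1.le
    linarith

theorem dgfCoef_pos {n : ℕ} (hn : 2 ≤ n) : 0 < dgfCoef n := by
  unfold dgfCoef
  split_ifs with h
  · norm_num
  · have := one_lt_log (n := n) (by omega)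
    positivity

/-- The normalization `c (p - 1) = n ^ (p - 1)`. -/
theorem dgfCoef_mul {n : ℕ} (hn : 2 ≤ n) :
    dgfCoef n * (dgfExp n - 1) = (n : ℝ) ^ (dgfExp n - 1) := by
  unfold dgfCoef dgfExp
  split_ifs with h
  · subst h; norm_num
  · have h1 := one_lt_log (n := n) (by omega)
    have hn0 : (0 : ℝ) < n := by positivity
    -- Both sides equal e, since n^(1/ln n) = e.
    rw [Real.rpow_def_of_pos hn0, add_sub_cancel_left, mul_one_div_cancel (by linarith)]
    field_simp

/-- Weighted AM-GM between w_j and 1/n with weights 2 - p and p - 1; summation leaves the factor 2(2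
- p) + (p - 1) = 3 - p ≤ 2. It bounds the dual factor of the Cauchy-Schwarz inequality in
`dgf_bregman_ge`. -/
theorem sum_rpow_le {n : ℕ} (hn : 0 < n) {p : ℝ} (hp : 1 ≤ p) (hp2 : p ≤ 2) {w : Fin n → ℝ}
    (hw : ∀ j, 0 ≤ w j) (hsum : ∑ j, w j ≤ 2) :
    ∑ j, w j ^ (2 - p) ≤ 2 * (n : ℝ) ^ (p - 1) := by
  have hn0 : (0 : ℝ) < n := by exact_mod_cast hn
  have h : ∀ j, w j ^ (2 - p) ≤ (n : ℝ) ^ (p - 1) * ((2 - p) * w j + (p - 1) * (1 / n)) := by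
    intro j
    have := Real.geom_mean_le_arith_mean2_weighted (w₁ := 2 - p) (w₂ := p - 1) (by linarith)
      (by linarith) (hw j) (show (0 : ℝ) ≤ 1 / n by positivity) (by ring)
    rw [one_div, Real.inv_rpow hn0.le, ← div_eq_mul_inv,
      div_le_iff₀ (Real.rpow_pos_of_pos hn0 _)] at this
    rw [one_div]; linarith
  calc ∑ j, w j ^ (2 - p) ≤ ∑ j, (n : ℝ) ^ (p - 1) * ((2 - p) * w j + (p - 1) * (1 / n)) :=
        Finset.sum_le_sum fun j _ => h j
    _ = (n : ℝ) ^ (p - 1) * ((2 - p) * ∑ j, w j + (p - 1)) := by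
        rw [← Finset.mul_sum, Finset.sum_add_distrib, ← Finset.mul_sum]
        simp only [Finset.sum_const, Finset.card_univ, Fintype.card_fin, nsmul_eq_mul]
        field_simp
    _ ≤ (n : ℝ) ^ (p - 1) * 2 := by
        gcongr
        nlinarith
    _ = _ := mul_comm _ _

/-- The gradient of the distance-generating function. -/
noncomputable def dgfGrad {n : ℕ} (x : Fin n → ℝ) : Fin n → ℝ :=
  fun j => dgfCoef n / dgfExp n * absPowDeriv (dgfExp n) (x j)

theorem continuous_dgf {n : ℕ} (hn : 2 ≤ n) : Continuous (dgf (n := n)) := by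
  unfold dgf
  have := one_lt_dgfExp hn
  refine continuous_const.mul (continuous_finsetSum _ fun j _ => ?_)
  exact (continuous_abs.comp (continuous_apply j)).rpow_const fun _ => Or.inr (by linarith)

theorem continuous_dgfGrad {n : ℕ} (hn : 2 ≤ n) : Continuous (dgfGrad (n := n)) :=
  continuous_pi fun j => continuous_const.mul
    ((continuous_absPowDeriv (one_lt_dgfExp hn)).comp (continuous_apply j))

theorem hasFDerivAt_dgf {n : ℕ} (hn : 2 ≤ n) (x : Fin n → ℝ) :
    HasFDerivAt (dgf (n := n))
      (∑ j, dgfGrad x j • (ContinuousLinearMap.proj j : (Fin n → ℝ) →L[ℝ] ℝ)) x := by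
  have h : ∀ j : Fin n, HasFDerivAt (fun x : Fin n → ℝ => |x j| ^ dgfExp n)
      (absPowDeriv (dgfExp n) (x j) • (ContinuousLinearMap.proj j : (Fin n → ℝ) →L[ℝ] ℝ)) x := by
    intro j
    exact (hasDerivAt_abs_rpow (x j) (one_lt_dgfExp hn)).comp_hasFDerivAt x
      (ContinuousLinearMap.proj (R := ℝ) (φ := fun _ : Fin n => ℝ) j).hasFDerivAt
  have := (HasFDerivAt.fun_sum (u := Finset.univ) fun j _ => h j).const_mul
    (dgfCoef n / dgfExp n)
  refine this.congr_fderiv ?_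
  rw [Finset.smul_sum]
  simp only [dgfGrad, smul_smul]

/-- Strong convexity of the distance-generating function on the unit ball of `ℓ₁`. -/
theorem dgf_bregman_ge {n : ℕ} (hn : 2 ≤ n) {x z : Fin n → ℝ} (hx : l1 x ≤ 1) (hz : l1 z ≤ 1) :
    1 / 4 * l1 (z - x) ^ 2 ≤ dgf z - dgf x - dgfGrad x ⬝ᵥ (z - x) := by
  set p := dgfExp n with hpdef
  have hp : 1 < p := one_lt_dgfExp hn
  have hp2 : p ≤ 2 := dgfExp_le_two hn
  have hc : 0 < dgfCoef n := dgfCoef_pos hn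
  set w : Fin n → ℝ := fun j => max |x j| |z j| with hw
  have hw0 : ∀ j, 0 ≤ w j := fun j => le_max_of_le_left (abs_nonneg _)
  have hws : ∑ j, w j ≤ 2 := by
    have : ∑ j, w j ≤ ∑ j, (|x j| + |z j|) := Finset.sum_le_sum fun j _ =>
      max_le_add_of_nonneg (abs_nonneg _) (abs_nonneg _)
    rw [Finset.sum_add_distrib] at this
    unfold l1 at hx hz
    linarith
  have h1 : dgf z - dgf x - dgfGrad x ⬝ᵥ (z - x) = dgfCoef n / p *
      ∑ j, (|z j| ^ p - |x j| ^ p - absPowDeriv p (x j) * (z j - x j)) := by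
    simp only [dgf, dgfGrad, dotProduct, Finset.sum_sub_distrib, Pi.sub_apply, mul_sub,
      Finset.mul_sum, ← hpdef, mul_assoc]
  have h2 : dgfCoef n / p * ∑ j, (p * (p - 1) / 2 * w j ^ (p - 2) * (z j - x j) ^ 2) ≤
      dgf z - dgf x - dgfGrad x ⬝ᵥ (z - x) := by
    rw [h1]
    refine mul_le_mul_of_nonneg_left (Finset.sum_le_sum fun j _ => ?_) (by positivity)
    exact abs_rpow_bregman_ge hp hp2 (le_max_left _ _) (le_max_right _ _)
  refine le_trans ?_ h2
  -- Cauchy-Schwarz with the reciprocal weights w_j^(p-2) and w_j^(2-p). A coordinate with w_j = 0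
  -- has x_j = z_j = 0, so the value of 0^(p-2) is immaterial.
  have h3 : l1 (z - x) ^ 2 ≤
      (∑ j, w j ^ (p - 2) * (z j - x j) ^ 2) * ∑ j, w j ^ (2 - p) := by
    refine Finset.sum_sq_le_sum_mul_sum_of_sq_le_mul _ (fun j _ => ?_) (fun j _ => ?_)
      (fun j _ => ?_)
    · have := Real.rpow_nonneg (hw0 j) (p - 2); positivity
    · exact Real.rpow_nonneg (hw0 j) _
    · rcases (hw0 j).eq_or_lt with h0 | h0
      · have hx0 : x j = 0 := abs_eq_zero.1 (le_antisymm (h0 ▸ le_max_left _ _) (abs_nonneg _))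
        have hz0 : z j = 0 := abs_eq_zero.1 (le_antisymm (h0 ▸ le_max_right _ _) (abs_nonneg _))
        simp [hx0, hz0]
      · rw [Pi.sub_apply, sq_abs, mul_right_comm, ← Real.rpow_add h0]
        simp
  have h4 := sum_rpow_le (by omega) hp.le hp2 hw0 hws
  have h5 : 0 ≤ ∑ j, w j ^ (p - 2) * (z j - x j) ^ 2 := Finset.sum_nonneg fun j _ => by
    have := Real.rpow_nonneg (hw0 j) (p - 2); positivity
  -- By the normalization the prefactor is n^(p-1)/2, which meets the 2n^(p-1) of `h4`: the
  -- dimension cancels and the modulus 1/4 is left.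
  have h6 : dgfCoef n / p * ∑ j, (p * (p - 1) / 2 * w j ^ (p - 2) * (z j - x j) ^ 2) =
      (n : ℝ) ^ (p - 1) / 2 * ∑ j, w j ^ (p - 2) * (z j - x j) ^ 2 := by
    rw [← dgfCoef_mul hn, Finset.mul_sum, Finset.mul_sum]
    refine Finset.sum_congr rfl fun j _ => ?_
    rw [← hpdef]
    field_simp
  rw [h6]
  nlinarith [mul_le_mul_of_nonneg_left h4 h5]

theorem dgf_le_of_l1_le {n : ℕ} (hn : 2 ≤ n) {z : Fin n → ℝ} (hz : l1 z ≤ 1) :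
    dgf z ≤ dgfCoef n / dgfExp n := by
  have hp := one_lt_dgfExp hn
  have hc := dgfCoef_pos hn
  have : ∑ j, |z j| ^ dgfExp n ≤ 1 := by
    refine le_trans (Finset.sum_le_sum fun j _ => ?_) hz
    exact Real.rpow_le_self_of_le_one (abs_nonneg _) ((abs_le_l1 z j).trans hz) hp.le
  exact mul_le_of_le_one_right (by positivity) this

theorem dgf_le_dgfMax {n : ℕ} (hn : 2 ≤ n) {z : Fin n → ℝ} (hz : l1 z ≤ 1) : dgf z ≤ dgfMax n :=
  le_csSup ⟨_, by rintro _ ⟨y, hy, rfl⟩; exact dgf_le_of_l1_le hn hy⟩ ⟨z, hz, rfl⟩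

/-- The maximum is attained at a basis vector, where all ℓ_p norms equal 1. -/
theorem dgfMax_eq {n : ℕ} (hn : 2 ≤ n) : dgfMax n = dgfCoef n / dgfExp n := by
  refine le_antisymm (csSup_le ⟨_, 0, by simp [l1], rfl⟩ ?_) ?_
  · rintro _ ⟨y, hy, rfl⟩; exact dgf_le_of_l1_le hn hy
  · have hp := one_lt_dgfExp hn
    let j₀ : Fin n := ⟨0, by omega⟩
    have h : l1 (Pi.single j₀ 1 : Fin n → ℝ) ≤ 1 := by
      simp [l1, Pi.single_apply, apply_ite]
    refine le_trans (le_of_eq ?_) (dgf_le_dgfMax hn h)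
    have : ∀ j, |(Pi.single j₀ 1 : Fin n → ℝ) j| ^ dgfExp n = if j = j₀ then 1 else 0 := by
      intro j
      by_cases hj : j = j₀
      · simp [hj]
      · simp [hj, Real.zero_rpow (show dgfExp n ≠ 0 by linarith)]
    simp [dgf, this]

theorem one_le_dgfMax {n : ℕ} (hn : 2 ≤ n) : 1 ≤ dgfMax n := by
  rw [dgfMax_eq hn]
  unfold dgfCoef dgfExp
  split_ifs with h
  · norm_num
  · have h1 := one_lt_log (n := n) (by omega)
    have h2 : 1 / Real.log n ≤ 1 := by rw [div_le_one (by linarith)]; exact h1.le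
    have h3 : 0 < 1 / Real.log n := by positivity
    rw [le_div_iff₀ (by linarith)]
    nlinarith [Real.exp_one_gt_d9]

theorem log_le_dgfMax {n : ℕ} (hn : 2 ≤ n) : Real.log n ≤ dgfMax n := by
  rw [dgfMax_eq hn]
  unfold dgfCoef dgfExp
  split_ifs with h
  · subst h
    have := Real.log_two_lt_d9
    push_cast
    linarith
  · have h1 := one_lt_log (n := n) (by omega)
    have h2 : 1 / Real.log n ≤ 1 := by rw [div_le_one (by linarith)]; exact h1.le
    have h3 : 0 < 1 / Real.log n := by positivity
    rw [le_div_iff₀ (by linarith)]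
    nlinarith [Real.exp_one_gt_d9]

/-- Together with `log_le_dgfMax` this shows that Θ and ln n are of the same order: the algorithm is
tuned with Θ, the error bounds are stated with ln n. -/
theorem dgfMax_le {n : ℕ} (hn : 2 ≤ n) : dgfMax n ≤ 3 * Real.log n := by
  rw [dgfMax_eq hn]
  unfold dgfCoef dgfExp
  split_ifs with h
  · subst h
    have := Real.log_two_gt_d9
    push_cast
    linarith
  · have h1 := one_lt_log (n := n) (by omega)
    have h3 : 0 < 1 / Real.log n := by positivity
    rw [div_le_iff₀ (by linarith)]
    nlinarith [Real.exp_one_lt_d9]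

/-! ### The localized Bregman divergence -/

/-- The gradient of `localDgf R x₀`. -/
noncomputable def localGrad {n : ℕ} (R : ℝ) (x₀ z : Fin n → ℝ) : Fin n → ℝ :=
  R • dgfGrad (R⁻¹ • (z - x₀))

theorem hasFDerivAt_localDgf {n : ℕ} (hn : 2 ≤ n) {R : ℝ} (hR : 0 < R) (x₀ x : Fin n → ℝ) :
    HasFDerivAt (localDgf R x₀)
      (∑ j, localGrad R x₀ x j • (ContinuousLinearMap.proj j : (Fin n → ℝ) →L[ℝ] ℝ)) x := by
  have h1 : HasFDerivAt (fun z : Fin n → ℝ => R⁻¹ • (z - x₀))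
      (R⁻¹ • ContinuousLinearMap.id ℝ (Fin n → ℝ)) x :=
    ((hasFDerivAt_id x).sub_const x₀).const_smul R⁻¹
  have h2 := ((hasFDerivAt_dgf hn _).comp x h1).const_mul (R ^ 2)
  refine h2.congr_fderiv (ContinuousLinearMap.ext fun v => ?_)
  simp only [localGrad, _root_.sum_apply, _root_.smul_apply,
    ContinuousLinearMap.comp_apply, ContinuousLinearMap.proj_apply, Pi.smul_apply, smul_eq_mul,
    ContinuousLinearMap.id_apply, Finset.mul_sum]
  refine Finset.sum_congr rfl fun j _ => ?_
  field_simp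

theorem bregman_eq {n : ℕ} (hn : 2 ≤ n) {R : ℝ} (hR : 0 < R) (x₀ x z : Fin n → ℝ) :
    bregman R x₀ x z = localDgf R x₀ z - localDgf R x₀ x - localGrad R x₀ x ⬝ᵥ (z - x) := by
  rw [bregman, (hasFDerivAt_localDgf hn hR x₀ x).fderiv]
  simp [dotProduct]

/-- The factor R² and the rescaling by 1/R cancel, so the modulus does not depend on the radius. -/
theorem bregman_ge {n : ℕ} (hn : 2 ≤ n) {R : ℝ} (hR : 0 < R) {x₀ x z : Fin n → ℝ}
    (hx : l1 (x - x₀) ≤ R) (hz : l1 (z - x₀) ≤ R) :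
    1 / 4 * l1 (z - x) ^ 2 ≤ bregman R x₀ x z := by
  have hs : ∀ y : Fin n → ℝ, l1 y ≤ R → l1 (R⁻¹ • y) ≤ 1 := by
    intro y hy
    rw [l1_smul, abs_of_pos (inv_pos.2 hR), inv_mul_le_iff₀ hR, mul_one]; exact hy
  have h := dgf_bregman_ge hn (hs _ hx) (hs _ hz)
  have h1 : R⁻¹ • (z - x₀) - R⁻¹ • (x - x₀) = R⁻¹ • (z - x) := by
    rw [← smul_sub, sub_sub_sub_cancel_right]
  rw [h1, l1_smul, abs_of_pos (inv_pos.2 hR), dotProduct_smul] at h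
  rw [bregman_eq hn hR, localDgf, localDgf, localGrad, smul_dotProduct]
  have h2 := mul_le_mul_of_nonneg_left h (sq_nonneg R)
  have e1 : R ^ 2 * (1 / 4 * (R⁻¹ * l1 (z - x)) ^ 2) = 1 / 4 * l1 (z - x) ^ 2 := by
    field_simp
  rw [e1] at h2
  refine h2.trans_eq ?_
  simp only [smul_eq_mul]
  field_simp

/-- θ and its gradient vanish at the origin, so from the centre the divergence is the localized
function itself. This is the initial potential of a stage. -/
theorem bregman_center_le {n : ℕ} (hn : 2 ≤ n) {R : ℝ} (hR : 0 < R) {x₀ z : Fin n → ℝ}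
    (hz : l1 (z - x₀) ≤ R) : bregman R x₀ x₀ z ≤ R ^ 2 * dgfMax n := by
  have hp := one_lt_dgfExp hn
  have h0 : localGrad R x₀ x₀ = 0 := by
    ext j; simp [localGrad, dgfGrad, absPowDeriv_zero]
  have h1 : localDgf R x₀ x₀ = 0 := by
    simp [localDgf, dgf, Real.zero_rpow (show dgfExp n ≠ 0 by linarith)]
  rw [bregman_eq hn hR, h0, h1, zero_dotProduct, sub_zero, sub_zero, localDgf]
  refine mul_le_mul_of_nonneg_left (dgf_le_dgfMax hn ?_) (sq_nonneg R)
  rw [l1_smul, abs_of_pos (inv_pos.2 hR), inv_mul_le_iff₀ hR, mul_one]; exact hz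

/-- The three-point identity of the Bregman divergence. -/
theorem bregman_three_point {n : ℕ} (hn : 2 ≤ n) {R : ℝ} (hR : 0 < R) (x₀ x y z : Fin n → ℝ) :
    bregman R x₀ x z - bregman R x₀ y z - bregman R x₀ x y =
      (localGrad R x₀ y - localGrad R x₀ x) ⬝ᵥ (z - y) := by
  rw [bregman_eq hn hR, bregman_eq hn hR, bregman_eq hn hR, sub_dotProduct]
  have : z - x = (z - y) + (y - x) := by abel
  rw [this, dotProduct_add]
  ring

end CSMDSR
namespace CSMDSR
open Filter Topology

/-! ### The composite proximal mapping -/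

theorem mem_localBall_self {n : ℕ} {X : Set (Fin n → ℝ)} {R : ℝ} (hR : 0 < R) {x₀ : Fin n → ℝ}
    (hx₀ : x₀ ∈ X) : x₀ ∈ localBall X R x₀ := ⟨hx₀, by simpa [l1_zero] using hR.le⟩

theorem convex_localBall {n : ℕ} {X : Set (Fin n → ℝ)} (hX : Convex ℝ X) (R : ℝ)
    (x₀ : Fin n → ℝ) : Convex ℝ (localBall X R x₀) := by
  intro x hx y hy a b ha hb hab
  refine ⟨hX hx.1 hy.1 ha hb hab, ?_⟩
  have : a • x + b • y - x₀ = a • (x - x₀) + b • (y - x₀) := by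
    conv_lhs => rw [← one_smul ℝ x₀, ← hab]
    rw [add_smul, smul_sub, smul_sub]; abel
  rw [this]
  refine (l1_add_le _ _).trans ?_
  rw [l1_smul, l1_smul, abs_of_nonneg ha, abs_of_nonneg hb]
  have h1 := mul_le_mul_of_nonneg_left hx.2 ha
  have h2 := mul_le_mul_of_nonneg_left hy.2 hb
  calc _ ≤ a * R + b * R := add_le_add h1 h2
    _ = R := by rw [← add_mul, hab, one_mul]

theorem isBounded_l1_le {n : ℕ} (c : ℝ) : Bornology.IsBounded {x : Fin n → ℝ | l1 x ≤ c} := by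
  refine (Metric.isBounded_closedBall (x := (0 : Fin n → ℝ)) (r := c)).subset fun x hx => ?_
  rw [mem_closedBall_zero_iff]
  exact (pi_norm_le_iff_of_nonneg ((l1_nonneg x).trans hx)).2 fun j => (abs_le_l1 x j).trans hx

theorem isCompact_localBall {n : ℕ} {X : Set (Fin n → ℝ)} (hX : IsClosed X) (R : ℝ)
    (x₀ : Fin n → ℝ) : IsCompact (localBall X R x₀) := by
  refine Metric.isCompact_of_isClosed_isBounded ?_ ?_
  · exact hX.inter (isClosed_le (continuous_l1.comp (continuous_id.sub continuous_const))
      continuous_const)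
  · refine (isBounded_l1_le (R + l1 x₀)).subset fun z hz => ?_
    have := l1_le_add_sub z x₀
    have := hz.2
    exact Set.mem_ofPred.2 (by linarith)

theorem continuous_localDgf {n : ℕ} (hn : 2 ≤ n) (R : ℝ) :
    Continuous fun a : (Fin n → ℝ) × (Fin n → ℝ) => localDgf R a.1 a.2 := by
  unfold localDgf
  exact continuous_const.mul ((continuous_dgf hn).comp (by fun_prop))

theorem continuous_localGrad {n : ℕ} (hn : 2 ≤ n) (R : ℝ) :
    Continuous fun a : (Fin n → ℝ) × (Fin n → ℝ) => localGrad R a.1 a.2 := by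
  unfold localGrad
  refine Continuous.const_smul ?_ R
  exact (continuous_dgfGrad hn).comp
    (f := fun a : (Fin n → ℝ) × (Fin n → ℝ) => R⁻¹ • (a.2 - a.1)) (by fun_prop)

theorem continuous_bregman {n : ℕ} (hn : 2 ≤ n) {R : ℝ} (hR : 0 < R) :
    Continuous fun a : (Fin n → ℝ) × (Fin n → ℝ) × (Fin n → ℝ) => bregman R a.1 a.2.1 a.2.2 := by
  simp only [bregman_eq hn hR]
  have h1 := (continuous_localDgf hn R).comp
    (f := fun a : (Fin n → ℝ) × (Fin n → ℝ) × (Fin n → ℝ) => (a.1, a.2.2)) (by fun_prop)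
  have h2 := (continuous_localDgf hn R).comp
    (f := fun a : (Fin n → ℝ) × (Fin n → ℝ) × (Fin n → ℝ) => (a.1, a.2.1)) (by fun_prop)
  have h3 := (continuous_localGrad hn R).comp
    (f := fun a : (Fin n → ℝ) × (Fin n → ℝ) × (Fin n → ℝ) => (a.1, a.2.1)) (by fun_prop)
  refine (h1.sub h2).sub ?_
  exact h3.dotProduct (by fun_prop)

theorem measurable_comp_of_continuousOn {α β γ : Type*} [MeasurableSpace α] [TopologicalSpace β]
    [MeasurableSpace β] [OpensMeasurableSpace β] [TopologicalSpace γ] [MeasurableSpace γ]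
    [BorelSpace γ] {f : β → γ} {S : Set β} (hf : ContinuousOn f S) {g : α → β}
    (hg : Measurable g) (hgS : ∀ a, g a ∈ S) : Measurable fun a => f (g a) := by
  have hc : Measurable (S.domRestrict f) :=
    (continuousOn_iff_continuous_domRestrict.1 hf).measurable
  exact hc.comp (hg.subtype_mk (h := hgS))

/-- The objective of the composite proximal mapping. -/
noncomputable def proxObj {n : ℕ} (R : ℝ) (h : (Fin n → ℝ) → ℝ)
    (a : (Fin n → ℝ) × (Fin n → ℝ) × (Fin n → ℝ)) (y : Fin n → ℝ) : ℝ :=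
  a.2.1 ⬝ᵥ y + h y + bregman R a.1 a.2.2 y

theorem continuous_proxObj {n : ℕ} (hn : 2 ≤ n) {R : ℝ} (hR : 0 < R) {h : (Fin n → ℝ) → ℝ}
    (hh : Continuous h) :
    Continuous fun b : ((Fin n → ℝ) × (Fin n → ℝ) × (Fin n → ℝ)) × (Fin n → ℝ) =>
      proxObj R h b.1 b.2 := by
  unfold proxObj
  have h3 := (continuous_bregman hn hR).comp
    (f := fun b : ((Fin n → ℝ) × (Fin n → ℝ) × (Fin n → ℝ)) × (Fin n → ℝ) =>
      (b.1.1, b.1.2.2, b.2)) (by fun_prop)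
  refine (Continuous.add ?_ (hh.comp continuous_snd)).add h3
  exact Continuous.dotProduct (by fun_prop) (by fun_prop)

/-- The data of a composite proximal mapping. -/
structure ProxData {n : ℕ} (X : Set (Fin n → ℝ)) (R : ℝ) (h : (Fin n → ℝ) → ℝ) : Prop where
  two_le : 2 ≤ n
  convex : Convex ℝ X
  isClosed : IsClosed X
  pos : 0 < R
  convexOn : ConvexOn ℝ Set.univ h
  continuous : Continuous h

namespace ProxData

variable {n : ℕ} {X : Set (Fin n → ℝ)} {R : ℝ} {h : (Fin n → ℝ) → ℝ}

theorem compProx_spec (H : ProxData X R h) {x₀ : Fin n → ℝ} (hx₀ : x₀ ∈ X) (ζ x : Fin n → ℝ) :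
    compProx X R x₀ h ζ x ∈ localBall X R x₀ ∧
      IsMinOn (proxObj R h (x₀, ζ, x)) (localBall X R x₀) (compProx X R x₀ h ζ x) := by
  have hc : Continuous (proxObj R h (x₀, ζ, x)) :=
    (continuous_proxObj H.two_le H.pos H.continuous).comp (Continuous.prodMk_right (x₀, ζ, x))
  obtain ⟨z, hz, hmin⟩ := (isCompact_localBall H.isClosed R x₀).exists_isMinOn
    ⟨x₀, mem_localBall_self H.pos hx₀⟩ hc.continuousOn
  exact Classical.epsilon_spec (p := fun z => z ∈ localBall X R x₀ ∧
    IsMinOn (fun y => ζ ⬝ᵥ y + h y + bregman R x₀ x y) (localBall X R x₀) z) ⟨z, hz, hmin⟩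

/-- First order optimality condition for the composite proximal mapping. -/
theorem optimality (H : ProxData X R h) {x₀ ζ x y z : Fin n → ℝ}
    (hy : y ∈ localBall X R x₀) (hmin : IsMinOn (proxObj R h (x₀, ζ, x)) (localBall X R x₀) y)
    (hz : z ∈ localBall X R x₀) :
    0 ≤ ζ ⬝ᵥ (z - y) + (h z - h y) + (localGrad R x₀ y - localGrad R x₀ x) ⬝ᵥ (z - y) := by
  have hline : HasDerivAt (fun τ : ℝ => y + τ • (z - y)) (z - y) 0 := by
    simpa using ((hasDerivAt_id (0 : ℝ)).smul_const (z - y)).const_add y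
  have hd : HasDerivAt (fun τ : ℝ => τ * (ζ ⬝ᵥ (z - y) + (h z - h y) -
      localGrad R x₀ x ⬝ᵥ (z - y)) + localDgf R x₀ (y + τ • (z - y)))
      ((ζ ⬝ᵥ (z - y) + (h z - h y) - localGrad R x₀ x ⬝ᵥ (z - y)) +
        localGrad R x₀ y ⬝ᵥ (z - y)) 0 := by
    have h2 : HasFDerivAt (localDgf R x₀) (∑ j, localGrad R x₀ y j •
        (ContinuousLinearMap.proj j : (Fin n → ℝ) →L[ℝ] ℝ)) (y + (0 : ℝ) • (z - y)) := by
      rw [zero_smul, add_zero]; exact hasFDerivAt_localDgf H.two_le H.pos x₀ y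
    have h3 := ((hasDerivAt_id (0 : ℝ)).mul_const (ζ ⬝ᵥ (z - y) + (h z - h y) -
      localGrad R x₀ x ⬝ᵥ (z - y))).add (h2.comp_hasDerivAt (0 : ℝ) hline)
    refine h3.congr_deriv ?_
    simp [dotProduct]
  -- `h` need not be differentiable. By convexity its increment along the segment is at most τ(h z -
  -- h y), so only the smooth part has to be differentiated at τ = 0.
  have hnn : ∀ τ ∈ Set.Ioo (0 : ℝ) 1, localDgf R x₀ y ≤ τ * (ζ ⬝ᵥ (z - y) + (h z - h y) -
      localGrad R x₀ x ⬝ᵥ (z - y)) + localDgf R x₀ (y + τ • (z - y)) := by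
    intro τ hτ
    have e : y + τ • (z - y) = (1 - τ) • y + τ • z := by
      rw [smul_sub, sub_smul, one_smul]; abel
    have hmem : y + τ • (z - y) ∈ localBall X R x₀ := by
      rw [e]
      exact convex_localBall H.convex R x₀ hy hz (by linarith [hτ.2]) hτ.1.le (by ring)
    have h1 := hmin hmem
    have h2 := H.convexOn.2 (Set.mem_univ y) (Set.mem_univ z) (by linarith [hτ.2] : 0 ≤ 1 - τ)
      hτ.1.le (by ring)
    rw [← e] at h2
    simp only [proxObj, Set.mem_ofPred_eq, bregman_eq H.two_le H.pos, smul_eq_mul] at h1 h2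
    have e2 : y + τ • (z - y) - x = (y - x) + τ • (z - y) := by abel
    rw [e2, dotProduct_add, dotProduct_add, dotProduct_smul, dotProduct_smul, smul_eq_mul,
      smul_eq_mul] at h1
    nlinarith
  have hlim := hd.tendsto_slope_zero_right
  rw [sub_dotProduct]
  have : 0 ≤ (ζ ⬝ᵥ (z - y) + (h z - h y) - localGrad R x₀ x ⬝ᵥ (z - y)) +
        localGrad R x₀ y ⬝ᵥ (z - y) := by
    refine ge_of_tendsto hlim ?_
    filter_upwards [Ioo_mem_nhdsGT (show (0 : ℝ) < 1 by norm_num)] with τ hτ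
    have := hnn τ hτ
    simp only [zero_add, zero_smul, add_zero, zero_mul, smul_eq_mul]
    exact mul_nonneg (inv_nonneg.2 hτ.1.le) (by linarith)
  linarith

/-- Optimality combined with the three-point identity; its divergences telescope when the steps are
summed. -/
theorem three_point (H : ProxData X R h) {x₀ ζ x y z : Fin n → ℝ}
    (hy : y ∈ localBall X R x₀) (hmin : IsMinOn (proxObj R h (x₀, ζ, x)) (localBall X R x₀) y)
    (hz : z ∈ localBall X R x₀) :
    ζ ⬝ᵥ (y - z) + (h y - h z) ≤
      bregman R x₀ x z - bregman R x₀ y z - bregman R x₀ x y := by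
  have h1 := H.optimality hy hmin hz
  rw [bregman_three_point H.two_le H.pos]
  have : ζ ⬝ᵥ (y - z) = -(ζ ⬝ᵥ (z - y)) := by rw [← dotProduct_neg, neg_sub]
  linarith

/-- Comparing two minimizers by the three-point inequality forces their divergence to be
nonpositive, and strong convexity makes them equal. Uniqueness is what makes the choice in
`compProx` continuous. -/
theorem eq_of_isMinOn (H : ProxData X R h) {x₀ ζ x y z : Fin n → ℝ}
    (hy : y ∈ localBall X R x₀) (hmin : IsMinOn (proxObj R h (x₀, ζ, x)) (localBall X R x₀) y)
    (hz : z ∈ localBall X R x₀)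
    (hmin' : IsMinOn (proxObj R h (x₀, ζ, x)) (localBall X R x₀) z) : z = y := by
  have h1 := H.three_point hy hmin hz
  have h2 := hmin' hy
  have h3 := bregman_ge H.two_le H.pos hy.2 hz.2
  simp only [proxObj, Set.mem_ofPred_eq] at h2
  rw [dotProduct_sub] at h1
  have h4 : l1 (z - y) ^ 2 ≤ 0 := by linarith
  have h5 : l1 (z - y) = 0 := by
    have := sq_nonneg (l1 (z - y))
    exact pow_eq_zero_iff two_ne_zero |>.1 (le_antisymm h4 this)
  refine sub_eq_zero.1 (funext fun j => ?_)
  have := abs_le_l1 (z - y) j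
  rw [h5] at this
  exact abs_nonpos_iff.1 this

/-- Joint continuity of the composite proximal mapping in the center, the linear term and the
prox-center. -/
theorem continuousOn_compProx (H : ProxData X R h) :
    ContinuousOn (fun a : (Fin n → ℝ) × (Fin n → ℝ) × (Fin n → ℝ) =>
      compProx X R a.1 h a.2.1 a.2.2) {a | a.1 ∈ X} := by
  intro a ha
  -- Minimizers along a convergent sequence of data stay bounded; a cluster point minimizes the
  -- limit problem and is therefore its unique solution.
  refine tendsto_of_subseq_tendsto fun ns hns => ?_
  have hmem : ∀ᶠ k in atTop, (ns k).1 ∈ X := hns.eventually self_mem_nhdsWithin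
  have hlim : Tendsto ns atTop (𝓝 a) := tendsto_nhds_of_tendsto_nhdsWithin hns
  have hlim1 : Tendsto (fun k => (ns k).1) atTop (𝓝 a.1) :=
    (continuous_fst.tendsto a).comp hlim
  set y : ℕ → Fin n → ℝ := fun k => compProx X R (ns k).1 h (ns k).2.1 (ns k).2.2 with hy
  have hbd : ∀ᶠ k in atTop, y k ∈ {x : Fin n → ℝ | l1 x ≤ R + (l1 a.1 + 1)} := by
    have hl : ∀ᶠ k in atTop, l1 (ns k).1 < l1 a.1 + 1 :=
      ((continuous_l1.tendsto a.1).comp hlim1).eventually (gt_mem_nhds (lt_add_one _))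
    filter_upwards [hmem, hl] with k hk hk2
    have h1 : l1 (y k - (ns k).1) ≤ R := (H.compProx_spec hk (ns k).2.1 (ns k).2.2).1.2
    have h2 := l1_le_add_sub (y k) (ns k).1
    change l1 (y k) ≤ R + (l1 a.1 + 1)
    linarith
  obtain ⟨y₀, -, ms, hms, hy₀⟩ := tendsto_subseq_of_frequently_bounded (isBounded_l1_le _)
    hbd.frequently
  refine ⟨ms, ?_⟩
  have hlim' := hlim.comp hms.tendsto_atTop
  have hlim1' := hlim1.comp hms.tendsto_atTop
  have hmem' := hms.tendsto_atTop.eventually hmem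
  have hy₀X : y₀ ∈ localBall X R a.1 := by
    constructor
    · refine H.isClosed.mem_of_tendsto hy₀ ?_
      filter_upwards [hmem'] with k hk using (H.compProx_spec hk _ _).1.1
    · refine le_of_tendsto ((continuous_l1.tendsto _).comp (hy₀.sub hlim1')) ?_
      filter_upwards [hmem'] with k hk using (H.compProx_spec hk _ _).1.2
  have hF := continuous_proxObj H.two_le H.pos H.continuous
  have hmin : IsMinOn (proxObj R h a) (localBall X R a.1) y₀ := by
    intro z hz
    -- The feasible set moves with the centre. A competitor `z` for the limit centre is pulled
    -- towards the centre `b` by the factor R/(R + |b - a|₁), which makes it feasible there and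
    -- tends to 1.
    set c : (Fin n → ℝ) → ℝ := fun b => R / (R + l1 (b - a.1)) with hc
    set w : (Fin n → ℝ) → Fin n → ℝ := fun b => (1 - c b) • b + c b • z with hw
    have hpos : ∀ b, 0 < R + l1 (b - a.1) := fun b => by
      have := l1_nonneg (b - a.1); linarith [H.pos]
    have hcc : Continuous c := continuous_const.div
      (continuous_const.add (continuous_l1.comp (continuous_id.sub continuous_const)))
      fun b => (hpos b).ne'
    have hwc : Continuous w := ((continuous_const.sub hcc).smul continuous_id).add
      (hcc.smul continuous_const)
    have hwa : w a.1 = z := by simp [hw, hc, l1_zero, H.pos.ne']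
    have hwmem : ∀ b ∈ X, w b ∈ localBall X R b := by
      intro b hb
      have hc0 : 0 ≤ c b := div_nonneg H.pos.le (hpos b).le
      have hc1 : c b ≤ 1 := by
        rw [hc, div_le_one (hpos b)]
        have := l1_nonneg (b - a.1); linarith
      refine ⟨H.convex hb hz.1 (by linarith) hc0 (by ring), ?_⟩
      have e : w b - b = c b • (z - b) := by
        simp only [hw]; rw [sub_smul, one_smul, smul_sub]; abel
      rw [e, l1_smul, abs_of_nonneg hc0, hc, div_mul_eq_mul_div, div_le_iff₀ (hpos b)]
      refine mul_le_mul_of_nonneg_left ?_ H.pos.le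
      have h1 := l1_sub_le z a.1 b
      rw [l1_sub_comm a.1 b] at h1
      linarith [hz.2]
    have t1 : Tendsto (fun k => proxObj R h (ns (ms k)) (y (ms k))) atTop
        (𝓝 (proxObj R h a y₀)) :=
      Tendsto.comp (g := fun b : ((Fin n → ℝ) × (Fin n → ℝ) × (Fin n → ℝ)) × (Fin n → ℝ) =>
        proxObj R h b.1 b.2) (f := fun k => (ns (ms k), y (ms k))) (hF.tendsto (a, y₀))
        (Tendsto.prodMk_nhds hlim' hy₀)
    have t2 : Tendsto (fun k => proxObj R h (ns (ms k)) (w (ns (ms k)).1)) atTop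
        (𝓝 (proxObj R h a z)) := by
      have hwl : Tendsto (fun k => w (ns (ms k)).1) atTop (𝓝 z) := by
        have := (hwc.tendsto a.1).comp hlim1'
        rwa [hwa] at this
      exact Tendsto.comp (g := fun b : ((Fin n → ℝ) × (Fin n → ℝ) × (Fin n → ℝ)) × (Fin n → ℝ) =>
        proxObj R h b.1 b.2) (f := fun k => (ns (ms k), w (ns (ms k)).1)) (hF.tendsto (a, z))
        (Tendsto.prodMk_nhds hlim' hwl)
    refine le_of_tendsto_of_tendsto t1 t2 ?_
    filter_upwards [hmem'] with k hk
    exact (H.compProx_spec hk _ _).2 (hwmem _ hk)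
  have hspec := H.compProx_spec ha a.2.1 a.2.2
  have : y₀ = compProx X R a.1 h a.2.1 a.2.2 := H.eq_of_isMinOn hspec.1 hspec.2 hy₀X hmin
  rw [this] at hy₀
  exact hy₀

/-- This makes all iterates measurable functions of the observations, as the probabilistic part
requires. -/
theorem measurable_compProx (H : ProxData X R h) {α : Type*} [MeasurableSpace α]
    {x₀ ζ x : α → Fin n → ℝ} (hx₀ : Measurable x₀) (hζ : Measurable ζ) (hx : Measurable x)
    (hmem : ∀ a, x₀ a ∈ X) : Measurable fun a => compProx X R (x₀ a) h (ζ a) (x a) :=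
  measurable_comp_of_continuousOn H.continuousOn_compProx
    (g := fun a => (x₀ a, ζ a, x a)) (hx₀.prodMk (hζ.prodMk hx)) hmem

end ProxData

theorem proxData_l1 {n : ℕ} (hn : 2 ≤ n) {X : Set (Fin n → ℝ)} (hX : Convex ℝ X)
    (hXc : IsClosed X) {R : ℝ} (hR : 0 < R) {γ κ : ℝ} (hγ : 0 ≤ γ) (hκ : 0 ≤ κ) :
    ProxData X R (fun z => γ * (κ * l1 z)) where
  two_le := hn
  convex := hX
  isClosed := hXc
  pos := hR
  convexOn := (convexOn_l1.smul hκ).smul hγ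
  continuous := continuous_const.mul (continuous_const.mul continuous_l1)

end CSMDSR
namespace CSMDSR

/-! ### One stage: the deterministic part -/

/-- The deterministic assumptions of the sparse generalized linear regression problem. -/
structure Model {n : ℕ} (q : Params) (X : Set (Fin n → ℝ)) (act : ℝ → ℝ) (xs : Fin n → ℝ) :
    Prop where
  two_le : 2 ≤ n
  one_le_s : 1 ≤ q.s
  sig_pos : 0 < q.sig
  kapSig_pos : 0 < q.kapSig
  rLow_pos : 0 < q.rLow
  nuBar_pos : 0 < q.nuBar
  kapSig_le : q.kapSig ≤ q.nuBar ^ 2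
  convex : Convex ℝ X
  isClosed : IsClosed X
  mem : xs ∈ X
  sparse : (Finset.univ.filter fun j => xs j ≠ 0).card ≤ q.s
  mono : Monotone act
  lip : ∀ u v, |act u - act v| ≤ q.rUp * |u - v|
  low : ∀ u v, q.rLow * |u - v| ≤ |act u - act v|

/-- The observations `(φ, 𝔯(φᵀ x) + σ ξ)` that correspond to the sequence of the `(φ, ξ)`. -/
def obsSeq {n : ℕ} (act : ℝ → ℝ) (xs : Fin n → ℝ) (sig : ℝ) (u : ℕ → (Fin n → ℝ) × ℝ) (i : ℕ) :
    (Fin n → ℝ) × ℝ :=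
  ((u i).1, act ((u i).1 ⬝ᵥ xs) + sig * (u i).2)

/-- The average of `ξ φ` over a batch. -/
noncomputable def noiseAvg {n : ℕ} (L : ℕ) (u : ℕ → (Fin n → ℝ) × ℝ) : Fin n → ℝ :=
  (L : ℝ)⁻¹ • ∑ l ∈ Finset.range L, (u l).2 • (u l).1

/-- The noiseless part of the averaged stochastic gradient. -/
noncomputable def driftAvg {n : ℕ} (act : ℝ → ℝ) (xs : Fin n → ℝ) (L : ℕ)
    (u : ℕ → (Fin n → ℝ) × ℝ) (x : Fin n → ℝ) : Fin n → ℝ :=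
  (L : ℝ)⁻¹ • ∑ l ∈ Finset.range L, (act ((u l).1 ⬝ᵥ x) - act ((u l).1 ⬝ᵥ xs)) • (u l).1

/-- The average over a batch of `(𝔯(φᵀ x) - 𝔯(φᵀ x_*)) φᵀ (x - x_*)`. -/
noncomputable def gapAvg {n : ℕ} (act : ℝ → ℝ) (xs : Fin n → ℝ) (L : ℕ)
    (u : ℕ → (Fin n → ℝ) × ℝ) (x : Fin n → ℝ) : ℝ :=
  (L : ℝ)⁻¹ * ∑ l ∈ Finset.range L,
    (act ((u l).1 ⬝ᵥ x) - act ((u l).1 ⬝ᵥ xs)) * ((u l).1 ⬝ᵥ (x - xs))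

theorem batchGrad_obsSeq {n : ℕ} (act : ℝ → ℝ) (xs : Fin n → ℝ) (sig : ℝ) (L : ℕ)
    (u : ℕ → (Fin n → ℝ) × ℝ) (x : Fin n → ℝ) :
    batchGrad act L (obsSeq act xs sig u) x = driftAvg act xs L u x - sig • noiseAvg L u := by
  rw [batchGrad, driftAvg, noiseAvg, smul_comm sig, ← smul_sub]
  congr 1
  rw [Finset.smul_sum, ← Finset.sum_sub_distrib]
  refine Finset.sum_congr rfl fun l _ => ?_
  rw [stochGrad, obsSeq, smul_smul, ← sub_smul]
  congr 1; ring

theorem smul_sum_smul_dotProduct {n : ℕ} (L : ℕ) (c : ℕ → ℝ) (a : ℕ → Fin n → ℝ) (k : ℝ)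
    (v : Fin n → ℝ) : (k • ∑ l ∈ Finset.range L, c l • a l) ⬝ᵥ v =
      k * ∑ l ∈ Finset.range L, c l * (a l ⬝ᵥ v) := by
  rw [smul_dotProduct, sum_dotProduct, smul_eq_mul]
  simp only [smul_dotProduct, smul_eq_mul]

theorem abs_dotProduct_le_norm {n : ℕ} (a x : Fin n → ℝ) : |a ⬝ᵥ x| ≤ ‖a‖ * l1 x :=
  abs_dotProduct_le (fun j => norm_le_pi_norm a j) x

namespace Model

variable {n : ℕ} {q : Params} {X : Set (Fin n → ℝ)} {act : ℝ → ℝ} {xs : Fin n → ℝ}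

theorem rLow_le (H : Model q X act xs) : q.rLow ≤ q.rUp := by
  have := (H.low 1 0).trans (H.lip 1 0)
  simpa using this

theorem rUp_pos (H : Model q X act xs) : 0 < q.rUp := H.rLow_pos.trans_le H.rLow_le

theorem nu_pos (H : Model q X act xs) : 0 < q.nu :=
  mul_pos H.rUp_pos (pow_pos H.nuBar_pos 2)

theorem rho_pos (H : Model q X act xs) : 0 < q.rho := inv_pos.2 (mul_pos H.kapSig_pos H.rLow_pos)

theorem sigStar_pos (H : Model q X act xs) : 0 < q.sigStar := mul_pos H.sig_pos H.nuBar_pos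

theorem s_pos (H : Model q X act xs) : (0 : ℝ) < q.s := by exact_mod_cast H.one_le_s

/-- The modulus of monotonicity cannot exceed the Lipschitz constant, nor κ_Σ a diagonal entry of Σ.
Hence stage lengths are at least 1 before rounding, and rounding up at most doubles them. -/
theorem one_le_rho_mul_nu (H : Model q X act xs) : 1 ≤ q.rho * q.nu := by
  rw [Params.rho, Params.nu, inv_mul_eq_div, one_le_div (mul_pos H.kapSig_pos H.rLow_pos), mul_comm]
  exact mul_le_mul H.rLow_le H.kapSig_le H.kapSig_pos.le H.rUp_pos.le

theorem gap_eq_abs (H : Model q X act xs) (a b : ℝ) :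
    (act a - act b) * (a - b) = |act a - act b| * |a - b| := by
  rw [← abs_mul, abs_of_nonneg]
  rcases le_total a b with h | h
  · exact mul_nonneg_of_nonpos_of_nonpos (sub_nonpos.2 (H.mono h)) (sub_nonpos.2 h)
  · exact mul_nonneg (sub_nonneg.2 (H.mono h)) (sub_nonneg.2 h)

/-- Co-coercivity of a monotone Lipschitz function. It lets the size of the noiseless gradient be
charged to the gap, which vanishes at x_*. -/
theorem sq_le_gap (H : Model q X act xs) (a b : ℝ) :
    (act a - act b) ^ 2 ≤ q.rUp * ((act a - act b) * (a - b)) := by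
  rw [H.gap_eq_abs, ← sq_abs]
  nlinarith [H.lip a b, abs_nonneg (act a - act b)]

theorem gap_ge (H : Model q X act xs) (a b : ℝ) :
    q.rLow * (a - b) ^ 2 ≤ (act a - act b) * (a - b) := by
  rw [H.gap_eq_abs, ← sq_abs]
  nlinarith [H.low a b, abs_nonneg (a - b)]

theorem gapAvg_ge (H : Model q X act xs) (L : ℕ) (u : ℕ → (Fin n → ℝ) × ℝ) (x : Fin n → ℝ) :
    (L : ℝ)⁻¹ * ∑ l ∈ Finset.range L, q.rLow * ((u l).1 ⬝ᵥ (x - xs)) ^ 2 ≤ gapAvg act xs L u x := by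
  refine mul_le_mul_of_nonneg_left (Finset.sum_le_sum fun l _ => ?_) (by positivity)
  rw [dotProduct_sub]
  exact H.gap_ge _ _

/-- Cauchy-Schwarz over the batch, then co-coercivity for each observation. The norm on `Fin n → ℝ`
is the uniform norm, dual to ℓ₁. -/
theorem norm_driftAvg_sq_le (H : Model q X act xs) {L : ℕ} (hL : 0 < L)
    {u : ℕ → (Fin n → ℝ) × ℝ} (hu : ∀ l < L, ∀ j, |(u l).1 j| ≤ q.nuBar) (x : Fin n → ℝ) :
    ‖driftAvg act xs L u x‖ ^ 2 ≤ q.nu * gapAvg act xs L u x := by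
  have hL0 : (0 : ℝ) < L := by exact_mod_cast hL
  set d : ℕ → ℝ := fun l => act ((u l).1 ⬝ᵥ x) - act ((u l).1 ⬝ᵥ xs) with hd
  have h1 : ‖driftAvg act xs L u x‖ ≤ (L : ℝ)⁻¹ * ∑ l ∈ Finset.range L, |d l| * q.nuBar := by
    rw [driftAvg, norm_smul, Real.norm_of_nonneg (by positivity : (0 : ℝ) ≤ (L : ℝ)⁻¹)]
    refine mul_le_mul_of_nonneg_left ((norm_sum_le _ _).trans (Finset.sum_le_sum fun l hl => ?_))
      (by positivity)
    rw [norm_smul, Real.norm_eq_abs]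
    exact mul_le_mul_of_nonneg_left ((pi_norm_le_iff_of_nonneg H.nuBar_pos.le).2
      (hu l (Finset.mem_range.1 hl))) (abs_nonneg _)
  have h2 : (∑ l ∈ Finset.range L, |d l| * q.nuBar) ^ 2 ≤
      L * ∑ l ∈ Finset.range L, (|d l| * q.nuBar) ^ 2 := by
    simpa using sq_sum_le_card_mul_sum_sq (s := Finset.range L) (f := fun l => |d l| * q.nuBar)
  have h3 : ∑ l ∈ Finset.range L, (|d l| * q.nuBar) ^ 2 ≤
      ∑ l ∈ Finset.range L, q.nu * (d l * ((u l).1 ⬝ᵥ (x - xs))) := by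
    refine Finset.sum_le_sum fun l _ => ?_
    have := H.sq_le_gap ((u l).1 ⬝ᵥ x) ((u l).1 ⬝ᵥ xs)
    rw [mul_pow, sq_abs, Params.nu, dotProduct_sub]
    nlinarith [mul_le_mul_of_nonneg_right this (sq_nonneg q.nuBar)]
  rw [← Finset.mul_sum] at h3
  calc ‖driftAvg act xs L u x‖ ^ 2 ≤ ((L : ℝ)⁻¹ * ∑ l ∈ Finset.range L, |d l| * q.nuBar) ^ 2 :=
        pow_le_pow_left₀ (norm_nonneg _) h1 2
    _ ≤ (L : ℝ)⁻¹ ^ 2 * (L * (q.nu * ∑ l ∈ Finset.range L, d l * ((u l).1 ⬝ᵥ (x - xs)))) := by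
        rw [mul_pow]
        exact mul_le_mul_of_nonneg_left (h2.trans (mul_le_mul_of_nonneg_left h3 hL0.le))
          (by positivity)
    _ = q.nu * gapAvg act xs L u x := by
        simp only [hd, gapAvg]; field_simp

/-- One step of composite mirror descent. -/
theorem step_le (H : Model q X act xs) {R γ κ : ℝ} {L : ℕ} (hR : 0 < R) (hγ : 0 < γ)
    (hγν : γ * q.nu ≤ 1 / 4) (hκ : 0 ≤ κ) (hL : 0 < L) {u : ℕ → (Fin n → ℝ) × ℝ}
    (hu : ∀ l < L, ∀ j, |(u l).1 j| ≤ q.nuBar) {x₀ y y' : Fin n → ℝ} (hx₀ : x₀ ∈ X)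
    (hy : y ∈ localBall X R x₀) (hxs : xs ∈ localBall X R x₀)
    (hy' : y' = compProx X R x₀ (fun z => γ * (κ * l1 z))
      (γ • batchGrad act L (obsSeq act xs q.sig u) y) y) :
    γ / 2 * gapAvg act xs L u y + γ * κ * (l1 y' - l1 xs) ≤
      bregman R x₀ y xs - bregman R x₀ y' xs +
        γ * q.sig * ((L : ℝ)⁻¹ * ∑ l ∈ Finset.range L, (u l).2 * ((u l).1 ⬝ᵥ (y - xs))) +
        2 * γ ^ 2 * q.sig ^ 2 * ‖noiseAvg L u‖ ^ 2 := by
  have D := proxData_l1 H.two_le H.convex H.isClosed hR hγ.le hκ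
  have hspec := D.compProx_spec hx₀ (γ • batchGrad act L (obsSeq act xs q.sig u) y) y
  rw [← hy'] at hspec
  have h1 := D.three_point hspec.1 hspec.2 hxs
  have h2 := bregman_ge H.two_le hR hy.2 hspec.1.2
  set G := batchGrad act L (obsSeq act xs q.sig u) y with hG
  rw [batchGrad_obsSeq] at hG
  have h3 : (γ • G) ⬝ᵥ (y' - xs) = γ * (G ⬝ᵥ (y - xs)) + γ * (G ⬝ᵥ (y' - y)) := by
    rw [smul_dotProduct, smul_eq_mul, ← mul_add, ← dotProduct_add]
    congr 2; abel
  have h4 : G ⬝ᵥ (y - xs) = gapAvg act xs L u y -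
      q.sig * ((L : ℝ)⁻¹ * ∑ l ∈ Finset.range L, (u l).2 * ((u l).1 ⬝ᵥ (y - xs))) := by
    rw [hG, sub_dotProduct, smul_dotProduct, noiseAvg, driftAvg, smul_sum_smul_dotProduct,
      smul_sum_smul_dotProduct, gapAvg, smul_eq_mul]
  have h5 : -(‖G‖ * l1 (y' - y)) ≤ G ⬝ᵥ (y' - y) := (abs_le.1 (abs_dotProduct_le_norm _ _)).1
  have h6 : ‖G‖ ^ 2 ≤ 2 * (q.nu * gapAvg act xs L u y) + 2 * q.sig ^ 2 * ‖noiseAvg L u‖ ^ 2 := by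
    have e1 : ‖G‖ ≤ ‖driftAvg act xs L u y‖ + q.sig * ‖noiseAvg L u‖ := by
      rw [hG]
      refine (norm_sub_le _ _).trans_eq ?_
      rw [norm_smul, Real.norm_of_nonneg H.sig_pos.le]
    have e2 := H.norm_driftAvg_sq_le hL hu y
    have e3 := pow_le_pow_left₀ (norm_nonneg _) e1 2
    nlinarith [sq_nonneg (‖driftAvg act xs L u y‖ - q.sig * ‖noiseAvg L u‖)]
  have h7 : 0 ≤ gapAvg act xs L u y := by
    refine le_trans ?_ (H.gapAvg_ge L u y)
    have := H.rLow_pos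
    positivity
  -- Young's inequality, with the coefficient 1/4 that strong convexity provides in `h2`.
  have h8 : γ * (‖G‖ * l1 (y' - y)) ≤ γ ^ 2 * ‖G‖ ^ 2 + 1 / 4 * l1 (y' - y) ^ 2 := by
    nlinarith [sq_nonneg (γ * ‖G‖ - 1 / 2 * l1 (y' - y))]
  -- The drift contributes 2γ²ν times the gap, at most half of the term γ · gap because γν ≤ 1/4.
  have h9 : γ ^ 2 * ‖G‖ ^ 2 ≤ γ / 2 * gapAvg act xs L u y +
      2 * γ ^ 2 * q.sig ^ 2 * ‖noiseAvg L u‖ ^ 2 := by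
    have e1 := mul_le_mul_of_nonneg_left h6 (sq_nonneg γ)
    have e2 := mul_le_mul_of_nonneg_left hγν (mul_nonneg hγ.le h7)
    nlinarith
  rw [h3, h4] at h1
  have h10 := mul_le_mul_of_nonneg_left h5 hγ.le
  nlinarith

theorem csmdIter_mem (H : Model q X act xs) {R γ κ : ℝ} (hR : 0 < R) (hγ : 0 ≤ γ) (hκ : 0 ≤ κ)
    {x₀ : Fin n → ℝ} (hx₀ : x₀ ∈ X) (L : ℕ) (o : ℕ → (Fin n → ℝ) × ℝ) (i : ℕ) :
    csmdIter X act x₀ γ κ R L o i ∈ localBall X R x₀ := by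
  cases i with
  | zero => exact mem_localBall_self hR hx₀
  | succ i =>
    exact ((proxData_l1 H.two_le H.convex H.isClosed hR hγ hκ).compProx_spec hx₀ _ _).1

/-- The average of points of a convex set belongs to it. -/
theorem csmd_mem (H : Model q X act xs) {R γ κ : ℝ} (hR : 0 < R) (hγ : 0 ≤ γ) (hκ : 0 ≤ κ)
    {x₀ : Fin n → ℝ} (hx₀ : x₀ ∈ X) {m : ℕ} (hm : 0 < m) (L : ℕ) (o : ℕ → (Fin n → ℝ) × ℝ) :
    csmd X act x₀ γ κ R m L o ∈ X := by
  have hm0 : (0 : ℝ) < m := by exact_mod_cast hm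
  rw [csmd, Finset.smul_sum]
  refine H.convex.sum_mem (fun _ _ => by positivity) ?_
    fun i _ => (H.csmdIter_mem hR hγ hκ hx₀ L o i).1
  simp [hm0.ne']

/-- The sum of the one-step bounds over a stage. -/
theorem sum_step_le (H : Model q X act xs) {R γ κ : ℝ} {L : ℕ} (hR : 0 < R) (hγ : 0 < γ)
    (hγν : γ * q.nu ≤ 1 / 4) (hκ : 0 ≤ κ) (hL : 0 < L) {u : ℕ → (Fin n → ℝ) × ℝ}
    (hu : ∀ l, ∀ j, |(u l).1 j| ≤ q.nuBar) {x₀ : Fin n → ℝ} (hx₀ : x₀ ∈ X)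
    (hxs : l1 (x₀ - xs) ≤ R) {y : ℕ → Fin n → ℝ}
    (hy : y = csmdIter X act x₀ γ κ R L (obsSeq act xs q.sig u)) (m : ℕ) :
    γ / 2 * ∑ i ∈ Finset.range m, gapAvg act xs L (fun l => u (i * L + l)) (y i) +
        γ * κ * ∑ i ∈ Finset.range m, (l1 (y i) - l1 xs) ≤
      R ^ 2 * dgfMax n + γ * κ * R +
        γ * q.sig * ∑ i ∈ Finset.range m, (L : ℝ)⁻¹ * ∑ l ∈ Finset.range L,
          (u (i * L + l)).2 * ((u (i * L + l)).1 ⬝ᵥ (y i - xs)) +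
        2 * γ ^ 2 * q.sig ^ 2 *
          ∑ i ∈ Finset.range m, ‖noiseAvg L (fun l => u (i * L + l))‖ ^ 2 := by
  have hxs' : xs ∈ localBall X R x₀ := ⟨H.mem, by rw [l1_sub_comm]; exact hxs⟩
  have hmem : ∀ i, y i ∈ localBall X R x₀ := fun i => by
    rw [hy]; exact H.csmdIter_mem hR hγ.le hκ hx₀ L _ i
  have hstep : ∀ i, γ / 2 * gapAvg act xs L (fun l => u (i * L + l)) (y i) +
      γ * κ * (l1 (y (i + 1)) - l1 xs) ≤
      bregman R x₀ (y i) xs - bregman R x₀ (y (i + 1)) xs +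
        γ * q.sig * ((L : ℝ)⁻¹ * ∑ l ∈ Finset.range L, (u (i * L + l)).2 *
          ((u (i * L + l)).1 ⬝ᵥ (y i - xs))) +
        2 * γ ^ 2 * q.sig ^ 2 * ‖noiseAvg L (fun l => u (i * L + l))‖ ^ 2 := by
    intro i
    refine H.step_le hR hγ hγν hκ hL (u := fun l => u (i * L + l)) (fun l _ => hu _) hx₀ (hmem i)
      hxs' ?_
    rw [hy]; rfl
  have hsum := Finset.sum_le_sum fun i (_ : i ∈ Finset.range m) => hstep i
  simp only [Finset.sum_add_distrib, ← Finset.mul_sum] at hsum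
  rw [Finset.sum_range_sub' (fun i => bregman R x₀ (y i) xs) m] at hsum
  have h0 : y 0 = x₀ := by rw [hy]; rfl
  have hV0 : bregman R x₀ (y 0) xs ≤ R ^ 2 * dgfMax n := by
    rw [h0]; exact bregman_center_le H.two_le hR hxs'.2
  have hVm : 0 ≤ bregman R x₀ (y m) xs :=
    le_trans (by positivity) (bregman_ge H.two_le hR (hmem m).2 hxs'.2)
  -- A step penalizes the new iterate, whereas the output averages the iterates 0, …, m - 1. The
  -- shift of index costs |y_0|₁ - |y_m|₁ ≤ R, hence the term γκR.
  have hshift : ∑ i ∈ Finset.range m, (l1 (y i) - l1 xs) =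
      ∑ i ∈ Finset.range m, (l1 (y (i + 1)) - l1 xs) + (l1 (y 0) - l1 (y m)) := by
    have := Finset.sum_range_sub' (fun i => l1 (y i)) m
    rw [← this, ← Finset.sum_add_distrib]
    exact Finset.sum_congr rfl fun i _ => by ring
  have hl : l1 (y 0) - l1 (y m) ≤ R := by
    have h1 := l1_le_add_sub (y 0) (y m)
    have h2 := (hmem m).2
    rw [l1_sub_comm, h0] at h1
    rw [h0]; linarith
  have hl' := mul_le_mul_of_nonneg_left hl (mul_nonneg hγ.le hκ)
  rw [hshift, mul_add]
  simp only [← Finset.mul_sum]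
  linarith

end Model

theorem sum_range_mul_eq (f : ℕ → ℝ) (m L : ℕ) :
    ∑ j ∈ Finset.range (m * L), f j =
      ∑ i ∈ Finset.range m, ∑ l ∈ Finset.range L, f (i * L + l) := by
  induction m with
  | zero => simp
  | succ m ih => rw [add_one_mul, Finset.sum_range_add, ih, Finset.sum_range_succ]

/-! ### Sparse recovery and the halving of the error. -/

namespace Model

variable {n : ℕ} {q : Params} {X : Set (Fin n → ℝ)} {act : ℝ → ℝ} {xs : Fin n → ℝ}

/-- Recovery of a sparse vector from a bound for the penalized quadratic error. -/
theorem l1_le_of_penalized (H : Model q X act xs) {R ε κ : ℝ} (hR : 0 < R) {x : Fin n → ℝ}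
    (hκ : κ = R / (16 * (q.rho * q.s)))
    (h : 1 / (4 * q.rho) * ((x - xs) ⬝ᵥ (x - xs)) + κ * (l1 x - l1 xs) ≤ ε)
    (hε : ε ≤ R ^ 2 / (64 * (q.rho * q.s))) : l1 (x - xs) ≤ R / 2 := by
  have hρ := H.rho_pos
  have hs := H.s_pos
  set S := Finset.univ.filter fun j => xs j ≠ 0 with hS
  set a := ∑ j ∈ S, |(x - xs) j| with ha
  have ha2 : a ^ 2 ≤ q.s * ((x - xs) ⬝ᵥ (x - xs)) := by
    have h1 : a ^ 2 ≤ S.card * ∑ j ∈ S, |(x - xs) j| ^ 2 := sq_sum_le_card_mul_sum_sq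
    have h2 : ∑ j ∈ S, |(x - xs) j| ^ 2 ≤ (x - xs) ⬝ᵥ (x - xs) := by
      rw [dotProduct]
      simp only [sq_abs, ← sq]
      exact Finset.sum_le_univ_sum_of_nonneg fun j => sq_nonneg _
    have h3 : (S.card : ℝ) ≤ q.s := by exact_mod_cast H.sparse
    refine h1.trans (mul_le_mul h3 h2 (Finset.sum_nonneg fun _ _ => sq_nonneg _) hs.le)
  -- Off the support x_* vanishes and the whole deviation counts; on the support the triangle
  -- inequality loses at most twice the deviation.
  have hl : l1 (x - xs) - 2 * a ≤ l1 x - l1 xs := by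
    have e : ∑ j, (|(x - xs) j| - (if j ∈ S then 2 * |(x - xs) j| else 0)) ≤
        ∑ j, (|x j| - |xs j|) := by
      refine Finset.sum_le_sum fun j _ => ?_
      by_cases hj : j ∈ S
      · rw [if_pos hj, Pi.sub_apply]
        have := abs_sub_abs_le_abs_sub (xs j) (x j)
        rw [abs_sub_comm] at this
        linarith
      · have h0 : xs j = 0 := by simpa [hS] using hj
        rw [if_neg hj, Pi.sub_apply, h0]; simp
    rw [Finset.sum_sub_distrib, Finset.sum_sub_distrib, Finset.sum_ite_mem, Finset.univ_inter,
      ← Finset.mul_sum] at e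
    exact e
  have hκ0 : 0 < κ := by rw [hκ]; positivity
  have h1 : κ * l1 (x - xs) ≤ ε + 4 * κ ^ 2 * (q.rho * q.s) := by
    have e1 := mul_le_mul_of_nonneg_left hl hκ0.le
    have e2 : 1 / (4 * (q.rho * q.s)) * a ^ 2 ≤ 1 / (4 * q.rho) * ((x - xs) ⬝ᵥ (x - xs)) := by
      have := mul_le_mul_of_nonneg_left ha2 (by positivity : 0 ≤ 1 / (4 * (q.rho * q.s)))
      refine this.trans_eq ?_
      field_simp
    have e3 : 2 * κ * a ≤ 1 / (4 * (q.rho * q.s)) * a ^ 2 + 4 * κ ^ 2 * (q.rho * q.s) := by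
      have h0 : 0 < q.rho * q.s := mul_pos hρ hs
      have : 0 ≤ 1 / (4 * (q.rho * q.s)) * (a - 4 * κ * (q.rho * q.s)) ^ 2 := by positivity
      have e : 1 / (4 * (q.rho * q.s)) * (a - 4 * κ * (q.rho * q.s)) ^ 2 =
        1 / (4 * (q.rho * q.s)) * a ^ 2 - 2 * κ * a + 4 * κ ^ 2 * (q.rho * q.s) := by
        field_simp; ring
      linarith
    linarith
  -- With κ = R/(16ρs), both ε and 4κ²ρs are at most R²/(64ρs), and twice that is κR/2.
  have h2 : κ * l1 (x - xs) ≤ κ * (R / 2) := by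
    refine (h1.trans (add_le_add_left hε _)).trans_eq ?_
    rw [hκ]; field_simp; ring
  exact le_of_mul_le_mul_left h2 hκ0

/-- A stage halves the error bound on the event where the three sums are controlled. -/
theorem csmd_halving (H : Model q X act xs) {R γ κ τ lam Q : ℝ} {m L : ℕ} (hR : 0 < R)
    (hγ : 0 < γ) (hγν : γ * q.nu ≤ 1 / 4) (hκ : κ = R / (16 * (q.rho * q.s))) (hm : 0 < m)
    (hL : 0 < L) {u : ℕ → (Fin n → ℝ) × ℝ}
    (hu : ∀ l, ∀ j, |(u l).1 j| ≤ q.nuBar) {x₀ : Fin n → ℝ} (hx₀ : x₀ ∈ X)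
    (hxs : l1 (x₀ - xs) ≤ R) {y : ℕ → Fin n → ℝ}
    (hy : y = csmdIter X act x₀ γ κ R L (obsSeq act xs q.sig u))
    (hquad : ∑ j ∈ Finset.range (m * L), 1 / (2 * q.rho) * ((y (j / L) - xs) ⬝ᵥ (y (j / L) - xs)) ≤
      ∑ j ∈ Finset.range (m * L), q.rLow * ((u j).1 ⬝ᵥ (y (j / L) - xs)) ^ 2 + 4 * q.nu * R ^ 2 * τ)
    (hlin : ∑ j ∈ Finset.range (m * L), (u j).2 * ((u j).1 ⬝ᵥ (y (j / L) - xs)) ≤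
      8 * lam * q.nuBar ^ 2 * R ^ 2 * (m * L) + τ / lam)
    (hnoise : ∑ i ∈ Finset.range m, ‖noiseAvg L (fun l => u (i * L + l))‖ ^ 2 ≤ Q)
    (hε : R ^ 2 * dgfMax n / (γ * m) + κ * R / m + 2 * q.nu * R ^ 2 * τ / (m * L) +
      q.sig * (8 * lam * q.nuBar ^ 2 * R ^ 2 + τ / (lam * (m * L))) + 2 * γ * q.sig ^ 2 * Q / m ≤
      R ^ 2 / (64 * (q.rho * q.s))) :
    l1 (csmd X act x₀ γ κ R m L (obsSeq act xs q.sig u) - xs) ≤ R / 2 := by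
  have hρ := H.rho_pos
  have hs := H.s_pos
  have hm0 : (0 : ℝ) < m := by exact_mod_cast hm
  have hL0 : (0 : ℝ) < L := by exact_mod_cast hL
  have hκ0 : 0 ≤ κ := by rw [hκ]; positivity
  have hsum := H.sum_step_le hR hγ hγν hκ0 hL hu hx₀ hxs hy m
  -- Observation j of the stage is used by iteration `j / L`.
  have hdiv : ∀ i, ∀ l ∈ Finset.range L, (i * L + l) / L = i := fun i l hl => by
    rw [mul_comm, Nat.mul_add_div hL, Nat.div_eq_of_lt (Finset.mem_range.1 hl), add_zero]
  have hgap : (L : ℝ)⁻¹ * ∑ j ∈ Finset.range (m * L), q.rLow * ((u j).1 ⬝ᵥ (y (j / L) - xs)) ^ 2 ≤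
      ∑ i ∈ Finset.range m, gapAvg act xs L (fun l => u (i * L + l)) (y i) := by
    rw [sum_range_mul_eq, Finset.mul_sum]
    refine Finset.sum_le_sum fun i _ => le_trans (le_of_eq ?_) (H.gapAvg_ge L _ _)
    congr 1
    exact Finset.sum_congr rfl fun l hl => by rw [hdiv i l hl]
  have hlin' : ∑ i ∈ Finset.range m, (L : ℝ)⁻¹ * ∑ l ∈ Finset.range L,
      (u (i * L + l)).2 * ((u (i * L + l)).1 ⬝ᵥ (y i - xs)) =
      (L : ℝ)⁻¹ * ∑ j ∈ Finset.range (m * L), (u j).2 * ((u j).1 ⬝ᵥ (y (j / L) - xs)) := by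
    rw [sum_range_mul_eq, Finset.mul_sum]
    refine Finset.sum_congr rfl fun i _ => ?_
    congr 1
    exact Finset.sum_congr rfl fun l hl => by rw [hdiv i l hl]
  have hquad' : ∑ j ∈ Finset.range (m * L), 1 / (2 * q.rho) *
      ((y (j / L) - xs) ⬝ᵥ (y (j / L) - xs)) =
      L * (1 / (2 * q.rho) * ∑ i ∈ Finset.range m, (y i - xs) ⬝ᵥ (y i - xs)) := by
    rw [sum_range_mul_eq, Finset.mul_sum, Finset.mul_sum]
    refine Finset.sum_congr rfl fun i _ => ?_
    rw [Finset.sum_congr rfl fun l hl => by rw [hdiv i l hl]]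
    simp
  set A := ∑ i ∈ Finset.range m, (y i - xs) ⬝ᵥ (y i - xs) with hA
  set B := ∑ i ∈ Finset.range m, (l1 (y i) - l1 xs) with hB
  rw [hlin'] at hsum
  rw [hquad'] at hquad
  have hmain : 1 / (4 * q.rho) * A + κ * B ≤ m * (R ^ 2 / (64 * (q.rho * q.s))) := by
    have e1 : 1 / (2 * q.rho) * A ≤
        ∑ i ∈ Finset.range m, gapAvg act xs L (fun l => u (i * L + l)) (y i) +
          (L : ℝ)⁻¹ * (4 * q.nu * R ^ 2 * τ) := by
      have := mul_le_mul_of_nonneg_left hquad (inv_nonneg.2 hL0.le)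
      rw [inv_mul_cancel_left₀ hL0.ne', mul_add] at this
      linarith
    have e2 := mul_le_mul_of_nonneg_left hlin (inv_nonneg.2 hL0.le)
    have e2' := mul_le_mul_of_nonneg_left e2 (mul_nonneg hγ.le H.sig_pos.le)
    have e3 := mul_le_mul_of_nonneg_left hnoise
      (by positivity : 0 ≤ 2 * γ ^ 2 * q.sig ^ 2)
    have e1' := mul_le_mul_of_nonneg_left e1 (by positivity : 0 ≤ γ / 2)
    have e4 : γ * (1 / (4 * q.rho) * A + κ * B) ≤ R ^ 2 * dgfMax n + γ * κ * R +
        γ * q.sig * ((L : ℝ)⁻¹ * (8 * lam * q.nuBar ^ 2 * R ^ 2 * (m * L) + τ / lam)) +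
        2 * γ ^ 2 * q.sig ^ 2 * Q + γ / 2 * ((L : ℝ)⁻¹ * (4 * q.nu * R ^ 2 * τ)) := by
      have : γ * (1 / (4 * q.rho) * A) = γ / 2 * (1 / (2 * q.rho) * A) := by
        field_simp; ring
      rw [mul_add, this]
      linarith
    have e5 := mul_le_mul_of_nonneg_left hε (mul_nonneg hγ.le hm0.le)
    refine le_of_mul_le_mul_left (e4.trans (le_trans (le_of_eq ?_) (e5.trans_eq ?_))) hγ
    · rw [show τ / (lam * (m * L)) = τ / lam / (m * L) by rw [div_div]]
      field_simp
      ring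
    · ring
  refine H.l1_le_of_penalized hR hκ (ε := R ^ 2 / (64 * (q.rho * q.s))) ?_ le_rfl
  rw [csmd, ← hy]
  set xh := (m : ℝ)⁻¹ • ∑ i ∈ Finset.range m, y i with hxh
  have f1 : xh - xs = (m : ℝ)⁻¹ • ∑ i ∈ Finset.range m, (y i - xs) := by
    rw [Finset.sum_sub_distrib, smul_sub, hxh]
    simp only [Finset.sum_const, Finset.card_range]
    rw [← Nat.cast_smul_eq_nsmul ℝ, smul_smul, inv_mul_cancel₀ hm0.ne', one_smul]
  -- The squared Euclidean norm and the ℓ₁ norm are convex, so averaged bounds pass to the averaged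
  -- iterate.
  have f2 : (xh - xs) ⬝ᵥ (xh - xs) ≤ (m : ℝ)⁻¹ * A := by
    rw [f1, hA]
    simp only [dotProduct, ← sq, Pi.smul_apply, Finset.sum_apply, smul_eq_mul]
    rw [Finset.sum_comm, Finset.mul_sum]
    refine Finset.sum_le_sum fun j _ => ?_
    have := sq_sum_le_card_mul_sum_sq (s := Finset.range m) (f := fun i => (y i - xs) j)
    rw [Finset.card_range] at this
    rw [mul_pow]
    refine (mul_le_mul_of_nonneg_left this (by positivity)).trans_eq ?_
    field_simp
  have f3 : l1 xh - l1 xs ≤ (m : ℝ)⁻¹ * B := by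
    have : l1 xh ≤ (m : ℝ)⁻¹ * ∑ i ∈ Finset.range m, l1 (y i) := by
      rw [hxh, l1_smul, abs_of_nonneg (inv_nonneg.2 hm0.le)]
      refine mul_le_mul_of_nonneg_left ?_ (inv_nonneg.2 hm0.le)
      exact Finset.le_sum_of_subadditive l1 l1_zero.le l1_add_le _ _
    rw [hB, Finset.sum_sub_distrib, mul_sub]
    simp only [Finset.sum_const, Finset.card_range, nsmul_eq_mul]
    rw [inv_mul_cancel_left₀ hm0.ne']
    linarith
  have f4 := mul_le_mul_of_nonneg_left f2 (by positivity : 0 ≤ 1 / (4 * q.rho))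
  have f5 := mul_le_mul_of_nonneg_left f3 hκ0
  have f6 := mul_le_mul_of_nonneg_left hmain (inv_nonneg.2 hm0.le)
  rw [inv_mul_cancel_left₀ hm0.ne'] at f6
  calc _ ≤ 1 / (4 * q.rho) * ((m : ℝ)⁻¹ * A) + κ * ((m : ℝ)⁻¹ * B) := add_le_add f4 f5
    _ = (m : ℝ)⁻¹ * (1 / (4 * q.rho) * A + κ * B) := by ring
    _ ≤ _ := f6

end Model

end CSMDSR
namespace CSMDSR
open scoped ENNReal NNReal

/-! ### Independent sequences -/

/-- `U` is an i.i.d. sequence with law `μ`. -/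
structure IsIID {Ω O : Type*} [MeasurableSpace Ω] [MeasurableSpace O] (P : Measure Ω)
    (U : ℕ → Ω → O) (μ : Measure O) : Prop where
  measurable : ∀ i, Measurable (U i)
  indep : iIndepFun U P
  law : ∀ i, P.map (U i) = μ

section IID

variable {Ω O β γ : Type*} [MeasurableSpace Ω] [MeasurableSpace O] [MeasurableSpace β]
  [MeasurableSpace γ] [Inhabited O] {P : Measure Ω} [IsProbabilityMeasure P] {U : ℕ → Ω → O}
  {μ : Measure O}

/-- Functions of disjoint finite parts of an i.i.d. sequence are independent. -/
theorem IsIID.indepFun (hU : IsIID P U μ) {S T : Finset ℕ} (hST : Disjoint S T)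
    {F : (ℕ → O) → β} {G : (ℕ → O) → γ} (hF : Measurable F) (hG : Measurable G)
    (hFS : DependsOn F S) (hGT : DependsOn G T) :
    IndepFun (fun ω => F fun i => U i ω) (fun ω => G fun i => U i ω) P := by
  classical
  have hext : ∀ S : Finset ℕ, Measurable fun (t : S → O) (i : ℕ) =>
      if h : i ∈ S then t ⟨i, h⟩ else default := fun S => by
    refine measurable_pi_iff.2 fun i => ?_
    by_cases h : i ∈ S
    · simp only [h, dif_pos]; exact measurable_pi_apply _
    · simp only [h, dif_neg, not_false_eq_true]; exact measurable_const
  have h := (hU.indep.indepFun_finset S T hST hU.measurable).comp (hF.comp (hext S))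
    (hG.comp (hext T))
  have e1 : (fun ω => F fun i => U i ω) = (F ∘ fun (t : S → O) (i : ℕ) =>
      if h : i ∈ S then t ⟨i, h⟩ else default) ∘ fun a (i : S) => U i a := by
    funext ω
    refine hFS fun i hi => ?_
    have : i ∈ S := hi
    simp [this]
  have e2 : (fun ω => G fun i => U i ω) = (G ∘ fun (t : T → O) (i : ℕ) =>
      if h : i ∈ T then t ⟨i, h⟩ else default) ∘ fun a (i : T) => U i a := by
    funext ω
    refine hGT fun i hi => ?_
    have : i ∈ T := hi
    simp [this]
  rw [e1, e2]
  exact h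

theorem IsIID.measurable_seq (hU : IsIID P U μ) : Measurable fun ω (i : ℕ) => U i ω :=
  measurable_pi_iff.2 hU.measurable

theorem IsIID.isProbabilityMeasure (hU : IsIID P U μ) : IsProbabilityMeasure μ := by
  rw [← hU.law 0]; exact Measure.isProbabilityMeasure_map (hU.measurable 0).aemeasurable

/-- Integration of a new observation against a function of the past. -/
theorem IsIID.lintegral_mul_le (hU : IsIID P U μ) {k : ℕ} {A : (ℕ → O) → ℝ≥0∞}
    {v : (ℕ → O) → β} (hA : Measurable A) (hv : Measurable v)
    (hAk : DependsOn A (Set.Iio k)) (hvk : DependsOn v (Set.Iio k)) {f : β × O → ℝ≥0∞}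
    (hf : Measurable f) (hf1 : ∀ w, ∫⁻ o, f (v w, o) ∂μ ≤ 1) :
    ∫⁻ ω, A (fun i => U i ω) * f (v fun i => U i ω, U k ω) ∂P ≤
      ∫⁻ ω, A (fun i => U i ω) ∂P := by
  have := hU.isProbabilityMeasure
  set W : Ω → ℝ≥0∞ × β := fun ω => (A fun i => U i ω, v fun i => U i ω) with hW
  have hWm : Measurable W := (hA.comp hU.measurable_seq).prodMk (hv.comp hU.measurable_seq)
  -- Weight and parameter depend on the first k observations only, so jointly they are independent
  -- of observation k, and the joint law is a product.
  have hind : IndepFun W (U k) P := by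
    refine hU.indepFun (S := Finset.range k) (T := {k}) (by simp)
      (F := fun w => (A w, v w)) (G := fun w => w k) (hA.prodMk hv) (measurable_pi_apply k) ?_ ?_
    · intro x y hxy
      have hxy' : ∀ i ∈ Set.Iio k, x i = y i := fun i hi => hxy i (by simpa using hi)
      exact Prod.ext (hAk hxy') (hvk hxy')
    · intro x y hxy
      exact hxy k (by simp)
  have hmap := hind.map_prod_eq_prod_map_map hWm.aemeasurable (hU.measurable k).aemeasurable
  rw [hU.law k] at hmap
  have hg : Measurable fun p : (ℝ≥0∞ × β) × O => p.1.1 * f (p.1.2, p.2) := by fun_prop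
  calc ∫⁻ ω, A (fun i => U i ω) * f (v fun i => U i ω, U k ω) ∂P
      = ∫⁻ p, p.1.1 * f (p.1.2, p.2) ∂(P.map fun ω => (W ω, U k ω)) := by
        rw [lintegral_map hg (hWm.prodMk (hU.measurable k))]
    _ = ∫⁻ x, ∫⁻ o, x.1 * f (x.2, o) ∂μ ∂(P.map W) := by
        rw [hmap, lintegral_prod _ hg.aemeasurable]
    _ = ∫⁻ ω, ∫⁻ o, (W ω).1 * f ((W ω).2, o) ∂μ ∂P := by
        rw [lintegral_map (Measurable.lintegral_prod_right hg) hWm]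
    _ ≤ ∫⁻ ω, A (fun i => U i ω) ∂P := by
        refine lintegral_mono fun ω => ?_
        rw [lintegral_const_mul _ (by fun_prop)]
        exact mul_le_of_le_one_right' (hf1 _)

/-- The exponential supermartingale argument, in product form. -/
theorem IsIID.lintegral_prod_le_one (hU : IsIID P U μ) {b : ℕ} {v : ℕ → (ℕ → O) → β}
    (hv : ∀ j, Measurable (v j)) (hvk : ∀ j, DependsOn (v j) (Set.Iio (b + j)))
    {f : β × O → ℝ≥0∞} (hf : Measurable f) (hf1 : ∀ j w, ∫⁻ o, f (v j w, o) ∂μ ≤ 1) (T : ℕ) :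
    ∫⁻ ω, ∏ j ∈ Finset.range T, f (v j fun i => U i ω, U (b + j) ω) ∂P ≤ 1 := by
  induction T with
  | zero => simp
  | succ T ih =>
    simp only [Finset.prod_range_succ]
    refine (hU.lintegral_mul_le (k := b + T) (v := v T)
      (A := fun w => ∏ j ∈ Finset.range T, f (v j w, w (b + j))) ?_ (hv T) ?_ (hvk T) hf
      (hf1 T)).trans ih
    · exact Finset.measurable_prod _ fun j _ =>
        hf.comp ((hv j).prodMk (measurable_pi_apply _))
    · intro x y hxy
      refine Finset.prod_congr rfl fun j hj => ?_
      have hj' := Finset.mem_range.1 hj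
      rw [hvk j fun i (hi : i < b + j) => hxy i (Set.mem_Iio.2 (by omega)),
        hxy (b + j) (Set.mem_Iio.2 (by omega))]

/-- Products of functions of consecutive blocks of an i.i.d. sequence. -/
theorem IsIID.lintegral_prod_block_le_one (hU : IsIID P U μ) {b L : ℕ} {G : ℕ → (ℕ → O) → ℝ≥0∞}
    (hG : ∀ j, Measurable (G j))
    (hGk : ∀ j, DependsOn (G j) (Set.Ico (b + j * L) (b + (j + 1) * L)))
    (hG1 : ∀ j, ∫⁻ ω, G j (fun i => U i ω) ∂P ≤ 1) (T : ℕ) :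
    ∫⁻ ω, ∏ j ∈ Finset.range T, G j (fun i => U i ω) ∂P ≤ 1 := by
  induction T with
  | zero => simp
  | succ T ih =>
    simp only [Finset.prod_range_succ]
    have hm : Measurable fun w => ∏ j ∈ Finset.range T, G j w :=
      Finset.measurable_prod _ fun j _ => hG j
    -- Here the factors read disjoint blocks, so the integral factorizes and no conditioning on the
    -- past is needed.
    have hind : IndepFun (fun ω => ∏ j ∈ Finset.range T, G j fun i => U i ω)
        (fun ω => G T fun i => U i ω) P := by
      refine hU.indepFun (S := Finset.range (b + T * L))
        (T := Finset.Ico (b + T * L) (b + (T + 1) * L)) ?_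
        (F := fun w => ∏ j ∈ Finset.range T, G j w) hm (hG T) ?_ ?_
      · rw [Finset.disjoint_left]
        intro i hi hi'
        rw [Finset.mem_range] at hi; rw [Finset.mem_Ico] at hi'; omega
      · intro x y hxy
        refine Finset.prod_congr rfl fun j hj => hGk j fun i hi => hxy i ?_
        have h1 : j + 1 ≤ T := Finset.mem_range.1 hj
        have h2 := Nat.mul_le_mul_right L h1
        rw [Finset.coe_range, Set.mem_Iio]
        exact hi.2.trans_le (by omega)
      · rw [Finset.coe_Ico]; exact hGk T
    have := lintegral_mul_eq_lintegral_mul_lintegral_of_indepFun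
      (hm.comp hU.measurable_seq) ((hG T).comp hU.measurable_seq) hind
    simp only [Pi.mul_apply, Function.comp_apply] at this
    rw [this]
    exact mul_le_one' ih (hG1 T)

end IID

/-- Chernoff bound for a random variable with exponential moment at most `1`. -/
theorem measure_lt_le_of_lintegral_exp_le_one {Ω : Type*} [MeasurableSpace Ω] {P : Measure Ω}
    {Z : Ω → ℝ} (hZ : Measurable Z) (h : ∫⁻ ω, ENNReal.ofReal (Real.exp (Z ω)) ∂P ≤ 1) (τ : ℝ) :
    P {ω | τ < Z ω} ≤ ENNReal.ofReal (Real.exp (-τ)) := by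
  have hm : Measurable fun ω => ENNReal.ofReal (Real.exp (Z ω)) := by fun_prop
  have h1 := mul_meas_ge_le_lintegral (μ := P) hm (ENNReal.ofReal (Real.exp τ))
  have h2 : P {ω | τ < Z ω} ≤ P {ω | ENNReal.ofReal (Real.exp τ) ≤ ENNReal.ofReal (Real.exp (Z ω))} :=
    measure_mono fun ω (hω : τ < Z ω) => ENNReal.ofReal_le_ofReal (Real.exp_le_exp.2 hω.le)
  have h3 : ENNReal.ofReal (Real.exp (-τ)) = (ENNReal.ofReal (Real.exp τ))⁻¹ := by
    rw [Real.exp_neg, ENNReal.ofReal_inv_of_pos (Real.exp_pos _)]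
  rw [h3, ENNReal.le_inv_iff_mul_le, mul_comm]
  exact (mul_le_mul_right h2 _).trans (h1.trans h)

theorem ofReal_exp_sum {ι : Type*} (s : Finset ι) (f : ι → ℝ) :
    ENNReal.ofReal (Real.exp (∑ i ∈ s, f i)) = ∏ i ∈ s, ENNReal.ofReal (Real.exp (f i)) := by
  rw [Real.exp_sum, ENNReal.ofReal_prod_of_nonneg fun _ _ => (Real.exp_pos _).le]

/-! ### Exponential moments of one observation -/

/-- The assumptions on the law of `(φ, ξ)`. -/
structure IsNoiseLaw {n : ℕ} (μ : Measure ((Fin n → ℝ) × ℝ)) (nuBar kap : ℝ) : Prop where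
  isProb : IsProbabilityMeasure μ
  nuBar_pos : 0 < nuBar
  bound : ∀ᵐ o ∂μ, ∀ j, |o.1 j| ≤ nuBar
  subG : ∫⁻ o, ENNReal.ofReal (Real.exp (o.2 ^ 2)) ∂μ ≤ ENNReal.ofReal (Real.exp 1)
  mean : ∀ j, ∫ o, o.2 * o.1 j ∂μ = 0
  cov : ∀ v : Fin n → ℝ, kap * (v ⬝ᵥ v) ≤ ∫ o, (o.1 ⬝ᵥ v) ^ 2 ∂μ

/-- For a centred variable the linear term integrates to 0, which leaves an exponential moment of
the square. -/
theorem exp_le_add_exp_sq (x : ℝ) : Real.exp x ≤ x + Real.exp (x ^ 2) := by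
  rcases le_or_gt |x| 1 with h | h
  · have h1 := (abs_le.1 (Real.abs_exp_sub_one_sub_id_le h)).2
    have h2 := Real.add_one_le_exp (x ^ 2)
    linarith
  · rcases lt_abs.1 h with h | h
    · have : Real.exp x ≤ Real.exp (x ^ 2) := Real.exp_le_exp.2 (by nlinarith)
      linarith
    · have h1 : Real.exp x ≤ 1 := Real.exp_le_one_iff.2 (by linarith)
      have h2 := Real.add_one_le_exp (x ^ 2)
      nlinarith

/-- A pointwise substitute for Jensen's inequality: if exp(y) has mean at most e, integration of the
right side gives at most exp(a). -/
theorem exp_mul_le {a y : ℝ} (ha : 0 ≤ a) (ha1 : a ≤ 1) :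
    Real.exp (a * y) ≤ Real.exp a * (a * (Real.exp y * Real.exp (-1)) + (1 - a)) := by
  have h := convexOn_exp.2 (Set.mem_univ (y - 1)) (Set.mem_univ 0) ha (sub_nonneg.2 ha1)
    (by ring)
  simp only [smul_eq_mul, mul_zero, add_zero, Real.exp_zero, mul_one] at h
  rw [← Real.exp_add, ← sub_eq_add_neg]
  have e : Real.exp (a * y) = Real.exp a * Real.exp (a * (y - 1)) := by
    rw [← Real.exp_add]; congr 1; ring
  rw [e]
  exact mul_le_mul_of_nonneg_left h (Real.exp_pos _).le

/-- The chord of exp(-x) over [0, 1] has slope -(1 - 1/e), below -1/2. -/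
theorem exp_neg_le_one_sub_half {x : ℝ} (h0 : 0 ≤ x) (h1 : x ≤ 1) : Real.exp (-x) ≤ 1 - x / 2 := by
  have h := convexOn_exp.2 (Set.mem_univ (-1)) (Set.mem_univ 0) h0 (sub_nonneg.2 h1) (by ring)
  simp only [smul_eq_mul, mul_zero, add_zero, Real.exp_zero, mul_one, mul_neg] at h
  have h2 : Real.exp (-1) ≤ 1 / 2 := by
    rw [Real.exp_neg, inv_le_comm₀ (Real.exp_pos _) (by norm_num)]
    linarith [Real.exp_one_gt_d9]
  nlinarith

theorem lintegral_ofReal_le_of_integral_le {α : Type*} [MeasurableSpace α] {μ : Measure α}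
    {f g : α → ℝ} (hfg : ∀ᵐ x ∂μ, f x ≤ g x) (hf : ∀ x, 0 ≤ f x) (hg : Integrable g μ) {c : ℝ}
    (hc : ∫ x, g x ∂μ ≤ c) : ∫⁻ x, ENNReal.ofReal (f x) ∂μ ≤ ENNReal.ofReal c := by
  have hg0 : 0 ≤ᵐ[μ] g := hfg.mono fun x hx => (hf x).trans hx
  refine (lintegral_mono_ae (hfg.mono fun x hx => ENNReal.ofReal_le_ofReal hx)).trans ?_
  rw [← ofReal_integral_eq_lintegral_ofReal hg hg0]
  exact ENNReal.ofReal_le_ofReal hc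

namespace IsNoiseLaw

variable {n : ℕ} {μ : Measure ((Fin n → ℝ) × ℝ)} {nuBar kap : ℝ}

theorem measurable_dot (v : Fin n → ℝ) : Measurable fun o : (Fin n → ℝ) × ℝ => o.1 ⬝ᵥ v := by
  unfold dotProduct; fun_prop

theorem integrable_exp_sq (H : IsNoiseLaw μ nuBar kap) :
    Integrable (fun o => Real.exp (o.2 ^ 2)) μ := by
  refine ⟨by fun_prop, ?_⟩
  rw [hasFiniteIntegral_iff_ofReal (Filter.Eventually.of_forall fun _ => (Real.exp_pos _).le)]
  exact H.subG.trans_lt ENNReal.ofReal_lt_top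

theorem integral_exp_sq_le (H : IsNoiseLaw μ nuBar kap) :
    ∫ o, Real.exp (o.2 ^ 2) ∂μ ≤ Real.exp 1 := by
  have := H.subG
  rwa [← ofReal_integral_eq_lintegral_ofReal H.integrable_exp_sq
    (Filter.Eventually.of_forall fun _ => (Real.exp_pos _).le),
    ENNReal.ofReal_le_ofReal_iff (Real.exp_pos _).le] at this

theorem integrable_mul (H : IsNoiseLaw μ nuBar kap) (j : Fin n) :
    Integrable (fun o => o.2 * o.1 j) μ := by
  refine (H.integrable_exp_sq.const_mul nuBar).mono' (by fun_prop) ?_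
  filter_upwards [H.bound] with o ho
  rw [Real.norm_eq_abs, abs_mul, mul_comm]
  have h1 : |o.2| ≤ Real.exp (o.2 ^ 2) := by
    have := Real.add_one_le_exp (o.2 ^ 2)
    rw [← sq_abs] at this ⊢
    nlinarith [sq_nonneg (|o.2| - 1)]
  exact mul_le_mul (ho j) h1 (abs_nonneg _) H.nuBar_pos.le

theorem integrable_mul_dot (H : IsNoiseLaw μ nuBar kap) (v : Fin n → ℝ) :
    Integrable (fun o => o.2 * (o.1 ⬝ᵥ v)) μ := by
  have : (fun o : (Fin n → ℝ) × ℝ => o.2 * (o.1 ⬝ᵥ v)) = fun o => ∑ j, o.2 * o.1 j * v j := by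
    funext o
    rw [dotProduct, Finset.mul_sum]
    exact Finset.sum_congr rfl fun j _ => by ring
  rw [this]
  exact integrable_finsetSum _ fun j _ => (H.integrable_mul j).mul_const _

theorem integral_mul_dot (H : IsNoiseLaw μ nuBar kap) (v : Fin n → ℝ) :
    ∫ o, o.2 * (o.1 ⬝ᵥ v) ∂μ = 0 := by
  have : (fun o : (Fin n → ℝ) × ℝ => o.2 * (o.1 ⬝ᵥ v)) = fun o => ∑ j, o.2 * o.1 j * v j := by
    funext o
    rw [dotProduct, Finset.mul_sum]
    exact Finset.sum_congr rfl fun j _ => by ring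
  rw [this, integral_finsetSum _ fun j _ => (H.integrable_mul j).mul_const _]
  simp [integral_mul_const, H.mean]

theorem integrable_dot_sq (H : IsNoiseLaw μ nuBar kap) (v : Fin n → ℝ) :
    Integrable (fun o => (o.1 ⬝ᵥ v) ^ 2) μ := by
  have := H.isProb
  refine Integrable.of_bound (((measurable_dot v).pow_const 2).aestronglyMeasurable)
    ((nuBar * l1 v) ^ 2) ?_
  filter_upwards [H.bound] with o ho
  rw [Real.norm_eq_abs, abs_pow]
  exact pow_le_pow_left₀ (abs_nonneg _) (abs_dotProduct_le ho v) 2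

/-- Lower deviations of the quadratic form of the regressor. -/
theorem lintegral_exp_quad_le (H : IsNoiseLaw μ nuBar kap) {v : Fin n → ℝ} {D lam r : ℝ}
    (hr : 0 ≤ r) (hlam : 0 ≤ lam) (hv : l1 v ≤ D) (hD : lam * (r * (nuBar * D) ^ 2) ≤ 1) :
    ∫⁻ o, ENNReal.ofReal (Real.exp (lam * (r * kap / 2 * (v ⬝ᵥ v) - r * (o.1 ⬝ᵥ v) ^ 2))) ∂μ ≤ 1 := by
  have := H.isProb
  set a := lam * (r * kap / 2 * (v ⬝ᵥ v)) with ha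
  set x : (Fin n → ℝ) × ℝ → ℝ := fun o => lam * r * (o.1 ⬝ᵥ v) ^ 2 with hx
  have hxi : Integrable x μ := (H.integrable_dot_sq v).const_mul _
  have hEx : 2 * a ≤ ∫ o, x o ∂μ := by
    simp only [hx]
    rw [integral_const_mul]
    have := mul_le_mul_of_nonneg_left (H.cov v) (mul_nonneg hlam hr)
    rw [ha]; linarith
  rw [← ENNReal.ofReal_one]
  refine lintegral_ofReal_le_of_integral_le (g := fun o => Real.exp a * (1 - x o / 2)) ?_
    (fun _ => (Real.exp_pos _).le) (((integrable_const 1).sub (hxi.div_const 2)).const_mul _) ?_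
  · filter_upwards [H.bound] with o ho
    have h1 : x o ≤ 1 := by
      have h2 : (o.1 ⬝ᵥ v) ^ 2 ≤ (nuBar * D) ^ 2 := by
        rw [← sq_abs]
        exact pow_le_pow_left₀ (abs_nonneg _) ((abs_dotProduct_le ho v).trans
          (mul_le_mul_of_nonneg_left hv H.nuBar_pos.le)) 2
      refine le_trans ?_ hD
      simp only [hx]
      rw [mul_assoc]
      gcongr
    have e : lam * (r * kap / 2 * (v ⬝ᵥ v) - r * (o.1 ⬝ᵥ v) ^ 2) = a + -x o := by
      simp only [ha, hx]; ring
    rw [e, Real.exp_add]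
    exact mul_le_mul_of_nonneg_left (exp_neg_le_one_sub_half (by simp only [hx]; positivity) h1)
      (Real.exp_pos _).le
  · rw [integral_const_mul, integral_sub (integrable_const 1) (hxi.div_const 2), integral_div]
    simp only [integral_const, probReal_univ, smul_eq_mul, mul_one]
    -- The mean of x is at least 2a because only half of κ_Σ is claimed; this pays for the slope 1/2
    -- of the chord.
    have h1 : 1 - (∫ o, x o ∂μ) / 2 ≤ Real.exp (-a) := by
      have := Real.add_one_le_exp (-a)
      linarith
    calc _ ≤ Real.exp a * Real.exp (-a) := mul_le_mul_of_nonneg_left h1 (Real.exp_pos _).le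
      _ = 1 := by rw [← Real.exp_add, add_neg_cancel, Real.exp_zero]

/-- The noise `ξ φᵀ v` is sub-Gaussian. -/
theorem lintegral_exp_lin_le (H : IsNoiseLaw μ nuBar kap) {v : Fin n → ℝ} {D lam : ℝ}
    (hlam : 0 ≤ lam) (hv : l1 v ≤ D) :
    ∫⁻ o, ENNReal.ofReal (Real.exp (lam * (o.2 * (o.1 ⬝ᵥ v)) - 2 * lam ^ 2 * (nuBar * D) ^ 2)) ∂μ
      ≤ 1 := by
  have := H.isProb
  set b := lam * (nuBar * D) with hb
  have hD : 0 ≤ D := (l1_nonneg v).trans hv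
  have hb0 : 0 ≤ b := mul_nonneg hlam (mul_nonneg H.nuBar_pos.le hD)
  have hX : ∀ᵐ o ∂μ, |lam * (o.2 * (o.1 ⬝ᵥ v))| ≤ b * |o.2| := by
    filter_upwards [H.bound] with o ho
    have h1 : |o.1 ⬝ᵥ v| ≤ nuBar * D := (abs_dotProduct_le ho v).trans
      (mul_le_mul_of_nonneg_left hv H.nuBar_pos.le)
    rw [abs_mul, abs_mul, abs_of_nonneg hlam, hb]
    calc lam * (|o.2| * |o.1 ⬝ᵥ v|) ≤ lam * (|o.2| * (nuBar * D)) := by gcongr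
      _ = _ := by ring
  have e : ∀ o : (Fin n → ℝ) × ℝ, lam * (o.2 * (o.1 ⬝ᵥ v)) - 2 * lam ^ 2 * (nuBar * D) ^ 2 =
      lam * (o.2 * (o.1 ⬝ᵥ v)) + -(2 * b ^ 2) := fun o => by rw [hb]; ring
  rw [← ENNReal.ofReal_one]
  simp only [e, Real.exp_add]
  have hlast : Real.exp (2 * b ^ 2) * Real.exp (-(2 * b ^ 2)) = 1 := by
    rw [← Real.exp_add, add_neg_cancel, Real.exp_zero]
  have hpos := Real.exp_pos (-(2 * b ^ 2))
  have hI := H.integral_exp_sq_le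
  have hee : Real.exp 1 * Real.exp (-1) = 1 := by
    rw [← Real.exp_add, add_neg_cancel, Real.exp_zero]
  -- For b ≤ 1 the vanishing mean and a fractional moment of exp(ξ²) give exp(b²). For b > 1
  -- centring is not needed: b|ξ| ≤ b²/4 + ξ², and b²/4 + 1 ≤ 2b².
  rcases le_or_gt b 1 with hb1 | hb1
  · have hb2 : b ^ 2 ≤ 1 := pow_le_one₀ hb0 hb1
    set g : (Fin n → ℝ) × ℝ → ℝ := fun o => lam * (o.2 * (o.1 ⬝ᵥ v)) +
      Real.exp (b ^ 2) * (b ^ 2 * (Real.exp (o.2 ^ 2) * Real.exp (-1)) + (1 - b ^ 2)) with hg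
    have hi1 := (H.integrable_mul_dot v).const_mul lam
    have hi2 : Integrable (fun o : (Fin n → ℝ) × ℝ =>
        b ^ 2 * (Real.exp (o.2 ^ 2) * Real.exp (-1))) μ :=
      (H.integrable_exp_sq.mul_const _).const_mul _
    have hi3 : Integrable (fun o : (Fin n → ℝ) × ℝ => Real.exp (b ^ 2) *
        (b ^ 2 * (Real.exp (o.2 ^ 2) * Real.exp (-1)) + (1 - b ^ 2))) μ :=
      (hi2.add (integrable_const _)).const_mul _
    refine lintegral_ofReal_le_of_integral_le (g := fun o => g o * Real.exp (-(2 * b ^ 2))) ?_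
      (fun _ => by positivity) ((hi1.add hi3).mul_const _) ?_
    · filter_upwards [hX] with o ho
      refine mul_le_mul_of_nonneg_right ?_ hpos.le
      refine (exp_le_add_exp_sq _).trans ?_
      simp only [hg]
      refine add_le_add_right ?_ _
      refine le_trans ?_ (exp_mul_le (sq_nonneg b) hb2)
      refine Real.exp_le_exp.2 ?_
      rw [← sq_abs (lam * _), ← sq_abs o.2, ← mul_pow]
      exact pow_le_pow_left₀ (abs_nonneg _) ho 2
    · rw [integral_mul_const]
      have hIg : ∫ o, g o ∂μ ≤ Real.exp (2 * b ^ 2) := by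
        simp only [hg]
        rw [integral_add hi1 hi3, integral_const_mul, H.integral_mul_dot, integral_const_mul,
          integral_add hi2 (integrable_const _), integral_const_mul, integral_mul_const]
        simp only [integral_const, probReal_univ, smul_eq_mul, one_mul, mul_zero, zero_add]
        have h1 := mul_le_mul_of_nonneg_right hI (Real.exp_pos (-1)).le
        rw [hee] at h1
        have h2 : b ^ 2 * ((∫ o, Real.exp (o.2 ^ 2) ∂μ) * Real.exp (-1)) + (1 - b ^ 2) ≤ 1 := by
          nlinarith [sq_nonneg b]
        calc _ ≤ Real.exp (b ^ 2) * 1 := mul_le_mul_of_nonneg_left h2 (Real.exp_pos _).le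
          _ ≤ Real.exp (2 * b ^ 2) := by
            rw [mul_one]; exact Real.exp_le_exp.2 (by nlinarith [sq_nonneg b])
      calc _ ≤ Real.exp (2 * b ^ 2) * Real.exp (-(2 * b ^ 2)) :=
            mul_le_mul_of_nonneg_right hIg hpos.le
        _ = 1 := hlast
  · refine lintegral_ofReal_le_of_integral_le
      (g := fun o => Real.exp (b ^ 2 / 4) * Real.exp (o.2 ^ 2) * Real.exp (-(2 * b ^ 2))) ?_
      (fun _ => by positivity) ((H.integrable_exp_sq.const_mul _).mul_const _) ?_
    · filter_upwards [hX] with o ho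
      refine mul_le_mul_of_nonneg_right ?_ hpos.le
      rw [← Real.exp_add]
      refine Real.exp_le_exp.2 ((le_abs_self _).trans (ho.trans ?_))
      rw [← sq_abs o.2]
      nlinarith [sq_nonneg (b / 2 - |o.2|)]
    · rw [integral_mul_const, integral_const_mul]
      calc _ ≤ Real.exp (b ^ 2 / 4) * Real.exp 1 * Real.exp (-(2 * b ^ 2)) := by gcongr
        _ ≤ Real.exp (2 * b ^ 2) * Real.exp (-(2 * b ^ 2)) := by
          refine mul_le_mul_of_nonneg_right ?_ hpos.le
          rw [← Real.exp_add]
          exact Real.exp_le_exp.2 (by nlinarith)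
        _ = 1 := hlast

theorem lintegral_exp_sq_sub_one_le (H : IsNoiseLaw μ nuBar kap) :
    ∫⁻ o, ENNReal.ofReal (Real.exp (o.2 ^ 2 - 1)) ∂μ ≤ 1 := by
  rw [← ENNReal.ofReal_one]
  refine lintegral_ofReal_le_of_integral_le (g := fun o => Real.exp (o.2 ^ 2) * Real.exp (-1))
    (Filter.Eventually.of_forall fun o => ?_) (fun _ => (Real.exp_pos _).le)
    (H.integrable_exp_sq.mul_const _) ?_
  · rw [← Real.exp_add, sub_eq_add_neg]
  · rw [integral_mul_const]
    calc _ ≤ Real.exp 1 * Real.exp (-1) := by gcongr; exact H.integral_exp_sq_le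
      _ = 1 := by rw [← Real.exp_add, add_neg_cancel, Real.exp_zero]

end IsNoiseLaw

end CSMDSR
namespace CSMDSR
open scoped ENNReal NNReal

/-! ### The noise of a minibatch -/

/-- The integrand times the standard Gaussian density is √2 times the density of variance 2. -/
theorem lintegral_exp_sq_div_four_gaussian :
    ∫⁻ x, ENNReal.ofReal (Real.exp (x ^ 2 / 4)) ∂(gaussianReal 0 1) ≤ 2 := by
  rw [gaussianReal_of_var_ne_zero 0 one_ne_zero,
    lintegral_withDensity_eq_lintegral_mul _ (measurable_gaussianPDF 0 1) (by fun_prop)]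
  have h : ∀ x : ℝ, (gaussianPDF 0 1 * fun x => ENNReal.ofReal (Real.exp (x ^ 2 / 4))) x =
      ENNReal.ofReal √2 * gaussianPDF 0 2 x := by
    intro x
    rw [Pi.mul_apply, gaussianPDF, gaussianPDF, ← ENNReal.ofReal_mul (gaussianPDFReal_nonneg _ _ _),
      ← ENNReal.ofReal_mul (by positivity), gaussianPDFReal, gaussianPDFReal, mul_assoc,
      ← Real.exp_add]
    congr 1
    have h1 : √(2 * Real.pi * ((2 : ℝ≥0) : ℝ)) = √2 * √(2 * Real.pi * ((1 : ℝ≥0) : ℝ)) := by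
      rw [← Real.sqrt_mul (by norm_num)]
      congr 1; push_cast; ring
    rw [h1, mul_inv, ← mul_assoc, ← mul_assoc, mul_inv_cancel₀ (by positivity), one_mul]
    congr 2
    push_cast; ring
  simp only [h]
  rw [lintegral_const_mul _ (measurable_gaussianPDF 0 2), lintegral_gaussianPDF_eq_one 0 two_ne_zero,
    mul_one, ← ENNReal.ofReal_ofNat 2]
  exact ENNReal.ofReal_le_ofReal (Real.sqrt_le_iff.2 ⟨by norm_num, by norm_num⟩)

theorem lintegral_exp_mul_gaussian (a : ℝ) :
    ∫⁻ x, ENNReal.ofReal (Real.exp (a * x)) ∂(gaussianReal 0 1) =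
      ENNReal.ofReal (Real.exp (a ^ 2 / 2)) := by
  have hi : Integrable (fun x => Real.exp (a * x)) (gaussianReal 0 1) :=
    integrable_exp_mul_gaussianReal a
  rw [← ofReal_integral_eq_lintegral_ofReal hi
    (Filter.Eventually.of_forall fun _ => (Real.exp_pos _).le)]
  congr 1
  have := congrFun (mgf_fun_id_gaussianReal (μ := 0) (v := 1)) a
  rw [mgf] at this
  rw [this]; simp

/-- A sub-Gaussian random variable has a square exponential moment. -/
theorem lintegral_exp_sq_le_two {Ω : Type*} [MeasurableSpace Ω] {P : Measure Ω} [SFinite P]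
    {S : Ω → ℝ} (hS : Measurable S) {K : ℝ} (hK : 0 < K)
    (h : ∀ a : ℝ, ∫⁻ ω, ENNReal.ofReal (Real.exp (a * S ω)) ∂P ≤
      ENNReal.ofReal (Real.exp (2 * a ^ 2 * K))) :
    ∫⁻ ω, ENNReal.ofReal (Real.exp (S ω ^ 2 / (16 * K))) ∂P ≤ 2 := by
  -- The square is linearized by an auxiliary Gaussian g: exp(S²/(16K)) is the mean of exp(cSg).
  -- After Tonelli the sub-Gaussian bound applies with a = cg and gives exp(g²/4).
  set c := √(1 / (8 * K)) with hc
  have hc2 : c ^ 2 = 1 / (8 * K) := Real.sq_sqrt (by positivity)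
  calc ∫⁻ ω, ENNReal.ofReal (Real.exp (S ω ^ 2 / (16 * K))) ∂P
      = ∫⁻ ω, ∫⁻ x, ENNReal.ofReal (Real.exp (c * S ω * x)) ∂(gaussianReal 0 1) ∂P := by
        refine lintegral_congr fun ω => ?_
        rw [lintegral_exp_mul_gaussian, mul_pow, hc2]
        congr 2; field_simp; ring
    _ = ∫⁻ x, ∫⁻ ω, ENNReal.ofReal (Real.exp (c * S ω * x)) ∂P ∂(gaussianReal 0 1) :=
        lintegral_lintegral_swap (by fun_prop)
    _ ≤ ∫⁻ x, ENNReal.ofReal (Real.exp (x ^ 2 / 4)) ∂(gaussianReal 0 1) := by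
        refine lintegral_mono fun x => ?_
        have h1 := h (c * x)
        have e : 2 * (c * x) ^ 2 * K = x ^ 2 / 4 := by
          rw [mul_pow, hc2]; field_simp; ring
        rw [e] at h1
        refine le_trans (le_of_eq (lintegral_congr fun ω => ?_)) h1
        congr 2; ring
    _ ≤ 2 := lintegral_exp_sq_div_four_gaussian

section Noise

variable {Ω : Type*} [MeasurableSpace Ω] {P : Measure Ω} [IsProbabilityMeasure P] {n : ℕ}
  {U : ℕ → Ω → (Fin n → ℝ) × ℝ} {μ : Measure ((Fin n → ℝ) × ℝ)} {nuBar kap : ℝ}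

theorem measurable_noiseAvg (L : ℕ) : Measurable (noiseAvg (n := n) L) := by
  have h : Measurable fun u : ℕ → (Fin n → ℝ) × ℝ => ∑ l ∈ Finset.range L, (u l).2 • (u l).1 :=
    Finset.measurable_sum _ fun l _ => by
      have h1 : Measurable fun u : ℕ → (Fin n → ℝ) × ℝ => (u l).1 := by fun_prop
      have h2 : Measurable fun u : ℕ → (Fin n → ℝ) × ℝ => (u l).2 := by fun_prop
      exact h2.smul h1
  exact h.const_smul (L : ℝ)⁻¹

theorem noiseAvg_congr {L : ℕ} {x y : ℕ → (Fin n → ℝ) × ℝ} (h : ∀ l < L, x l = y l) :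
    noiseAvg L x = noiseAvg L y := by
  rw [noiseAvg, noiseAvg, Finset.sum_congr rfl fun l hl => by rw [h l (Finset.mem_range.1 hl)]]

/-- The sign of `a` is put into the vector a·e_k, of ℓ₁ norm |a|, because the sub-Gaussian bound is
stated for nonnegative multipliers. -/
theorem lintegral_exp_noise_sum_le (hU : IsIID P U μ) (hμ : IsNoiseLaw μ nuBar kap) (b L : ℕ)
    (k : Fin n) (a : ℝ) :
    ∫⁻ ω, ENNReal.ofReal (Real.exp (a * ∑ l ∈ Finset.range L, (U (b + l) ω).2 * (U (b + l) ω).1 k))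
      ∂P ≤ ENNReal.ofReal (Real.exp (2 * a ^ 2 * (nuBar ^ 2 * L))) := by
  have hl1 : l1 (Pi.single k a : Fin n → ℝ) ≤ |a| := by
    simp [l1, Pi.single_apply, apply_ite]
  have h := hU.lintegral_prod_le_one (b := b) (v := fun _ _ => (Pi.single k a : Fin n → ℝ))
    (fun _ => measurable_const) (fun _ => fun _ _ _ => rfl)
    (f := fun p => ENNReal.ofReal (Real.exp (1 * (p.2.2 * (p.2.1 ⬝ᵥ p.1)) -
      2 * 1 ^ 2 * (nuBar * |a|) ^ 2))) (by unfold dotProduct; fun_prop)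
    (fun _ _ => hμ.lintegral_exp_lin_le zero_le_one hl1) L
  have e : ∀ ω, ENNReal.ofReal (Real.exp (a * ∑ l ∈ Finset.range L,
      (U (b + l) ω).2 * (U (b + l) ω).1 k)) =
      ENNReal.ofReal (Real.exp (2 * a ^ 2 * (nuBar ^ 2 * L))) * ∏ j ∈ Finset.range L,
        ENNReal.ofReal (Real.exp (1 * ((U (b + j) ω).2 * ((U (b + j) ω).1 ⬝ᵥ Pi.single k a)) -
          2 * 1 ^ 2 * (nuBar * |a|) ^ 2)) := by
    intro ω
    rw [← ofReal_exp_sum, ← ENNReal.ofReal_mul (Real.exp_pos _).le, ← Real.exp_add]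
    congr 2
    rw [Finset.sum_sub_distrib, Finset.mul_sum]
    simp only [dotProduct_single, Finset.sum_const, Finset.card_range, nsmul_eq_mul, mul_pow,
      sq_abs, one_pow, one_mul]
    have : ∀ j, a * ((U (b + j) ω).2 * (U (b + j) ω).1 k) =
      (U (b + j) ω).2 * ((U (b + j) ω).1 k * a) := fun j => by ring
    simp only [this]
    ring
  simp only [e]
  rw [lintegral_const_mul]
  · exact mul_le_of_le_one_right' h
  · refine Finset.measurable_prod _ fun j _ => ?_
    have := hU.measurable (b + j)
    unfold dotProduct
    fun_prop

/-- The maximum over the n coordinates is bounded by their sum, and each square exponential moment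
is at most 2; hence the compensator ln(2n). The factor L is the gain from averaging. -/
theorem lintegral_exp_noiseAvg_sq_le (hU : IsIID P U μ) (hμ : IsNoiseLaw μ nuBar kap) (hn : 0 < n)
    (b : ℕ) {L : ℕ} (hL : 0 < L) :
    ∫⁻ ω, ENNReal.ofReal (Real.exp (L / (16 * nuBar ^ 2) *
      ‖noiseAvg L (fun l => U (b + l) ω)‖ ^ 2 - Real.log (2 * n))) ∂P ≤ 1 := by
  have hL0 : (0 : ℝ) < L := by exact_mod_cast hL
  have hn0 : (0 : ℝ) < n := by exact_mod_cast hn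
  have hν := hμ.nuBar_pos
  have : Nonempty (Fin n) := ⟨⟨0, hn⟩⟩
  have hSm : ∀ k : Fin n, Measurable fun ω => ∑ l ∈ Finset.range L,
      (U (b + l) ω).2 * (U (b + l) ω).1 k := fun k =>
    Finset.measurable_sum _ fun l _ => by
      have := hU.measurable (b + l); fun_prop
  have hk : ∀ k : Fin n, ∫⁻ ω, ENNReal.ofReal (Real.exp ((∑ l ∈ Finset.range L,
      (U (b + l) ω).2 * (U (b + l) ω).1 k) ^ 2 / (16 * (nuBar ^ 2 * L)))) ∂P ≤ 2 := fun k =>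
    lintegral_exp_sq_le_two (hSm k) (by positivity) fun a =>
      lintegral_exp_noise_sum_le hU hμ b L k a
  have hpt : ∀ ω, ENNReal.ofReal (Real.exp (L / (16 * nuBar ^ 2) *
      ‖noiseAvg L (fun l => U (b + l) ω)‖ ^ 2 - Real.log (2 * n))) ≤
      ENNReal.ofReal (2 * n)⁻¹ * ∑ k : Fin n, ENNReal.ofReal (Real.exp ((∑ l ∈ Finset.range L,
      (U (b + l) ω).2 * (U (b + l) ω).1 k) ^ 2 / (16 * (nuBar ^ 2 * L)))) := by
    intro ω
    obtain ⟨k, hk⟩ : ∃ k, |noiseAvg L (fun l => U (b + l) ω) k| =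
        ‖noiseAvg L (fun l => U (b + l) ω)‖ := by
      obtain ⟨k, hk⟩ := Finite.exists_max fun k => |noiseAvg L (fun l => U (b + l) ω) k|
      refine ⟨k, le_antisymm (norm_le_pi_norm (noiseAvg L (fun l => U (b + l) ω)) k) ?_⟩
      exact (pi_norm_le_iff_of_nonneg (abs_nonneg _)).2 hk
    rw [sub_eq_add_neg, Real.exp_add, Real.exp_neg, Real.exp_log (by positivity), mul_comm,
      ENNReal.ofReal_mul (by positivity)]
    gcongr
    refine le_trans (le_of_eq ?_) (Finset.single_le_sum (f := fun k : Fin n =>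
      ENNReal.ofReal (Real.exp ((∑ l ∈ Finset.range L,
      (U (b + l) ω).2 * (U (b + l) ω).1 k) ^ 2 / (16 * (nuBar ^ 2 * L)))))
      (fun _ _ => zero_le) (Finset.mem_univ k))
    rw [← hk, sq_abs, noiseAvg]
    simp only [Pi.smul_apply, Finset.sum_apply, smul_eq_mul]
    congr 2
    field_simp
  refine (lintegral_mono hpt).trans ?_
  rw [lintegral_const_mul, lintegral_finsetSum]
  · calc _ ≤ ENNReal.ofReal (2 * n)⁻¹ * ∑ k : Fin n, 2 := by
          gcongr with k; exact hk k
      _ = 1 := by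
        rw [Finset.sum_const, Finset.card_univ, Fintype.card_fin, nsmul_eq_mul,
          ENNReal.ofReal_inv_of_pos (by positivity), mul_comm (n : ℝ≥0∞),
          ENNReal.ofReal_mul (by norm_num), ENNReal.ofReal_natCast, ENNReal.ofReal_ofNat]
        refine ENNReal.inv_mul_cancel ?_ ?_
        · simp [hn.ne']
        · exact ENNReal.mul_ne_top (by norm_num) (ENNReal.natCast_ne_top n)
  · intro k _; have := hSm k; fun_prop
  · refine Finset.measurable_sum _ fun k _ => ?_
    have := hSm k; fun_prop

/-- The noise level of a sequence of minibatches. -/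
theorem measure_sum_noiseAvg_sq_le (hU : IsIID P U μ) (hμ : IsNoiseLaw μ nuBar kap) (hn : 0 < n)
    (b m : ℕ) {L : ℕ} (hL : 0 < L) (τ : ℝ) :
    P {ω | 16 * nuBar ^ 2 / L * (m * Real.log (2 * n) + τ) <
      ∑ i ∈ Finset.range m, ‖noiseAvg L (fun l => U (b + (i * L + l)) ω)‖ ^ 2} ≤
      ENNReal.ofReal (Real.exp (-τ)) := by
  have hL0 : (0 : ℝ) < L := by exact_mod_cast hL
  have hν := hμ.nuBar_pos
  set g : ℕ → (ℕ → (Fin n → ℝ) × ℝ) → ℝ := fun i w => L / (16 * nuBar ^ 2) *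
      ‖noiseAvg L (fun l => w (b + (i * L + l)))‖ ^ 2 - Real.log (2 * n) with hg
  have hgm : ∀ i, Measurable (g i) := by
    intro i
    have : Measurable fun w : ℕ → (Fin n → ℝ) × ℝ => noiseAvg L (fun l => w (b + (i * L + l))) :=
      (measurable_noiseAvg L).comp (measurable_pi_iff.2 fun l => measurable_pi_apply _)
    simp only [hg]
    fun_prop
  have h := hU.lintegral_prod_block_le_one (b := b) (L := L)
    (G := fun i w => ENNReal.ofReal (Real.exp (g i w)))
    (fun i => by have := hgm i; fun_prop) ?_ ?_ m
  · simp only [← ofReal_exp_sum] at h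
    refine (measure_mono ?_).trans (measure_lt_le_of_lintegral_exp_le_one
      (Finset.measurable_sum _ fun i _ => (hgm i).comp hU.measurable_seq) h τ)
    intro ω hω
    have hω' : 16 * nuBar ^ 2 / L * (m * Real.log (2 * n) + τ) <
      ∑ i ∈ Finset.range m, ‖noiseAvg L (fun l => U (b + (i * L + l)) ω)‖ ^ 2 := hω
    change τ < ∑ i ∈ Finset.range m, g i fun i => U i ω
    simp only [hg, Finset.sum_sub_distrib, ← Finset.mul_sum, Finset.sum_const, Finset.card_range,
      nsmul_eq_mul]
    have h1 := mul_lt_mul_of_pos_left hω' (by positivity : 0 < (L : ℝ) / (16 * nuBar ^ 2))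
    have e : (L : ℝ) / (16 * nuBar ^ 2) * (16 * nuBar ^ 2 / L * (m * Real.log (2 * n) + τ)) =
      m * Real.log (2 * n) + τ := by field_simp
    rw [e] at h1
    linarith
  · intro i x y hxy
    simp only [hg]
    rw [noiseAvg_congr fun l hl => hxy (b + (i * L + l)) ⟨by omega, by rw [add_one_mul]; omega⟩]
  · intro i
    have := lintegral_exp_noiseAvg_sq_le hU hμ hn (b + i * L) hL
    simpa only [hg, add_assoc] using this

/-- The noise level of a sequence of single observations. -/
theorem measure_sum_noiseAvg_one_sq_le (hU : IsIID P U μ) (hμ : IsNoiseLaw μ nuBar kap)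
    (b m : ℕ) (τ : ℝ) :
    P {ω | nuBar ^ 2 * (m + τ) <
      ∑ i ∈ Finset.range m, ‖noiseAvg 1 (fun l => U (b + (i * 1 + l)) ω)‖ ^ 2} ≤
      ENNReal.ofReal (Real.exp (-τ)) := by
  have hν := hμ.nuBar_pos
  have h := hU.lintegral_prod_le_one (b := b) (v := fun _ _ => ()) (fun _ => measurable_const)
    (fun _ => fun _ _ _ => rfl) (f := fun p => ENNReal.ofReal (Real.exp (p.2.2 ^ 2 - 1)))
    (by fun_prop) (fun _ _ => hμ.lintegral_exp_sq_sub_one_le) m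
  simp only [← ofReal_exp_sum] at h
  have hb : ∀ᵐ ω ∂P, ∀ i, ∀ j, |(U i ω).1 j| ≤ nuBar := ae_all_iff.2 fun i =>
    ae_of_ae_map (hU.measurable i).aemeasurable (by rw [hU.law i]; exact hμ.bound)
  have hm : Measurable fun ω => ∑ i ∈ Finset.range m, ((U (b + i) ω).2 ^ 2 - 1) :=
    Finset.measurable_sum _ fun i _ => by have := hU.measurable (b + i); fun_prop
  refine (measure_mono_ae ?_).trans (measure_lt_le_of_lintegral_exp_le_one hm h τ)
  filter_upwards [hb] with ω hω hlt
  have hlt' : nuBar ^ 2 * (m + τ) <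
      ∑ i ∈ Finset.range m, ‖noiseAvg 1 (fun l => U (b + (i * 1 + l)) ω)‖ ^ 2 := hlt
  change τ < ∑ i ∈ Finset.range m, ((U (b + i) ω).2 ^ 2 - 1)
  -- For one observation the uniform norm of ξφ is at most ν̄|ξ|, so no union over coordinates
  -- occurs. This spares the standard version the extra ln n of the minibatch version.
  have h1 : ∑ i ∈ Finset.range m, ‖noiseAvg 1 (fun l => U (b + (i * 1 + l)) ω)‖ ^ 2 ≤
      ∑ i ∈ Finset.range m, nuBar ^ 2 * (U (b + i) ω).2 ^ 2 := by
    refine Finset.sum_le_sum fun i _ => ?_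
    have e : noiseAvg 1 (fun l => U (b + (i * 1 + l)) ω) = (U (b + i) ω).2 • (U (b + i) ω).1 := by
      simp [noiseAvg]
    rw [e, norm_smul, mul_pow, Real.norm_eq_abs, sq_abs, mul_comm]
    gcongr
    exact (pi_norm_le_iff_of_nonneg hν.le).2 (hω _)
  rw [← Finset.mul_sum] at h1
  have h2 := lt_of_mul_lt_mul_left (hlt'.trans_le h1) (by positivity)
  rw [Finset.sum_sub_distrib]
  simp only [Finset.sum_const, Finset.card_range, nsmul_eq_mul, mul_one]
  linarith

end Noise

end CSMDSR
namespace CSMDSR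
open scoped ENNReal NNReal

/-! ### One stage: the probabilistic part -/

/-- Iterate i reads only the first i batches, so it is independent of the batch it is tested on. -/
theorem csmdIter_congr {n : ℕ} {X : Set (Fin n → ℝ)} {act : ℝ → ℝ} {x₀ : Fin n → ℝ} {γ κ R : ℝ}
    {L : ℕ} {o o' : ℕ → (Fin n → ℝ) × ℝ} (i : ℕ) (h : ∀ l < i * L, o l = o' l) :
    csmdIter X act x₀ γ κ R L o i = csmdIter X act x₀ γ κ R L o' i := by
  induction i with
  | zero => rfl
  | succ i ih =>
    rw [csmdIter, csmdIter, ih fun l hl => h l (by rw [add_one_mul]; omega), batchGrad, batchGrad,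
      Finset.sum_congr rfl fun l hl => by
        rw [h (i * L + l) (by have := Finset.mem_range.1 hl; rw [add_one_mul]; omega)]]

theorem csmd_congr {n : ℕ} {X : Set (Fin n → ℝ)} {act : ℝ → ℝ} {x₀ : Fin n → ℝ} {γ κ R : ℝ}
    {m L : ℕ} {o o' : ℕ → (Fin n → ℝ) × ℝ} (h : ∀ l < m * L, o l = o' l) :
    csmd X act x₀ γ κ R m L o = csmd X act x₀ γ κ R m L o' := by
  rw [csmd, csmd, Finset.sum_congr rfl fun i hi => ?_]
  exact csmdIter_congr i fun l hl =>
    h l (hl.trans_le (Nat.mul_le_mul_right L (Finset.mem_range.1 hi).le))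

namespace Model

variable {n : ℕ} {q : Params} {X : Set (Fin n → ℝ)} {act : ℝ → ℝ} {xs : Fin n → ℝ}

theorem measurable_act (H : Model q X act xs) : Measurable act := by
  have : LipschitzWith ⟨q.rUp, H.rUp_pos.le⟩ act := LipschitzWith.of_dist_le_mul fun u v => by
    rw [Real.dist_eq, Real.dist_eq]; exact H.lip u v
  exact this.continuous.measurable

theorem measurable_obsSeq (H : Model q X act xs) :
    Measurable (obsSeq (n := n) act xs q.sig) := by
  refine measurable_pi_iff.2 fun i => ?_
  have h1 : Measurable fun u : ℕ → (Fin n → ℝ) × ℝ => (u i).1 := (measurable_pi_apply i).fst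
  have h2 : Measurable fun u : ℕ → (Fin n → ℝ) × ℝ => (u i).2 := (measurable_pi_apply i).snd
  have h3 : Measurable fun u : ℕ → (Fin n → ℝ) × ℝ => (u i).1 ⬝ᵥ xs := by
    unfold dotProduct; fun_prop
  exact h1.prodMk ((H.measurable_act.comp h3).add (h2.const_mul _))

theorem measurable_batchGrad (H : Model q X act xs) {α : Type*} [MeasurableSpace α] (L : ℕ)
    {o : α → ℕ → (Fin n → ℝ) × ℝ} {x : α → Fin n → ℝ} (ho : Measurable o) (hx : Measurable x) :
    Measurable fun a => batchGrad act L (o a) (x a) := by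
  have h : Measurable fun a => ∑ l ∈ Finset.range L, stochGrad act (x a) (o a l) := by
    refine Finset.measurable_sum _ fun l _ => ?_
    have h0 : Measurable fun a => o a l := (measurable_pi_apply l).comp ho
    have h3 : Measurable fun a => (o a l).1 ⬝ᵥ x a := by
      unfold dotProduct; fun_prop
    exact ((H.measurable_act.comp h3).sub h0.snd).smul h0.fst
  exact h.const_smul (L : ℝ)⁻¹

theorem measurable_csmdIter (H : Model q X act xs) {α : Type*} [MeasurableSpace α] {γ κ R : ℝ}
    (hR : 0 < R) (hγ : 0 ≤ γ) (hκ : 0 ≤ κ) (L : ℕ) {o : α → ℕ → (Fin n → ℝ) × ℝ}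
    {x₀ : α → Fin n → ℝ} (ho : Measurable o) (hx₀ : Measurable x₀) (hmem : ∀ a, x₀ a ∈ X) (i : ℕ) :
    Measurable fun a => csmdIter X act (x₀ a) γ κ R L (o a) i := by
  induction i with
  | zero => exact hx₀
  | succ i ih =>
    have hs : Measurable fun a l => o a (i * L + l) :=
      measurable_pi_iff.2 fun l => (measurable_pi_apply _).comp ho
    exact (proxData_l1 H.two_le H.convex H.isClosed hR hγ hκ).measurable_compProx hx₀
      ((H.measurable_batchGrad L hs ih).const_smul γ) ih hmem

theorem measurable_csmd (H : Model q X act xs) {α : Type*} [MeasurableSpace α] {γ κ R : ℝ}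
    (hR : 0 < R) (hγ : 0 ≤ γ) (hκ : 0 ≤ κ) (m L : ℕ) {o : α → ℕ → (Fin n → ℝ) × ℝ}
    {x₀ : α → Fin n → ℝ} (ho : Measurable o) (hx₀ : Measurable x₀) (hmem : ∀ a, x₀ a ∈ X) :
    Measurable fun a => csmd X act (x₀ a) γ κ R m L (o a) := by
  have h : Measurable fun a => ∑ i ∈ Finset.range m, csmdIter X act (x₀ a) γ κ R L (o a) i :=
    Finset.measurable_sum _ fun i _ => H.measurable_csmdIter hR hγ hκ L ho hx₀ hmem i
  exact h.const_smul (m : ℝ)⁻¹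

end Model

/-- A point of `X` computed from the first `b` elements of the sequence of the `(φ, ξ)`. -/
structure IsAdaptedPoint {n : ℕ} (X : Set (Fin n → ℝ)) (b : ℕ)
    (D : (ℕ → (Fin n → ℝ) × ℝ) → Fin n → ℝ) : Prop where
  measurable : Measurable D
  dependsOn : DependsOn D (Set.Iio b)
  mem : ∀ w, D w ∈ X

theorem isAdaptedPoint_const {n : ℕ} {X : Set (Fin n → ℝ)} {x : Fin n → ℝ} (hx : x ∈ X) (b : ℕ) :
    IsAdaptedPoint X b fun _ => x :=
  ⟨measurable_const, fun _ _ _ => rfl, fun _ => hx⟩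

namespace Model

variable {n : ℕ} {q : Params} {X : Set (Fin n → ℝ)} {act : ℝ → ℝ} {xs : Fin n → ℝ}

theorem isAdaptedPoint_csmd (H : Model q X act xs) {γ κ R : ℝ} (hR : 0 < R) (hγ : 0 ≤ γ)
    (hκ : 0 ≤ κ) {m : ℕ} (hm : 0 < m) (L : ℕ) {b : ℕ}
    {D : (ℕ → (Fin n → ℝ) × ℝ) → Fin n → ℝ} (hD : IsAdaptedPoint X b D) :
    IsAdaptedPoint X (b + m * L) fun w => csmd X act (D w) γ κ R m L
      (fun i => obsSeq act xs q.sig w (b + i)) := by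
  refine ⟨H.measurable_csmd hR hγ hκ m L ?_ hD.measurable hD.mem, ?_,
    fun w => H.csmd_mem hR hγ hκ (hD.mem w) hm L _⟩
  · exact measurable_pi_iff.2 fun i => (measurable_pi_apply (b + i)).comp H.measurable_obsSeq
  · intro x y hxy
    change csmd X act (D x) γ κ R m L (fun i => obsSeq act xs q.sig x (b + i)) =
      csmd X act (D y) γ κ R m L (fun i => obsSeq act xs q.sig y (b + i))
    rw [hD.dependsOn fun i (hi : i < b) => hxy i (Set.mem_Iio.2 (by omega))]
    refine csmd_congr fun l hl => ?_
    rw [obsSeq, obsSeq, hxy (b + l) (Set.mem_Iio.2 (by omega))]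

/-- A stage halves the error bound with high probability. -/
theorem measure_csmd_le (H : Model q X act xs) {Ω : Type*} [MeasurableSpace Ω] {P : Measure Ω}
    [IsProbabilityMeasure P] {U : ℕ → Ω → (Fin n → ℝ) × ℝ} {μ : Measure ((Fin n → ℝ) × ℝ)}
    (hU : IsIID P U μ) (hμ : IsNoiseLaw μ q.nuBar q.kapSig) {R γ κ τ lam Q : ℝ} {m L b : ℕ}
    (hR : 0 < R) (hγ : 0 < γ) (hγν : γ * q.nu ≤ 1 / 4) (hκ : κ = R / (16 * (q.rho * q.s)))
    (hm : 0 < m) (hL : 0 < L) (hlam : 0 < lam) {D : (ℕ → (Fin n → ℝ) × ℝ) → Fin n → ℝ}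
    (hD : IsAdaptedPoint X b D)
    (hQ : P {ω | Q < ∑ i ∈ Finset.range m, ‖noiseAvg L (fun l => U (b + (i * L + l)) ω)‖ ^ 2} ≤
      ENNReal.ofReal (Real.exp (-τ)))
    (hε : R ^ 2 * dgfMax n / (γ * m) + κ * R / m + 2 * q.nu * R ^ 2 * τ / (m * L) +
      q.sig * (8 * lam * q.nuBar ^ 2 * R ^ 2 + τ / (lam * (m * L))) + 2 * γ * q.sig ^ 2 * Q / m ≤
      R ^ 2 / (64 * (q.rho * q.s))) :
    P {ω | l1 (D (fun i => U i ω) - xs) ≤ R ∧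
      R / 2 < l1 (csmd X act (D fun i => U i ω) γ κ R m L
        (fun i => obsSeq act xs q.sig (fun i => U i ω) (b + i)) - xs)} ≤
      3 * ENNReal.ofReal (Real.exp (-τ)) := by
  have hρ := H.rho_pos
  have hs := H.s_pos
  have hκ0 : 0 ≤ κ := by rw [hκ]; positivity
  set y : ℕ → (ℕ → (Fin n → ℝ) × ℝ) → Fin n → ℝ := fun i w =>
    csmdIter X act (D w) γ κ R L (fun i => obsSeq act xs q.sig w (b + i)) i with hy
  have hym : ∀ i, Measurable (y i) := fun i => H.measurable_csmdIter hR hγ.le hκ0 L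
    (measurable_pi_iff.2 fun i => (measurable_pi_apply (b + i)).comp H.measurable_obsSeq)
    hD.measurable hD.mem i
  have hyd : ∀ i, DependsOn (y i) (Set.Iio (b + i * L)) := by
    intro i x z hxz
    change csmdIter X act (D x) γ κ R L _ i = csmdIter X act (D z) γ κ R L _ i
    rw [hD.dependsOn fun i (hi : i < b) => hxz i (Set.mem_Iio.2 (by omega))]
    refine csmdIter_congr i fun l hl => ?_
    rw [obsSeq, obsSeq, hxz (b + l) (Set.mem_Iio.2 (by omega))]
  set A : Set (ℕ → (Fin n → ℝ) × ℝ) := {w | l1 (D w - xs) ≤ R} with hA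
  have hAm : MeasurableSet A := measurableSet_le
    (continuous_l1.measurable.comp (hD.measurable.sub_const xs)) measurable_const
  classical
  -- The error vector is replaced by 0 when the stage starts too far from x_*. The truncated vector
  -- is still known before observation b + j and always has ℓ₁ norm at most 2R, so no conditioning
  -- on the earlier stages is needed.
  set v : ℕ → (ℕ → (Fin n → ℝ) × ℝ) → Fin n → ℝ := fun j w =>
    if w ∈ A then y (j / L) w - xs else 0 with hv
  have hvm : ∀ j, Measurable (v j) := fun j =>
    Measurable.ite hAm ((hym _).sub_const xs) measurable_const
  have hvd : ∀ j, DependsOn (v j) (Set.Iio (b + j)) := by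
    intro j x z hxz
    have h1 : D x = D z := hD.dependsOn fun i (hi : i < b) => hxz i (Set.mem_Iio.2 (by omega))
    have h2 : y (j / L) x = y (j / L) z := hyd _ fun i (hi : i < b + j / L * L) =>
      hxz i (Set.mem_Iio.2 (by have := Nat.div_mul_le_self j L; omega))
    simp only [hv, hA, Set.mem_ofPred_eq, h1, h2]
  have hvl : ∀ j w, l1 (v j w) ≤ 2 * R := by
    intro j w
    by_cases hw : w ∈ A
    · simp only [hv, if_pos hw]
      have h1 := l1_sub_le (y (j / L) w) (D w) xs
      have h2 := (H.csmdIter_mem hR hγ.le hκ0 (hD.mem w) L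
        (fun i => obsSeq act xs q.sig w (b + i)) (j / L)).2
      have h3 : l1 (D w - xs) ≤ R := hw
      linarith
    · simp only [hv, if_neg hw, l1_zero]; linarith
  set T := m * L with hT
  have hquadm : Measurable fun p : (Fin n → ℝ) × ((Fin n → ℝ) × ℝ) =>
      1 / (4 * q.nu * R ^ 2) * (q.rLow * q.kapSig / 2 * (p.1 ⬝ᵥ p.1) -
        q.rLow * (p.2.1 ⬝ᵥ p.1) ^ 2) := by
    unfold dotProduct; fun_prop
  have hlinm : Measurable fun p : (Fin n → ℝ) × ((Fin n → ℝ) × ℝ) =>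
      lam * (p.2.2 * (p.2.1 ⬝ᵥ p.1)) - 2 * lam ^ 2 * (q.nuBar * (2 * R)) ^ 2 := by
    unfold dotProduct; fun_prop
  have hν := H.nu_pos
  -- With the multiplier 1/(4νR²) the scaled quadratic form stays in [0, 1], since |v|₁ ≤ 2R and r̲
  -- ≤ r̄.
  have hquad := hU.lintegral_prod_le_one (b := b) hvm hvd (f := fun p => ENNReal.ofReal (Real.exp
    (1 / (4 * q.nu * R ^ 2) * (q.rLow * q.kapSig / 2 * (p.1 ⬝ᵥ p.1) -
      q.rLow * (p.2.1 ⬝ᵥ p.1) ^ 2)))) (by fun_prop)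
    (fun j w => hμ.lintegral_exp_quad_le H.rLow_pos.le (by positivity) (hvl j w) (by
      have h1 := H.rLow_le
      have h2 : q.rLow * (q.nuBar * (2 * R)) ^ 2 ≤ 4 * q.nu * R ^ 2 := by
        rw [Params.nu]
        have := mul_le_mul_of_nonneg_right h1 (by positivity : 0 ≤ 4 * (q.nuBar ^ 2 * R ^ 2))
        linarith
      rw [one_div, inv_mul_le_iff₀ (by positivity), mul_one]
      exact h2)) T
  have hlin := hU.lintegral_prod_le_one (b := b) hvm hvd (f := fun p => ENNReal.ofReal (Real.exp
    (lam * (p.2.2 * (p.2.1 ⬝ᵥ p.1)) - 2 * lam ^ 2 * (q.nuBar * (2 * R)) ^ 2))) (by fun_prop)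
    (fun j w => hμ.lintegral_exp_lin_le hlam.le (hvl j w)) T
  simp only [← ofReal_exp_sum] at hquad hlin
  have hpair : ∀ j, Measurable fun ω => (v j fun i => U i ω, U (b + j) ω) := fun j =>
    ((hvm j).comp hU.measurable_seq).prodMk (hU.measurable (b + j))
  have hE1 := measure_lt_le_of_lintegral_exp_le_one (P := P)
    (Finset.measurable_sum _ fun j _ => hquadm.comp (hpair j)) hquad τ
  have hE2 := measure_lt_le_of_lintegral_exp_le_one (P := P)
    (Finset.measurable_sum _ fun j _ => hlinm.comp (hpair j)) hlin τ
  have hb : ∀ᵐ ω ∂P, ∀ i, ∀ j, |(U i ω).1 j| ≤ q.nuBar := ae_all_iff.2 fun i =>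
    ae_of_ae_map (hU.measurable i).aemeasurable (by rw [hU.law i]; exact hμ.bound)
  have h3 : (3 : ℝ≥0∞) * ENNReal.ofReal (Real.exp (-τ)) = ENNReal.ofReal (Real.exp (-τ)) +
      ENNReal.ofReal (Real.exp (-τ)) + ENNReal.ofReal (Real.exp (-τ)) := by ring
  rw [h3]
  refine (measure_mono_ae ?_).trans ((measure_union_le _ _).trans
    (add_le_add ((measure_union_le _ _).trans (add_le_add hE1 hE2)) hQ))
  filter_upwards [hb] with ω hω hbad
  obtain ⟨hb1, hb2⟩ : l1 (D (fun i => U i ω) - xs) ≤ R ∧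
      R / 2 < l1 (csmd X act (D fun i => U i ω) γ κ R m L
        (fun i => obsSeq act xs q.sig (fun i => U i ω) (b + i)) - xs) := hbad
  by_contra hnot
  have hnot' : ¬ ((τ < ∑ j ∈ Finset.range T, _ ∨ τ < ∑ j ∈ Finset.range T, _) ∨ Q < _) := hnot
  simp only [not_or, not_lt, Function.comp_apply] at hnot'
  obtain ⟨⟨hn1, hn2⟩, hn3⟩ := hnot'
  refine absurd hb2 (not_lt.2 ?_)
  have hvω : ∀ j, v j (fun i => U i ω) = y (j / L) (fun i => U i ω) - xs := fun j => by
    simp only [hv]; exact if_pos hb1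
  simp only [hvω] at hn1 hn2
  refine H.csmd_halving hR hγ hγν hκ hm hL (u := fun l => U (b + l) ω) (fun l => hω _)
    (hD.mem _) hb1 (y := fun i => y i fun i => U i ω) rfl (τ := τ) (lam := lam) (Q := Q) ?_ ?_ ?_ hε
  · rw [← Finset.mul_sum, Finset.sum_sub_distrib, one_div, inv_mul_le_iff₀ (by positivity)] at hn1
    have e : 1 / (2 * q.rho) = q.rLow * q.kapSig / 2 := by
      rw [Params.rho]
      have := H.kapSig_pos
      have := H.rLow_pos
      field_simp
    rw [e]
    linarith
  · rw [Finset.sum_sub_distrib, ← Finset.mul_sum] at hn2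
    simp only [Finset.sum_const, Finset.card_range, nsmul_eq_mul] at hn2
    have h1 := div_le_div_of_nonneg_right (sub_le_iff_le_add.1 hn2) hlam.le
    rw [mul_div_cancel_left₀ _ hlam.ne'] at h1
    refine h1.trans_eq ?_
    rw [hT]; push_cast; field_simp; ring
  · exact hn3

end Model

end CSMDSR
namespace CSMDSR
open scoped ENNReal NNReal

/-! ### The stages of the algorithm -/

/-- A choice of the absolute constants of the algorithm. -/
noncomputable def tuning : Tuning where
  aLen := 4096
  aStop := 1024
  aPen := 1 / 16
  aRad := 32
  aLenAs := 1024
  aStepAs := 1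
  aPenAs := 4
  aPenMb := 4
  aBatch := 4
  aLen_pos := by norm_num
  aStop_pos := by norm_num
  aPen_pos := by norm_num
  aRad_pos := by norm_num
  aLenAs_pos := by norm_num
  aStepAs_pos := by norm_num
  aPenAs_pos := by norm_num
  aPenMb_pos := by norm_num
  aBatch_pos := by norm_num

namespace Model

variable {n : ℕ} {q : Params} {X : Set (Fin n → ℝ)} {act : ℝ → ℝ} {xs : Fin n → ℝ}

/-- The target is eight times R²/(512ρs), and each of the six terms is at most one such unit; `lam`
makes the variance term of the martingale exactly one unit. -/
theorem error_terms_le (H : Model q X act xs) {R γ κ τ lam Q Θ m L : ℝ} (hR : 0 < R)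
    (hγ : 0 < γ) (hκ : κ = R / (16 * (q.rho * q.s)))
    (hlam : lam = 1 / (4096 * q.sig * q.nuBar ^ 2 * (q.rho * q.s))) (hm : 0 < m) (hL : 0 < L)
    (h1 : 512 * (q.rho * q.s) * Θ ≤ γ * m) (h2 : 32 ≤ m)
    (h3 : 1024 * (q.rho * q.s * q.nu) * τ ≤ m * L)
    (h4 : 2 ^ 21 * q.sigStar ^ 2 * (q.rho * q.s) ^ 2 * τ ≤ R ^ 2 * (m * L))
    (h5 : 1024 * γ * q.sig ^ 2 * Q * (q.rho * q.s) ≤ R ^ 2 * m) :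
    R ^ 2 * Θ / (γ * m) + κ * R / m + 2 * q.nu * R ^ 2 * τ / (m * L) +
      q.sig * (8 * lam * q.nuBar ^ 2 * R ^ 2 + τ / (lam * (m * L))) + 2 * γ * q.sig ^ 2 * Q / m ≤
      R ^ 2 / (64 * (q.rho * q.s)) := by
  have hρs : 0 < q.rho * q.s := mul_pos H.rho_pos H.s_pos
  have hσ := H.sig_pos
  have hν := H.nuBar_pos
  set w := q.rho * q.s with hw
  have hR2 : 0 < R ^ 2 := by positivity
  have t1 : R ^ 2 * Θ / (γ * m) ≤ R ^ 2 / (512 * w) := by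
    rw [div_le_div_iff₀ (by positivity) (by positivity)]
    nlinarith [mul_le_mul_of_nonneg_left h1 hR2.le]
  have t2 : κ * R / m ≤ R ^ 2 / (512 * w) := by
    rw [hκ, div_mul_eq_mul_div, div_div, div_le_div_iff₀ (by positivity) (by positivity)]
    nlinarith [mul_le_mul_of_nonneg_left h2 (mul_pos hR2 hρs).le]
  have t3 : 2 * q.nu * R ^ 2 * τ / (m * L) ≤ R ^ 2 / (512 * w) := by
    rw [div_le_div_iff₀ (by positivity) (by positivity)]
    nlinarith [mul_le_mul_of_nonneg_left h3 hR2.le]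
  have t4 : q.sig * (8 * lam * q.nuBar ^ 2 * R ^ 2) = R ^ 2 / (512 * w) := by
    rw [hlam]; field_simp; ring
  have t5 : q.sig * (τ / (lam * (m * L))) ≤ R ^ 2 / (512 * w) := by
    have e : q.sig * (τ / (lam * (m * L))) = 4096 * q.sigStar ^ 2 * w * τ / (m * L) := by
      rw [hlam, Params.sigStar]; field_simp
    rw [e, div_le_div_iff₀ (by positivity) (by positivity)]
    nlinarith
  have t6 : 2 * γ * q.sig ^ 2 * Q / m ≤ R ^ 2 / (512 * w) := by
    rw [div_le_div_iff₀ (by positivity) (by positivity)]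
    nlinarith
  have e : R ^ 2 / (64 * w) = 8 * (R ^ 2 / (512 * w)) := by field_simp; ring
  have hp : 0 ≤ R ^ 2 / (512 * w) := by positivity
  rw [mul_add, e]
  linarith

theorem one_le_mass (H : Model q X act xs) : 1 ≤ q.rho * q.s * q.nu := by
  have h1 := H.one_le_rho_mul_nu
  have h2 : (1 : ℝ) ≤ q.s := by exact_mod_cast H.one_le_s
  nlinarith

variable {Ω : Type*} [MeasurableSpace Ω] {P : Measure Ω} [IsProbabilityMeasure P]
  {U : ℕ → Ω → (Fin n → ℝ) × ℝ} {μ : Measure ((Fin n → ℝ) × ℝ)}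

/-- A stage without minibatches. -/
theorem measure_csmd_one_le (H : Model q X act xs) (hU : IsIID P U μ)
    (hμ : IsNoiseLaw μ q.nuBar q.kapSig) {R γ κ τ : ℝ} {m b : ℕ} (hR : 0 < R) (hγ : 0 < γ)
    (hγν : γ * q.nu ≤ 1 / 4) (hκ : κ = R / (16 * (q.rho * q.s)))
    {D : (ℕ → (Fin n → ℝ) × ℝ) → Fin n → ℝ} (hD : IsAdaptedPoint X b D) (hτ : 0 ≤ τ)
    (h1 : 512 * (q.rho * q.s) * dgfMax n ≤ γ * m) (h2 : (32 : ℝ) ≤ m)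
    (h3 : 1024 * (q.rho * q.s * q.nu) * τ ≤ m)
    (h4 : 2 ^ 21 * q.sigStar ^ 2 * (q.rho * q.s) ^ 2 * τ ≤ R ^ 2 * m)
    (h5 : 2048 * γ * q.sigStar ^ 2 * (q.rho * q.s) ≤ R ^ 2) :
    P {ω | l1 (D (fun i => U i ω) - xs) ≤ R ∧
      R / 2 < l1 (csmd X act (D fun i => U i ω) γ κ R m 1
        (fun i => obsSeq act xs q.sig (fun i => U i ω) (b + i)) - xs)} ≤
      3 * ENNReal.ofReal (Real.exp (-τ)) := by
  have hρs : 0 < q.rho * q.s := mul_pos H.rho_pos H.s_pos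
  have hσ := H.sig_pos
  have hν := H.nuBar_pos
  have hm0 : (0 : ℝ) < m := by linarith
  have hτm : τ ≤ m := by
    have := H.one_le_mass
    nlinarith
  refine H.measure_csmd_le hU hμ hR hγ hγν hκ (by exact_mod_cast hm0) one_pos
    (lam := 1 / (4096 * q.sig * q.nuBar ^ 2 * (q.rho * q.s))) (by positivity) hD
    (measure_sum_noiseAvg_one_sq_le hU hμ b m τ) ?_
  refine H.error_terms_le hR hγ hκ rfl hm0 (by norm_num) h1 h2 (by simpa using h3)
    (by simpa using h4) ?_
  have e : 1024 * γ * q.sig ^ 2 * (q.nuBar ^ 2 * (m + τ)) * (q.rho * q.s) =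
      1024 * γ * q.sigStar ^ 2 * (q.rho * q.s) * (m + τ) := by rw [Params.sigStar]; ring
  rw [e]
  have h6 : 1024 * γ * q.sigStar ^ 2 * (q.rho * q.s) * (m + τ) ≤
      1024 * γ * q.sigStar ^ 2 * (q.rho * q.s) * (2 * m) := by
    gcongr; linarith
  nlinarith [mul_le_mul_of_nonneg_right h5 hm0.le]

/-- A stage with minibatches. -/
theorem measure_csmd_batch_le (H : Model q X act xs) (hU : IsIID P U μ)
    (hμ : IsNoiseLaw μ q.nuBar q.kapSig) {R γ κ τ : ℝ} {m L b : ℕ} (hR : 0 < R) (hγ : 0 < γ)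
    (hγν : γ * q.nu ≤ 1 / 4) (hκ : κ = R / (16 * (q.rho * q.s))) (hL : 0 < L)
    {D : (ℕ → (Fin n → ℝ) × ℝ) → Fin n → ℝ} (hD : IsAdaptedPoint X b D) (hτ : 0 ≤ τ)
    (h1 : 512 * (q.rho * q.s) * dgfMax n ≤ γ * m) (h2 : (32 : ℝ) ≤ m)
    (h3 : 1024 * (q.rho * q.s * q.nu) * τ ≤ m)
    (h4 : 2 ^ 21 * q.sigStar ^ 2 * (q.rho * q.s) ^ 2 * τ ≤ R ^ 2 * (m * L))
    (h5 : 49152 * γ * q.sigStar ^ 2 * (q.rho * q.s) * dgfMax n ≤ R ^ 2 * L) :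
    P {ω | l1 (D (fun i => U i ω) - xs) ≤ R ∧
      R / 2 < l1 (csmd X act (D fun i => U i ω) γ κ R m L
        (fun i => obsSeq act xs q.sig (fun i => U i ω) (b + i)) - xs)} ≤
      3 * ENNReal.ofReal (Real.exp (-τ)) := by
  have hρs : 0 < q.rho * q.s := mul_pos H.rho_pos H.s_pos
  have hσ := H.sig_pos
  have hν := H.nuBar_pos
  have hn := H.two_le
  have hΘ := one_le_dgfMax hn
  have hm0 : (0 : ℝ) < m := by linarith
  have hL0 : (0 : ℝ) < L := by exact_mod_cast hL
  have hL1 : (1 : ℝ) ≤ L := by exact_mod_cast hL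
  have hτm : τ ≤ m := by
    have := H.one_le_mass
    nlinarith
  -- Since n ≥ 2, ln(2n) ≤ 2 ln n. This Θ is the reason why the batches must have size of order 4^k
  -- Θ.
  have hlog : Real.log (2 * n) ≤ 2 * dgfMax n := by
    have hn2 : (2 : ℝ) ≤ n := by exact_mod_cast hn
    have e1 : Real.log (2 * n) ≤ Real.log (n * n) := Real.log_le_log (by linarith) (by nlinarith)
    rw [Real.log_mul (x := n) (by positivity) (by positivity)] at e1
    linarith [log_le_dgfMax hn]
  refine H.measure_csmd_le hU hμ hR hγ hγν hκ (by exact_mod_cast hm0) hL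
    (lam := 1 / (4096 * q.sig * q.nuBar ^ 2 * (q.rho * q.s))) (by positivity) hD
    (measure_sum_noiseAvg_sq_le hU hμ (by omega) b m hL τ) ?_
  refine H.error_terms_le hR hγ hκ rfl hm0 hL0 h1 h2
    (h3.trans (le_mul_of_one_le_right hm0.le hL1)) h4 ?_
  have hsum : m * Real.log (2 * n) + τ ≤ 3 * (m * dgfMax n) := by
    have e1 := mul_le_mul_of_nonneg_left hlog hm0.le
    have e2 := mul_le_mul_of_nonneg_left hΘ hm0.le
    linarith
  have e : 1024 * γ * q.sig ^ 2 * (16 * q.nuBar ^ 2 / L * (m * Real.log (2 * n) + τ)) *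
      (q.rho * q.s) = 16384 * γ * q.sigStar ^ 2 * (q.rho * q.s) *
        (m * Real.log (2 * n) + τ) / L := by rw [Params.sigStar]; field_simp; ring
  rw [e, div_le_iff₀ hL0]
  have h6 : 16384 * γ * q.sigStar ^ 2 * (q.rho * q.s) * (m * Real.log (2 * n) + τ) ≤
      16384 * γ * q.sigStar ^ 2 * (q.rho * q.s) * (3 * (m * dgfMax n)) := by
    gcongr
  nlinarith [mul_le_mul_of_nonneg_right h5 hm0.le]

theorem mass_add_ge_one (H : Model q X act xs) (ht : 0 ≤ q.t) :
    1 ≤ q.s * q.rho * q.nu * (dgfMax n + q.t) := by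
  have h1 := H.one_le_mass
  have h2 := one_le_dgfMax H.two_le
  nlinarith

theorem m0_ge (n : ℕ) (q : Params) :
    4096 * (q.s * q.rho * q.nu * (dgfMax n + q.t)) ≤ q.m0 tuning n := Nat.le_ceil _

theorem m0_pos (H : Model q X act xs) (ht : 0 ≤ q.t) : 0 < q.m0 tuning n := by
  have h1 := H.mass_add_ge_one ht
  have h2 := m0_ge n q
  have : (0 : ℝ) < q.m0 tuning n := by linarith
  exact_mod_cast this

theorem mAs_ge (n k : ℕ) (q : Params) :
    1024 * (4 ^ k * (q.s * q.rho * q.nu * (dgfMax n + q.t))) ≤ q.mAs tuning n k := Nat.le_ceil _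

theorem batch_ge (n k : ℕ) : 4 * (4 ^ k * dgfMax n) ≤ Params.batch tuning n k := Nat.le_ceil _

theorem batch_pos (hn : 2 ≤ n) (k : ℕ) : 0 < Params.batch tuning n k := by
  have h1 := one_le_dgfMax hn
  have : (0 : ℝ) < Params.batch tuning n k := lt_of_lt_of_le (by positivity) (batch_ge n k)
  exact_mod_cast this

theorem mAs_pos (H : Model q X act xs) (ht : 0 ≤ q.t) (k : ℕ) : 0 < q.mAs tuning n k := by
  have h1 := H.mass_add_ge_one ht
  have : (0 : ℝ) < q.mAs tuning n k := lt_of_lt_of_le (by positivity) (mAs_ge n k q)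
  exact_mod_cast this

theorem radAs_pos (H : Model q X act xs) (k : ℕ) : 0 < q.radAs tuning k := by
  have := H.sigStar_pos
  have := H.rho_pos
  have := H.s_pos
  have := H.nu_pos
  have : (0 : ℝ) < tuning.aRad := tuning.aRad_pos
  unfold Params.radAs
  positivity

/-- In the asymptotic phase R²4^k is constant, so stages four times longer with steps four times
smaller, or batches four times larger, exactly offset the halved radius. The constant 1024 = 32² is
also the stopping threshold `aStop`. -/
theorem radAs_sq (H : Model q X act xs) (k : ℕ) :
    q.radAs tuning k ^ 2 * (q.nu * 4 ^ k) = 1024 * q.sigStar ^ 2 * (q.rho * q.s) := by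
  have := H.rho_pos
  have := H.s_pos
  have := H.nu_pos
  have e : (4 : ℝ) ^ k = (2 ^ k) ^ 2 := by rw [← pow_mul, mul_comm, pow_mul]; norm_num
  have e2 : tuning.aRad = 32 := rfl
  rw [Params.radAs, e2, div_pow, mul_pow, mul_pow, Real.sq_sqrt (by positivity), e]
  field_simp
  ring

theorem radAs_succ (q : Params) (k : ℕ) : q.radAs tuning (k + 1) = q.radAs tuning k / 2 := by
  rw [Params.radAs, Params.radAs, pow_succ, div_div]

/-- With these constants the prescribed penalty is the R/(16ρs) that the halving property asks for.
-/
theorem penAs_eq (H : Model q X act xs) (k : ℕ) :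
    4 * q.penAs (k + 1) = q.radAs tuning k / (16 * (q.rho * q.s)) := by
  have hρ := H.rho_pos
  have hs := H.s_pos
  have hν := H.nu_pos
  have e2 : tuning.aRad = 32 := rfl
  have e : √(q.rho * q.s / q.nu) = q.rho * q.s / √(q.rho * q.nu * q.s) := by
    rw [eq_div_iff (by positivity), ← Real.sqrt_mul (by positivity)]
    have : q.rho * q.s / q.nu * (q.rho * q.nu * q.s) = (q.rho * q.s) ^ 2 := by field_simp
    rw [this, Real.sqrt_sq (by positivity)]
  rw [Params.penAs, Params.radAs, e2, e, pow_succ]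
  have : 0 < √(q.rho * q.nu * q.s) := by positivity
  field_simp
  ring

theorem isAdaptedPoint_prePoint (H : Model q X act xs) (ht : 0 ≤ q.t) (hR : 0 < q.R)
    {x₀ : Fin n → ℝ} (hx₀ : x₀ ∈ X) (k : ℕ) :
    IsAdaptedPoint X (k * q.m0 tuning n) fun w =>
      prePoint tuning q X act x₀ (obsSeq act xs q.sig w) k := by
  have hρ := H.rho_pos
  have hs := H.s_pos
  have hν := H.nu_pos
  induction k with
  | zero => exact isAdaptedPoint_const hx₀ _
  | succ k ih =>
    have hr : 0 < q.radPre k := by unfold Params.radPre; positivity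
    have hp := tuning.aPen_pos
    have := H.isAdaptedPoint_csmd (γ := 1 / (4 * q.nu))
      (κ := tuning.aPen * (q.radPre k / (q.rho * q.s))) hr (by positivity) (by positivity)
      (H.m0_pos ht) 1 ih
    rw [mul_one, ← add_one_mul] at this
    exact this

theorem isAdaptedPoint_asPoint (H : Model q X act xs) (ht : 0 ≤ q.t) (hR : 0 < q.R)
    {x₀ : Fin n → ℝ} (hx₀ : x₀ ∈ X) (k : ℕ) :
    IsAdaptedPoint X (q.m0 tuning n * q.K1 tuning n + ∑ j ∈ Finset.range k, q.mAs tuning n (j + 1))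
      fun w => asPoint tuning q X act x₀ (obsSeq act xs q.sig w) k := by
  have hν := H.nu_pos
  induction k with
  | zero =>
    have := H.isAdaptedPoint_prePoint ht hR hx₀ (q.K1 tuning n)
    rw [mul_comm] at this
    exact this
  | succ k ih =>
    have h1 : (0 : ℝ) ≤ tuning.aPenAs * q.penAs (k + 1) := by
      change 0 ≤ 4 * q.penAs (k + 1)
      have hρ := H.rho_pos
      have hs := H.s_pos
      have := H.radAs_pos k
      rw [H.penAs_eq]
      positivity
    have h2 := tuning.aStepAs_pos
    have := H.isAdaptedPoint_csmd (γ := tuning.aStepAs / (4 ^ (k + 1) * q.nu)) (H.radAs_pos k)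
      (by positivity) h1 (H.mAs_pos ht (k + 1)) 1 ih
    rw [mul_one, add_assoc, ← Finset.sum_range_succ] at this
    exact this

theorem isAdaptedPoint_mbPoint (H : Model q X act xs) (ht : 0 ≤ q.t) (hR : 0 < q.R)
    {x₀ : Fin n → ℝ} (hx₀ : x₀ ∈ X) (k : ℕ) :
    IsAdaptedPoint X (q.m0 tuning n * q.K1 tuning n +
      ∑ j ∈ Finset.range k, q.m0 tuning n * Params.batch tuning n (j + 1))
      fun w => mbPoint tuning q X act x₀ (obsSeq act xs q.sig w) k := by
  have hν := H.nu_pos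
  induction k with
  | zero =>
    have := H.isAdaptedPoint_prePoint ht hR hx₀ (q.K1 tuning n)
    rw [mul_comm] at this
    exact this
  | succ k ih =>
    have h1 : (0 : ℝ) ≤ tuning.aPenMb * q.penAs (k + 1) := by
      change 0 ≤ 4 * q.penAs (k + 1)
      have hρ := H.rho_pos
      have hs := H.s_pos
      have := H.radAs_pos k
      rw [H.penAs_eq]
      positivity
    have := H.isAdaptedPoint_csmd (γ := 1 / (4 * q.nu)) (H.radAs_pos k)
      (by positivity) h1 (H.m0_pos ht) (Params.batch tuning n (k + 1)) ih
    rw [add_assoc, ← Finset.sum_range_succ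
      (fun j => q.m0 tuning n * Params.batch tuning n (j + 1))] at this
    exact this

/-- A stage of the preliminary phase. -/
theorem measure_prePoint_le (H : Model q X act xs) (hU : IsIID P U μ)
    (hμ : IsNoiseLaw μ q.nuBar q.kapSig) (ht : 0 ≤ q.t) (hR : 0 < q.R) {x₀ : Fin n → ℝ}
    (hx₀ : x₀ ∈ X) {k : ℕ} (hk : 1024 * (q.rho * q.sigStar ^ 2 * q.s) ≤ q.radPre k ^ 2 * q.nu) :
    P {ω | l1 (prePoint tuning q X act x₀ (obsSeq act xs q.sig fun i => U i ω) k - xs) ≤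
        q.radPre k ∧ q.radPre (k + 1) <
          l1 (prePoint tuning q X act x₀ (obsSeq act xs q.sig fun i => U i ω) (k + 1) - xs)} ≤
      3 * ENNReal.ofReal (Real.exp (-(2 * q.t))) := by
  have hρ := H.rho_pos
  have hs := H.s_pos
  have hν := H.nu_pos
  have hΘ := one_le_dgfMax H.two_le
  have hg := H.one_le_mass
  have hm := m0_ge n q
  have hr : 0 < q.radPre k := by unfold Params.radPre; positivity
  have hhalf : q.radPre (k + 1) = q.radPre k / 2 := by
    rw [Params.radPre, Params.radPre, pow_succ, div_div]
  set m : ℝ := (q.m0 tuning n : ℝ) with hmdef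
  set g := q.rho * q.s * q.nu with hgdef
  have hm' : 4096 * (g * (dgfMax n + q.t)) ≤ m := by
    rw [hgdef]; linarith [hm]
  have hgΘ : 1 ≤ g * dgfMax n := by nlinarith
  have hgt : 0 ≤ g * q.t := by positivity
  rw [hhalf]
  -- The deviation level is τ = 2t rather than t: one factor exp(-t) is later spent on the number of
  -- preliminary stages.
  refine H.measure_csmd_one_le hU hμ hr (γ := 1 / (4 * q.nu)) (by positivity) ?_ ?_
    (H.isAdaptedPoint_prePoint ht hR hx₀ k) (by positivity) ?_ ?_ ?_ ?_ ?_
  · exact le_of_eq (by field_simp)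
  · change 1 / 16 * (q.radPre k / (q.rho * q.s)) = _
    field_simp
  · rw [one_div, inv_mul_eq_div, le_div_iff₀ (by positivity)]
    nlinarith
  · nlinarith
  · nlinarith
  · have h1 := mul_le_mul_of_nonneg_left hm' (sq_nonneg (q.radPre k))
    have h2 := mul_le_mul_of_nonneg_right hk
      (by positivity : 0 ≤ 4096 * (q.rho * q.s * (dgfMax n + q.t)))
    refine le_trans ?_ h1
    have h3 : q.radPre k ^ 2 * (4096 * (g * (dgfMax n + q.t))) = q.radPre k ^ 2 * q.nu *
      (4096 * (q.rho * q.s * (dgfMax n + q.t))) := by rw [hgdef]; ring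
    rw [h3]
    refine le_trans ?_ h2
    have h4 : 1024 * (q.rho * q.sigStar ^ 2 * q.s) * (4096 * (q.rho * q.s * (dgfMax n + q.t))) =
      2 ^ 22 * (q.sigStar ^ 2 * (q.rho * q.s) ^ 2) * dgfMax n +
        2 ^ 21 * q.sigStar ^ 2 * (q.rho * q.s) ^ 2 * (2 * q.t) := by ring
    rw [h4]
    have : 0 ≤ 2 ^ 22 * (q.sigStar ^ 2 * (q.rho * q.s) ^ 2) * dgfMax n := by positivity
    linarith
  · have e : 2048 * (1 / (4 * q.nu)) * q.sigStar ^ 2 * (q.rho * q.s) =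
      512 * (q.rho * q.sigStar ^ 2 * q.s) / q.nu := by field_simp; ring
    rw [e, div_le_iff₀ hν]
    have : 0 ≤ q.rho * q.sigStar ^ 2 * q.s := by positivity
    linarith

/-- A stage of the asymptotic phase without minibatches. -/
theorem measure_asPoint_le (H : Model q X act xs) (hU : IsIID P U μ)
    (hμ : IsNoiseLaw μ q.nuBar q.kapSig) (ht : 0 ≤ q.t) (hR : 0 < q.R) {x₀ : Fin n → ℝ}
    (hx₀ : x₀ ∈ X) (k : ℕ) :
    P {ω | l1 (asPoint tuning q X act x₀ (obsSeq act xs q.sig fun i => U i ω) k - xs) ≤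
        q.radAs tuning k ∧ q.radAs tuning (k + 1) <
          l1 (asPoint tuning q X act x₀ (obsSeq act xs q.sig fun i => U i ω) (k + 1) - xs)} ≤
      3 * ENNReal.ofReal (Real.exp (-(2 * q.t))) := by
  have hρ := H.rho_pos
  have hs := H.s_pos
  have hν := H.nu_pos
  have hΘ := one_le_dgfMax H.two_le
  have hg := H.one_le_mass
  have hm := mAs_ge n (k + 1) q
  have hr := H.radAs_pos k
  have hr2 := H.radAs_sq k
  set m : ℝ := (q.mAs tuning n (k + 1) : ℝ) with hmdef
  set g := q.rho * q.s * q.nu with hgdef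
  have h4k : (1 : ℝ) ≤ 4 ^ k := one_le_pow₀ (by norm_num)
  have hm' : 4096 * 4 ^ k * (g * (dgfMax n + q.t)) ≤ m := by
    rw [hgdef]; rw [pow_succ] at hm; linarith [hm]
  have hgΘ : 1 ≤ g * dgfMax n := by nlinarith
  have hgt : 0 ≤ g * q.t := by positivity
  have hm'' : 4096 * (g * (dgfMax n + q.t)) ≤ m := by
    refine le_trans ?_ hm'
    have : 0 ≤ 4096 * (g * (dgfMax n + q.t)) := by nlinarith
    nlinarith
  rw [radAs_succ]
  refine H.measure_csmd_one_le hU hμ hr (γ := tuning.aStepAs / (4 ^ (k + 1) * q.nu)) ?_ ?_ ?_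
    (H.isAdaptedPoint_asPoint ht hR hx₀ k) (by positivity) ?_ ?_ ?_ ?_ ?_
  · have := tuning.aStepAs_pos; positivity
  · change 1 / (4 ^ (k + 1) * q.nu) * q.nu ≤ 1 / 4
    rw [pow_succ, one_div, mul_inv, mul_assoc, inv_mul_cancel₀ hν.ne', mul_one, one_div]
    exact inv_anti₀ (by norm_num) (by linarith)
  · exact H.penAs_eq k
  · change _ ≤ 1 / (4 ^ (k + 1) * q.nu) * m
    rw [one_div, inv_mul_eq_div, le_div_iff₀ (by positivity)]
    refine le_trans ?_ hm'
    have e1 : 4096 * 4 ^ k * (g * (dgfMax n + q.t)) = 4096 * 4 ^ k * (g * dgfMax n) +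
      4096 * 4 ^ k * (g * q.t) := by ring
    have e2 : 512 * (q.rho * q.s) * dgfMax n * (4 ^ (k + 1) * q.nu) =
      2048 * 4 ^ k * (g * dgfMax n) := by rw [hgdef, pow_succ]; ring
    have : 0 ≤ 4096 * 4 ^ k * (g * q.t) := by positivity
    have : 0 ≤ 4 ^ k * (g * dgfMax n) := by positivity
    rw [e1, e2]
    linarith
  · nlinarith
  · nlinarith
  · have h1 := mul_le_mul_of_nonneg_left hm' (sq_nonneg (q.radAs tuning k))
    refine le_trans ?_ h1
    have h3 : q.radAs tuning k ^ 2 * (4096 * 4 ^ k * (g * (dgfMax n + q.t))) =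
      q.radAs tuning k ^ 2 * (q.nu * 4 ^ k) * (4096 * (q.rho * q.s * (dgfMax n + q.t))) := by
      rw [hgdef]; ring
    rw [h3, hr2]
    have h4 : 1024 * q.sigStar ^ 2 * (q.rho * q.s) * (4096 * (q.rho * q.s * (dgfMax n + q.t))) =
      2 ^ 22 * (q.sigStar ^ 2 * (q.rho * q.s) ^ 2) * dgfMax n +
        2 ^ 21 * q.sigStar ^ 2 * (q.rho * q.s) ^ 2 * (2 * q.t) := by ring
    rw [h4]
    have : 0 ≤ 2 ^ 22 * (q.sigStar ^ 2 * (q.rho * q.s) ^ 2) * dgfMax n := by positivity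
    linarith
  · change 2048 * (1 / (4 ^ (k + 1) * q.nu)) * q.sigStar ^ 2 * (q.rho * q.s) ≤ _
    have e : 2048 * (1 / (4 ^ (k + 1) * q.nu)) * q.sigStar ^ 2 * (q.rho * q.s) =
      512 * q.sigStar ^ 2 * (q.rho * q.s) / (q.nu * 4 ^ k) := by
      rw [pow_succ]; field_simp; ring
    rw [e, div_le_iff₀ (by positivity), hr2]
    have : 0 ≤ q.sigStar ^ 2 * (q.rho * q.s) := by positivity
    linarith

/-- A stage of the asymptotic phase with minibatches. -/
theorem measure_mbPoint_le (H : Model q X act xs) (hU : IsIID P U μ)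
    (hμ : IsNoiseLaw μ q.nuBar q.kapSig) (ht : 0 ≤ q.t) (hR : 0 < q.R) {x₀ : Fin n → ℝ}
    (hx₀ : x₀ ∈ X) (k : ℕ) :
    P {ω | l1 (mbPoint tuning q X act x₀ (obsSeq act xs q.sig fun i => U i ω) k - xs) ≤
        q.radAs tuning k ∧ q.radAs tuning (k + 1) <
          l1 (mbPoint tuning q X act x₀ (obsSeq act xs q.sig fun i => U i ω) (k + 1) - xs)} ≤
      3 * ENNReal.ofReal (Real.exp (-(2 * q.t))) := by
  have hρ := H.rho_pos
  have hs := H.s_pos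
  have hν := H.nu_pos
  have hΘ := one_le_dgfMax H.two_le
  have hg := H.one_le_mass
  have hm := m0_ge n q
  have hL := batch_ge n (k + 1)
  have hr := H.radAs_pos k
  have hr2 := H.radAs_sq k
  set m : ℝ := (q.m0 tuning n : ℝ) with hmdef
  set g := q.rho * q.s * q.nu with hgdef
  have hm' : 4096 * (g * (dgfMax n + q.t)) ≤ m := by
    rw [hgdef]; linarith [hm]
  have hL' : 16 * 4 ^ k * dgfMax n ≤ (Params.batch tuning n (k + 1) : ℝ) := by
    rw [pow_succ] at hL; linarith
  have hgΘ : 1 ≤ g * dgfMax n := by nlinarith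
  have hgt : 0 ≤ g * q.t := by positivity
  rw [radAs_succ]
  refine H.measure_csmd_batch_le hU hμ hr (γ := 1 / (4 * q.nu)) (by positivity) ?_ ?_
    (batch_pos H.two_le _) (H.isAdaptedPoint_mbPoint ht hR hx₀ k) (by positivity) ?_ ?_ ?_ ?_ ?_
  · exact le_of_eq (by field_simp)
  · exact H.penAs_eq k
  · rw [one_div, inv_mul_eq_div, le_div_iff₀ (by positivity)]
    nlinarith
  · nlinarith
  · nlinarith
  · have h0 : 4096 * (g * (dgfMax n + q.t)) * 4 ^ k ≤ m * (Params.batch tuning n (k + 1) : ℝ) := by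
      refine mul_le_mul hm' (le_trans ?_ hL') (by positivity) (le_trans (by positivity) hm')
      have : (0 : ℝ) < 4 ^ k := by positivity
      nlinarith
    have h1 := mul_le_mul_of_nonneg_left h0 (sq_nonneg (q.radAs tuning k))
    refine le_trans ?_ h1
    have h3 : q.radAs tuning k ^ 2 * (4096 * (g * (dgfMax n + q.t)) * 4 ^ k) =
      q.radAs tuning k ^ 2 * (q.nu * 4 ^ k) * (4096 * (q.rho * q.s * (dgfMax n + q.t))) := by
      rw [hgdef]; ring
    rw [h3, hr2]
    have h4 : 1024 * q.sigStar ^ 2 * (q.rho * q.s) * (4096 * (q.rho * q.s * (dgfMax n + q.t))) =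
      2 ^ 22 * (q.sigStar ^ 2 * (q.rho * q.s) ^ 2) * dgfMax n +
        2 ^ 21 * q.sigStar ^ 2 * (q.rho * q.s) ^ 2 * (2 * q.t) := by ring
    rw [h4]
    have : 0 ≤ 2 ^ 22 * (q.sigStar ^ 2 * (q.rho * q.s) ^ 2) * dgfMax n := by positivity
    linarith
  · have h1 := mul_le_mul_of_nonneg_left hL' (sq_nonneg (q.radAs tuning k))
    refine le_trans ?_ h1
    have e : 49152 * (1 / (4 * q.nu)) * q.sigStar ^ 2 * (q.rho * q.s) * dgfMax n =
      12288 * q.sigStar ^ 2 * (q.rho * q.s) * dgfMax n / q.nu := by field_simp; ring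
    rw [e, div_le_iff₀ hν]
    have e2 : q.radAs tuning k ^ 2 * (16 * 4 ^ k * dgfMax n) * q.nu =
      q.radAs tuning k ^ 2 * (q.nu * 4 ^ k) * (16 * dgfMax n) := by ring
    rw [e2, hr2]
    have : 0 ≤ q.sigStar ^ 2 * (q.rho * q.s) * dgfMax n := by positivity
    linarith

end Model

end CSMDSR
namespace CSMDSR
open scoped ENNReal NNReal

/-! ### The number of stages -/

theorem sum_numStages_le (cost : ℕ → ℕ) (B : ℕ) :
    ∑ k ∈ Finset.range (numStages cost B), cost (k + 1) ≤ B :=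
  Nat.findGreatest_spec (P := fun K => ∑ k ∈ Finset.range K, cost (k + 1) ≤ B) (Nat.zero_le B)
    (by simp)

theorem lt_sum_numStages_succ {cost : ℕ → ℕ} (hc : ∀ k, 0 < cost k) (B : ℕ) :
    B < ∑ k ∈ Finset.range (numStages cost B + 1), cost (k + 1) := by
  rcases le_or_gt (numStages cost B + 1) B with h | h
  · exact not_le.1 (Nat.findGreatest_is_greatest
      (P := fun K => ∑ k ∈ Finset.range K, cost (k + 1) ≤ B) (Nat.lt_succ_self _) h)
  -- The search in `numStages` is capped at B, but more than B stages of positive cost exceed B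
  -- anyway.
  · refine h.trans_le ?_
    have := Finset.sum_le_sum (f := fun _ => 1) (g := fun k => cost (k + 1))
      fun k (_ : k ∈ Finset.range (numStages cost B + 1)) => Nat.succ_le_of_lt (hc (k + 1))
    simpa using this

theorem numStages_eq_zero {cost : ℕ → ℕ} {B : ℕ} (h : B < cost 1) : numStages cost B = 0 := by
  by_contra h0
  have h1 := sum_numStages_le cost B
  have h2 : cost (0 + 1) ≤ ∑ k ∈ Finset.range (numStages cost B), cost (k + 1) :=
    Finset.single_le_sum (f := fun k => cost (k + 1)) (fun _ _ => Nat.zero_le _)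
      (Finset.mem_range.2 (Nat.pos_of_ne_zero h0))
  rw [zero_add] at h2
  omega

/-- The last stage performed alone costs at least 4^K, hence 4^K ≤ N. -/
theorem numStages_le_log {cost : ℕ → ℕ} (hc : ∀ k, 4 ^ k ≤ cost k) {B N : ℕ} (hBN : B ≤ N) :
    (numStages cost B : ℝ) ≤ Real.log N := by
  rcases Nat.eq_zero_or_pos (numStages cost B) with h0 | h0
  · rw [h0, Nat.cast_zero]; exact Real.log_natCast_nonneg N
  · obtain ⟨K, hK⟩ := Nat.exists_eq_add_of_lt h0
    rw [zero_add] at hK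
    have h1 := sum_numStages_le cost B
    have h2 : cost (K + 1) ≤ ∑ k ∈ Finset.range (numStages cost B), cost (k + 1) :=
      Finset.single_le_sum (f := fun k => cost (k + 1)) (fun _ _ => Nat.zero_le _)
        (Finset.mem_range.2 (by omega))
    have h3 : 4 ^ numStages cost B ≤ N := by
      rw [hK]; exact (hc _).trans (h2.trans (h1.trans hBN))
    have h4 : (4 : ℝ) ^ numStages cost B ≤ N := by exact_mod_cast h3
    have h5 := Real.log_le_log (by positivity) h4
    rw [Real.log_pow] at h5
    have h6 : 1 ≤ Real.log 4 := by
      rw [show (4 : ℝ) = 2 ^ 2 by norm_num, Real.log_pow]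
      have := Real.log_two_gt_d9
      push_cast; linarith
    refine le_trans ?_ h5
    exact le_mul_of_one_le_right (Nat.cast_nonneg _) h6

/-- A geometric sum is comparable to its last term. Applied up to the first stage that no longer
fits, it bounds the budget by a multiple of 4^K. -/
theorem sum_le_of_geometric {cost : ℕ → ℕ} {M : ℝ} (hM : 0 ≤ M)
    (hc : ∀ k, (cost (k + 1) : ℝ) ≤ M * 4 ^ k) (K : ℕ) :
    ((∑ k ∈ Finset.range (K + 1), cost (k + 1) : ℕ) : ℝ) ≤ 2 * M * 4 ^ K := by
  push_cast
  induction K with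
  | zero => have := hc 0; simp at this ⊢; linarith
  | succ K ih =>
    rw [Finset.sum_range_succ]
    have := hc (K + 1)
    have h4 : (0 : ℝ) < 4 ^ K := by positivity
    rw [pow_succ] at this ⊢
    nlinarith [mul_nonneg hM h4.le]

/-! ### Chains of stages -/

/-- A first failing stage starts within its radius, so a union bound over the events "good start,
bad end" suffices. -/
theorem measure_chain_le {Ω : Type*} [MeasurableSpace Ω] {P : Measure Ω} {d : ℕ → Ω → ℝ}
    {r : ℕ → ℝ} {ε : ℝ≥0∞} {K : ℕ}
    (h : ∀ k < K, P {ω | d k ω ≤ r k ∧ r (k + 1) < d (k + 1) ω} ≤ ε) :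
    P {ω | d 0 ω ≤ r 0 ∧ r K < d K ω} ≤ K * ε := by
  induction K with
  | zero =>
    have : {ω | d 0 ω ≤ r 0 ∧ r 0 < d 0 ω} = ∅ := by
      ext ω
      simp only [Set.mem_ofPred_eq, Set.mem_empty_iff_false, iff_false, not_and, not_lt]
      exact id
    simp [this]
  | succ K ih =>
    have h1 := ih fun k hk => h k (by omega)
    have h2 := h K (Nat.lt_succ_self K)
    have hsub : {ω | d 0 ω ≤ r 0 ∧ r (K + 1) < d (K + 1) ω} ⊆
        {ω | d 0 ω ≤ r 0 ∧ r K < d K ω} ∪ {ω | d K ω ≤ r K ∧ r (K + 1) < d (K + 1) ω} := by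
      rintro ω ⟨ha, hb⟩
      rcases lt_or_ge (r K) (d K ω) with hc | hc
      · exact Or.inl ⟨ha, hc⟩
      · exact Or.inr ⟨hc, hb⟩
    calc _ ≤ _ := measure_mono hsub
      _ ≤ _ := measure_union_le _ _
      _ ≤ K * ε + ε := add_le_add h1 h2
      _ = ((K + 1 : ℕ) : ℝ≥0∞) * ε := by push_cast; ring

/-! ### Radii and accuracy in terms of the sample budget. -/

namespace Model

variable {n : ℕ} {q : Params} {X : Set (Fin n → ℝ)} {act : ℝ → ℝ} {xs : Fin n → ℝ}

/-- The number of stages after which the radius of the preliminary phase reaches its target. -/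
noncomputable def preTarget (q : Params) : ℕ :=
  ⌈(1 / 2 : ℝ) * Real.logb 2 (q.R ^ 2 * q.nu / (1024 * (q.rho * q.sigStar ^ 2 * q.s)))⌉₊

theorem K1_eq (q : Params) (n : ℕ) : q.K1 tuning n = min (preTarget q) (q.N / q.m0 tuning n) := rfl

theorem two_mul_lt_logb_iff {y : ℝ} (hy : 0 < y) (k : ℕ) :
    (k : ℝ) < 1 / 2 * Real.logb 2 y ↔ (4 : ℝ) ^ k < y := by
  have h : (4 : ℝ) ^ k = 2 ^ (2 * (k : ℝ)) := by
    rw [Real.rpow_mul (by norm_num), Real.rpow_natCast]; norm_num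
  rw [h, ← Real.lt_logb_iff_rpow_lt (by norm_num) hy]
  constructor <;> intro h <;> linarith

theorem radPre_sq (q : Params) (k : ℕ) : q.radPre k ^ 2 * 4 ^ k = q.R ^ 2 := by
  have e : (4 : ℝ) ^ k = (2 ^ k) ^ 2 := by rw [← pow_mul, mul_comm, pow_mul]; norm_num
  rw [Params.radPre, e, div_pow, div_mul_cancel₀ _ (by positivity)]

/-- The stages before the target are exactly those whose radius still dominates the noise, which is
the hypothesis of `measure_prePoint_le`. -/
theorem lt_preTarget_iff (H : Model q X act xs) (hR : 0 < q.R) (k : ℕ) :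
    k < preTarget q ↔ 1024 * (q.rho * q.sigStar ^ 2 * q.s) < q.radPre k ^ 2 * q.nu := by
  have hρ := H.rho_pos
  have hs := H.s_pos
  have hν := H.nu_pos
  have hσ := H.sigStar_pos
  rw [preTarget, Nat.lt_ceil, two_mul_lt_logb_iff (by positivity), lt_div_iff₀ (by positivity),
    ← radPre_sq q k]
  have h4 : (0 : ℝ) < 4 ^ k := by positivity
  rw [show q.radPre k ^ 2 * 4 ^ k * q.nu = 4 ^ k * (q.radPre k ^ 2 * q.nu) by ring,
    mul_lt_mul_iff_right₀ h4]

/-- At the target, the radius of the preliminary phase is at most the initial radius of the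
asymptotic phase. -/
theorem radPre_le_radAs (H : Model q X act xs) (hR : 0 < q.R) {k : ℕ} (hk : preTarget q ≤ k) :
    q.radPre k ≤ q.radAs tuning 0 := by
  have h := mt (H.lt_preTarget_iff hR k).2 (not_lt.2 hk)
  have h2 := H.radAs_sq 0
  have hν := H.nu_pos
  rw [pow_zero, mul_one] at h2
  refine le_of_sq_le_sq ?_ (H.radAs_pos 0).le
  refine le_of_mul_le_mul_right ?_ hν
  rw [h2]
  linarith [not_lt.1 h]

/-- One stage before the target the preliminary radius still exceeds r_0. This bounds r_0 by an
exponentially small quantity when the preliminary phase uses up half of the budget. -/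
theorem radAs_le_radPre (H : Model q X act xs) (hR : 0 < q.R) {k : ℕ} (hk : k < preTarget q) :
    q.radAs tuning 0 ≤ q.radPre k := by
  have h := (H.lt_preTarget_iff hR k).1 hk
  have h2 := H.radAs_sq 0
  have hν := H.nu_pos
  rw [pow_zero, mul_one] at h2
  have hr : 0 < q.radPre k := by unfold Params.radPre; positivity
  refine le_of_sq_le_sq ?_ hr.le
  refine le_of_mul_le_mul_right ?_ hν
  rw [h2]
  linarith

theorem linRate_eq (q : Params) (n : ℕ) :
    linRate q n = q.N / (q.rho * q.s * q.nu * (Real.log n + q.t)) := by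
  rw [linRate, Params.rho, Params.nu]
  simp only [div_eq_mul_inv, mul_inv, inv_inv]
  ring

theorem log_add_pos (H : Model q X act xs) (ht : 0 ≤ q.t) : 0 < Real.log n + q.t := by
  have h1 := dgfMax_le H.two_le
  have h2 := one_le_dgfMax H.two_le
  linarith

/-- The number of preliminary stages is controlled by the confidence level. -/
theorem K1_le (H : Model q X act xs) (ht : 0 ≤ q.t) (hR : 0 < q.R)
    (hmin : min (Real.log (q.R ^ 2 * q.rUp * q.rLow * q.kapSig / (q.sig ^ 2 * q.s)))
      (linRate q n) ≤ Real.exp q.t) : (q.K1 tuning n : ℝ) ≤ 2 * Real.exp q.t := by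
  have hρ := H.rho_pos
  have hs := H.s_pos
  have hν := H.nu_pos
  have hσ := H.sigStar_pos
  have he : 1 ≤ Real.exp q.t := Real.one_le_exp ht
  rw [K1_eq]
  rcases min_le_iff.1 hmin with h | h
  · refine le_trans (Nat.cast_le.2 (min_le_left _ _)) ?_
    set y := q.R ^ 2 * q.nu / (1024 * (q.rho * q.sigStar ^ 2 * q.s)) with hy
    have hy0 : 0 < y := by positivity
    have hyle : y ≤ q.R ^ 2 * q.rUp * q.rLow * q.kapSig / (q.sig ^ 2 * q.s) := by
      -- The quantity in the hypothesis is R²ν/(ρσ_*²s), the one that defines the target.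
      have e : q.R ^ 2 * q.rUp * q.rLow * q.kapSig / (q.sig ^ 2 * q.s) = 1024 * y := by
        have := H.kapSig_pos
        have := H.rLow_pos
        have := H.nuBar_pos
        have := H.sig_pos
        rw [hy, Params.rho, Params.nu, Params.sigStar]
        field_simp
      linarith
    have h1 : Real.log y ≤ Real.exp q.t := (Real.log_le_log hy0 hyle).trans h
    have h2 : 1 / 2 * Real.logb 2 y ≤ Real.exp q.t := by
      have hl2 := Real.log_two_gt_d9
      rw [Real.logb]
      rw [← mul_div_assoc, div_le_iff₀ (by linarith)]
      nlinarith
    have h3 : (preTarget q : ℝ) ≤ ⌈Real.exp q.t⌉₊ := Nat.cast_le.2 (Nat.ceil_mono h2)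
    have h4 := Nat.ceil_lt_add_one (Real.exp_pos q.t).le
    linarith
  · refine le_trans (Nat.cast_le.2 (min_le_right _ _)) ?_
    refine Nat.cast_div_le.trans ?_
    have hm := m0_ge n q
    have hlog := log_le_dgfMax H.two_le
    have hpos := H.log_add_pos ht
    have h1 : q.rho * q.s * q.nu * (Real.log n + q.t) ≤ q.m0 tuning n := by
      refine le_trans ?_ hm
      have e1 : q.rho * q.s * q.nu * (Real.log n + q.t) ≤
        q.rho * q.s * q.nu * (dgfMax n + q.t) := by gcongr
      have e2 : 0 ≤ q.rho * q.s * q.nu * (Real.log n + q.t) := by positivity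
      linarith
    have h2 : (q.N : ℝ) / q.m0 tuning n ≤ linRate q n := by
      rw [linRate_eq]
      gcongr
    linarith

/-- 24576 = 2 · 4096 · 3: rounding up, `aLen`, and Θ ≤ 3 ln n. -/
theorem m0_le (H : Model q X act xs) (ht : 0 ≤ q.t) :
    (q.m0 tuning n : ℝ) ≤ 24576 * (q.rho * q.s * q.nu * (Real.log n + q.t)) := by
  have h1 := H.mass_add_ge_one ht
  have h2 := dgfMax_le H.two_le
  have hρ := H.rho_pos
  have hs := H.s_pos
  have hν := H.nu_pos
  have h3 : (q.m0 tuning n : ℝ) ≤ 2 * (4096 * (q.s * q.rho * q.nu * (dgfMax n + q.t))) :=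
    Nat.ceil_le_two_mul
      (show (2 : ℝ)⁻¹ ≤ 4096 * (q.s * q.rho * q.nu * (dgfMax n + q.t)) by linarith)
  have h4 : q.s * q.rho * q.nu * (dgfMax n + q.t) ≤
      q.s * q.rho * q.nu * (3 * (Real.log n + q.t)) := by gcongr; linarith
  linarith

theorem two_le_N (H : Model q X act xs) (ht : 0 ≤ q.t) (hN : q.m0 tuning n ≤ q.N) : 2 ≤ q.N := by
  have h1 := H.mass_add_ge_one ht
  have h2 := m0_ge n q
  have h3 : (2 : ℝ) ≤ q.m0 tuning n := by linarith
  have : 2 ≤ q.m0 tuning n := by exact_mod_cast h3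
  omega

theorem two_pow_neg_le {K : ℕ} {x : ℝ} (h : x ≤ 2 * K) : (1 : ℝ) / 2 ^ K ≤ Real.exp (-(x / 4)) := by
  have h1 : (2 : ℝ) ^ K = Real.exp (K * Real.log 2) := by
    rw [mul_comm, Real.exp_mul, Real.exp_log (by norm_num), Real.rpow_natCast]
  rw [h1, one_div, ← Real.exp_neg, Real.exp_le_exp]
  have := Real.log_two_gt_d9
  have hK : (0 : ℝ) ≤ K := Nat.cast_nonneg K
  nlinarith

/-- The accuracy of the preliminary phase if it uses at least half of the budget. -/
theorem radPre_le_exp (H : Model q X act xs) (ht : 0 ≤ q.t) (hR : 0 < q.R) {K : ℕ}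
    (hK : q.N ≤ 2 * (q.m0 tuning n * (K + 1))) :
    q.radPre K ≤ 2 * (q.R * Real.exp (-(1 / 98304) * linRate q n)) := by
  have hpos := H.log_add_pos ht
  have hρ := H.rho_pos
  have hs := H.s_pos
  have hν := H.nu_pos
  have hK' : (q.N : ℝ) ≤ 2 * (q.m0 tuning n * ((K + 1 : ℕ) : ℝ)) := by exact_mod_cast hK
  have h1 : linRate q n / 24576 ≤ 2 * ((K + 1 : ℕ) : ℝ) := by
    rw [linRate_eq, div_div, div_le_iff₀ (by positivity)]
    have := mul_le_mul_of_nonneg_right (H.m0_le ht) (Nat.cast_nonneg (K + 1) : (0 : ℝ) ≤ _)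
    linarith
  have h2 := two_pow_neg_le h1
  -- The hypothesis counts K + 1 stages while the radius has index K; one extra factor 2 covers both
  -- an unfinished stage and the stage before the target.
  have e : q.radPre K = 2 * (q.R * (1 / 2 ^ (K + 1))) := by
    rw [Params.radPre, pow_succ]; field_simp
  rw [e]
  have e2 : -(linRate q n / 24576 / 4) = -(1 / 98304) * linRate q n := by ring
  rw [e2] at h2
  gcongr

/-- The accuracy of the asymptotic phase if it uses at least half of the budget. -/
theorem radAs_le_sqrt (H : Model q X act xs) {E M : ℝ} {K : ℕ} (hE : 0 ≤ E)
    (hN0 : 0 < q.N) (hM : M ≤ 2 ^ 18 * 9 * (q.rho * q.s * q.nu * E))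
    (hN : (q.N : ℝ) ≤ 4 * M * 4 ^ K) :
    q.radAs tuning K ≤ 98304 * (q.sig * q.nuBar * q.s / (q.rLow * q.kapSig) * √(E / q.N)) := by
  have hρ := H.rho_pos
  have hs := H.s_pos
  have hν := H.nu_pos
  have hσ := H.sigStar_pos
  have hN0' : (0 : ℝ) < q.N := by exact_mod_cast hN0
  have e : q.sig * q.nuBar * q.s / (q.rLow * q.kapSig) = q.sigStar * (q.rho * q.s) := by
    rw [Params.sigStar, Params.rho, div_eq_mul_inv, mul_comm q.rLow]; ring
  rw [e]
  refine le_of_sq_le_sq ?_ (by positivity)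
  rw [mul_pow, mul_pow, Real.sq_sqrt (by positivity)]
  have h1 := H.radAs_sq K
  have h2 : (q.N : ℝ) ≤ 2 ^ 20 * 9 * (q.rho * q.s * q.nu * E) * 4 ^ K := by
    have : M * 4 ^ K ≤ 2 ^ 18 * 9 * (q.rho * q.s * q.nu * E) * 4 ^ K := by gcongr
    linarith
  -- Here 1024 · 2^20 · 9 = 98304².
  have h3 : q.radAs tuning K ^ 2 * (q.nu * 4 ^ K) * q.N ≤
      98304 ^ 2 * ((q.sigStar * (q.rho * q.s)) ^ 2 * E) * (q.nu * 4 ^ K) := by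
    rw [h1]
    have := mul_le_mul_of_nonneg_left h2
      (by positivity : 0 ≤ 1024 * q.sigStar ^ 2 * (q.rho * q.s))
    linarith
  rw [← mul_div_assoc, ← mul_div_assoc, le_div_iff₀ hN0']
  refine le_of_mul_le_mul_right ?_ (by positivity : 0 < q.nu * 4 ^ K)
  linarith

variable {Ω : Type*} [MeasurableSpace Ω] {P : Measure Ω} [IsProbabilityMeasure P]
  {U : ℕ → Ω → (Fin n → ℝ) × ℝ} {μ : Measure ((Fin n → ℝ) × ℝ)}

/-- The error bound for an asymptotic phase whose stages halve the error. -/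
theorem error_bound (H : Model q X act xs) (hU : IsIID P U μ)
    (hμ : IsNoiseLaw μ q.nuBar q.kapSig) (ht : 0 ≤ q.t) (hR : 0 < q.R) {x₀ : Fin n → ℝ}
    (hx₀ : x₀ ∈ X) (hx₀R : l1 (xs - x₀) ≤ q.R) (hN : q.m0 tuning n ≤ q.N)
    (hmin : min (Real.log (q.R ^ 2 * q.rUp * q.rLow * q.kapSig / (q.sig ^ 2 * q.s)))
      (linRate q n) ≤ Real.exp q.t)
    {cost : ℕ → ℕ} {M E : ℝ} (hcost : ∀ k, 4 ^ k ≤ cost k) (hcost1 : q.m0 tuning n ≤ cost 1)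
    (hM0 : 0 ≤ M) (hcostM : ∀ k, (cost (k + 1) : ℝ) ≤ M * 4 ^ k) (hE : 0 ≤ E)
    (hM : M ≤ 2 ^ 18 * 9 * (q.rho * q.s * q.nu * E)) {D : ℕ → Ω → Fin n → ℝ}
    (hD0 : ∀ ω, D 0 ω = prePoint tuning q X act x₀ (obsSeq act xs q.sig fun i => U i ω)
      (q.K1 tuning n))
    (hD : ∀ k, P {ω | l1 (D k ω - xs) ≤ q.radAs tuning k ∧
      q.radAs tuning (k + 1) < l1 (D (k + 1) ω - xs)} ≤
      3 * ENNReal.ofReal (Real.exp (-(2 * q.t)))) :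
    1 - 98304 * Real.exp (-q.t) * Real.log q.N ≤
      P.real {ω | l1 (D (numStages cost (q.budget tuning n)) ω - xs) ≤
        98304 * (q.R * Real.exp (-(1 / 98304) * linRate q n) +
          q.sig * q.nuBar * q.s / (q.rLow * q.kapSig) * √(E / q.N))} := by
  have hN2 := H.two_le_N ht hN
  have hm0 := H.m0_pos ht
  set K := numStages cost (q.budget tuning n) with hK
  set K1 := q.K1 tuning n with hK1
  set ε : ℝ≥0∞ := 3 * ENNReal.ofReal (Real.exp (-(2 * q.t))) with hε
  set b := 98304 * (q.R * Real.exp (-(1 / 98304) * linRate q n) +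
          q.sig * q.nuBar * q.s / (q.rLow * q.kapSig) * √(E / q.N)) with hb
  set G := {ω | l1 (D K ω - xs) ≤ b} with hG
  set e : ℕ → Ω → ℝ := fun k ω =>
    l1 (prePoint tuning q X act x₀ (obsSeq act xs q.sig fun i => U i ω) k - xs) with he
  set d : ℕ → Ω → ℝ := fun k ω => l1 (D k ω - xs) with hd
  have hexp : 0 ≤ q.R * Real.exp (-(1 / 98304) * linRate q n) := by positivity
  have hsqrt : 0 ≤ q.sig * q.nuBar * q.s / (q.rLow * q.kapSig) * √(E / q.N) := by
    have h1 := H.sig_pos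
    have h2 := H.nuBar_pos
    have h3 := H.rLow_pos
    have h4 := H.kapSig_pos
    have h5 := H.s_pos
    positivity
  have hpre : P {ω | e 0 ω ≤ q.radPre 0 ∧ q.radPre K1 < e K1 ω} ≤ K1 * ε := by
    refine measure_chain_le fun k hk => H.measure_prePoint_le hU hμ ht hR hx₀ ?_
    exact ((H.lt_preTarget_iff hR k).1 (hk.trans_le (min_le_left _ _))).le
  have has : P {ω | d 0 ω ≤ q.radAs tuning 0 ∧ q.radAs tuning K < d K ω} ≤ K * ε :=
    measure_chain_le fun k _ => hD k
  have hK1N : q.m0 tuning n * K1 ≤ q.N := by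
    refine le_trans (Nat.mul_le_mul_left _ (min_le_right _ _)) ?_
    rw [mul_comm]; exact Nat.div_mul_le_self _ _
  have hbudget : q.budget tuning n + q.m0 tuning n * K1 = q.N := Nat.sub_add_cancel hK1N
  -- If neither phase fails, the error bound holds deterministically; the cases differ in which
  -- phase consumed the budget.
  have hcover : (Set.univ : Set Ω) ⊆ G ∪
      ({ω | e 0 ω ≤ q.radPre 0 ∧ q.radPre K1 < e K1 ω} ∪
        {ω | d 0 ω ≤ q.radAs tuning 0 ∧ q.radAs tuning K < d K ω}) := by
    intro ω _
    by_contra hnot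
    simp only [Set.mem_union, not_or] at hnot
    obtain ⟨hn1, hn2, hn3⟩ := hnot
    have he0 : e 0 ω ≤ q.radPre 0 := by
      have : q.radPre 0 = q.R := by simp [Params.radPre]
      rw [this]
      change l1 (x₀ - xs) ≤ q.R
      rw [l1_sub_comm]; exact hx₀R
    have heK : e K1 ω ≤ q.radPre K1 := not_lt.1 fun h => hn2 ⟨he0, h⟩
    have hd0 : d 0 ω = e K1 ω := by simp only [hd, he, hD0]
    refine hn1 ?_
    change d K ω ≤ b
    rcases lt_or_ge (q.N / q.m0 tuning n) (preTarget q) with hcase | hcase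
    -- The budget ends before the target: fewer than m₀ observations are left, so no asymptotic
    -- stage is run.
    · have hK1' : K1 = q.N / q.m0 tuning n := min_eq_right hcase.le
      have hlt : q.N < q.m0 tuning n * (K1 + 1) := by
        rw [hK1']; exact Nat.lt_mul_div_succ _ hm0
      have hK0 : K = 0 := numStages_eq_zero (lt_of_lt_of_le (by rw [mul_add_one] at hlt; omega) hcost1)
      rw [hK0, hd0]
      have h1 := H.radPre_le_exp (n := n) ht hR (K := K1) (by omega)
      rw [hb]
      linarith
    · have hK1' : K1 = preTarget q := min_eq_left hcase
      have hd0' : d 0 ω ≤ q.radAs tuning 0 := by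
        rw [hd0]; exact heK.trans (H.radPre_le_radAs hR hK1'.ge)
      have hdK : d K ω ≤ q.radAs tuning K := not_lt.1 fun h => hn3 ⟨hd0', h⟩
      -- Either the asymptotic phase has more than half of the budget and gives the square-root
      -- term, or the preliminary phase used at least half, and r_K ≤ r_0 ≤ R_{K1-1} gives the
      -- exponential term.
      rcases lt_or_ge (2 * (q.m0 tuning n * K1)) q.N with hhalf | hhalf
      · have hlt := lt_sum_numStages_succ (fun k => (pow_pos (by norm_num) k).trans_le (hcost k))
          (q.budget tuning n)
        rw [← hK] at hlt
        have h1 : (q.N : ℝ) ≤ 4 * M * 4 ^ K := by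
          have h2 : q.N ≤ 2 * ∑ k ∈ Finset.range (K + 1), cost (k + 1) := by omega
          have h3 : (q.N : ℝ) ≤ 2 * ((∑ k ∈ Finset.range (K + 1), cost (k + 1) : ℕ) : ℝ) := by
            exact_mod_cast h2
          have := sum_le_of_geometric hM0 hcostM K
          linarith
        have h2 := H.radAs_le_sqrt hE (by omega) hM h1
        rw [hb]
        linarith
      · have hpos : 0 < K1 := by
          rcases Nat.eq_zero_or_pos K1 with h0 | h0
          · rw [h0] at hhalf; omega
          · exact h0
        obtain ⟨k, hk⟩ := Nat.exists_eq_add_of_lt hpos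
        rw [zero_add] at hk
        have h1 := H.radPre_le_exp (n := n) ht hR (K := k) (by rw [← hk]; exact hhalf)
        have h2 := H.radAs_le_radPre hR (k := k) (by omega)
        have h3 : q.radAs tuning K ≤ q.radAs tuning 0 := by
          have h4 := H.radAs_pos 0
          rw [Params.radAs, Params.radAs]
          rw [Params.radAs, pow_zero, div_one] at h4
          rw [pow_zero]
          exact div_le_div_of_nonneg_left h4.le one_pos (one_le_pow₀ (by norm_num))
        rw [hb]
        linarith
  have hprob : 1 ≤ P G + (K1 * ε + K * ε) := by
    calc (1 : ℝ≥0∞) = P Set.univ := measure_univ.symm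
      _ ≤ _ := measure_mono hcover
      _ ≤ _ := (measure_union_le _ _).trans (add_le_add le_rfl ((measure_union_le _ _).trans
          (add_le_add hpre has)))
  have hreal : 1 ≤ P.real G + (K1 * (3 * Real.exp (-(2 * q.t))) + K * (3 * Real.exp (-(2 * q.t)))) := by
    have hεt : ε ≠ ⊤ := ENNReal.mul_ne_top (by norm_num) ENNReal.ofReal_ne_top
    have hεr : ε.toReal = 3 * Real.exp (-(2 * q.t)) := by
      rw [hε, ENNReal.toReal_mul, ENNReal.toReal_ofReal (Real.exp_pos _).le, ENNReal.toReal_ofNat]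
    clear_value ε
    have h1 : (K1 : ℝ≥0∞) * ε ≠ ⊤ := ENNReal.mul_ne_top (ENNReal.natCast_ne_top _) hεt
    have h2 : (K : ℝ≥0∞) * ε ≠ ⊤ := ENNReal.mul_ne_top (ENNReal.natCast_ne_top _) hεt
    have h3 : P G ≠ ⊤ := measure_ne_top P G
    have h4 := ENNReal.toReal_mono (ENNReal.add_ne_top.2 ⟨h3, ENNReal.add_ne_top.2 ⟨h1, h2⟩⟩) hprob
    rw [ENNReal.toReal_add h3 (ENNReal.add_ne_top.2 ⟨h1, h2⟩), ENNReal.toReal_add h1 h2,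
      ENNReal.toReal_mul, ENNReal.toReal_mul, hεr, ENNReal.toReal_natCast, ENNReal.toReal_natCast,
      ENNReal.toReal_one] at h4
    exact h4
  have hK1e := H.K1_le ht hR hmin
  have hKl : (K : ℝ) ≤ Real.log q.N := numStages_le_log hcost (Nat.sub_le _ _)
  have hexp2 : Real.exp (-(2 * q.t)) = Real.exp (-q.t) * Real.exp (-q.t) := by
    rw [← Real.exp_add]; congr 1; ring
  have hexp1 : Real.exp q.t * Real.exp (-q.t) = 1 := by
    rw [← Real.exp_add, add_neg_cancel, Real.exp_zero]
  have hle1 : Real.exp (-q.t) ≤ 1 := Real.exp_le_one_iff.2 (by linarith)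
  have hlogN : 1 / 2 ≤ Real.log q.N := by
    have h1 : Real.log 2 ≤ Real.log q.N := Real.log_le_log (by norm_num) (by exact_mod_cast hN2)
    linarith [Real.log_two_gt_d9]
  have hpe := Real.exp_pos (-q.t)
  -- At most 2exp(t) preliminary stages fail with probability 3exp(-2t) each; ln N ≥ 1/2 then puts
  -- this into the form C exp(-t) ln N.
  have f1 : K1 * (3 * Real.exp (-(2 * q.t))) ≤ 6 * Real.exp (-q.t) := by
    rw [hexp2]
    have := mul_le_mul_of_nonneg_right hK1e (by positivity :
      0 ≤ 3 * (Real.exp (-q.t) * Real.exp (-q.t)))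
    refine this.trans_eq ?_
    linear_combination 6 * Real.exp (-q.t) * hexp1
  have f2 : K * (3 * Real.exp (-(2 * q.t))) ≤ 3 * (Real.exp (-q.t) * Real.log q.N) := by
    rw [hexp2]
    have h1 : Real.exp (-q.t) * Real.exp (-q.t) ≤ Real.exp (-q.t) := mul_le_of_le_one_left hpe.le hle1
    have h2 : K * (3 * (Real.exp (-q.t) * Real.exp (-q.t))) ≤ Real.log q.N * (3 * Real.exp (-q.t)) :=
      mul_le_mul hKl (by linarith) (by positivity) (by linarith)
    linarith
  have f3 := mul_le_mul_of_nonneg_left hlogN hpe.le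
  linarith

theorem cost_as (H : Model q X act xs) (ht : 0 ≤ q.t) :
    (∀ k, 4 ^ k ≤ q.mAs tuning n k) ∧ q.m0 tuning n ≤ q.mAs tuning n 1 ∧
      ∀ k, (q.mAs tuning n (k + 1) : ℝ) ≤
        24576 * (q.rho * q.s * q.nu * (Real.log n + q.t)) * 4 ^ k := by
  have h1 := H.mass_add_ge_one ht
  refine ⟨fun k => ?_, ?_, fun k => ?_⟩
  · have h2 := mAs_ge n k q
    have h3 : (4 : ℝ) ^ k ≤ q.mAs tuning n k := by
      have : (0 : ℝ) < 4 ^ k := by positivity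
      nlinarith
    exact_mod_cast h3
  · refine Nat.ceil_mono ?_
    change 4096 * (q.s * q.rho * q.nu * (dgfMax n + q.t)) ≤
      1024 * (4 ^ 1 * (q.s * q.rho * q.nu * (dgfMax n + q.t)))
    linarith
  · have hρ := H.rho_pos
    have hs := H.s_pos
    have hν := H.nu_pos
    have h2 := dgfMax_le H.two_le
    have h4 : (1 : ℝ) ≤ 4 ^ (k + 1) := one_le_pow₀ (by norm_num)
    have h3 : (q.mAs tuning n (k + 1) : ℝ) ≤
        2 * (1024 * (4 ^ (k + 1) * (q.s * q.rho * q.nu * (dgfMax n + q.t)))) := by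
      refine Nat.ceil_le_two_mul (show (2 : ℝ)⁻¹ ≤
        1024 * (4 ^ (k + 1) * (q.s * q.rho * q.nu * (dgfMax n + q.t))) from ?_)
      nlinarith
    have h5 : 4 ^ k * (q.s * q.rho * q.nu * (dgfMax n + q.t)) ≤
      4 ^ k * (q.s * q.rho * q.nu * (3 * (Real.log n + q.t))) := by gcongr; linarith
    rw [pow_succ] at h3
    linarith

/-- The product of m₀ and the batch size carries Θ(Θ + t), hence E = ln n (ln n + t). The constant
is 24576 · 96, where 96 = 2 · 4 · 4 · 3 comes from rounding, `aBatch`, the shift k + 1 and Θ ≤ 3 ln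
n. -/
theorem cost_mb (H : Model q X act xs) (ht : 0 ≤ q.t) :
    (∀ k, 4 ^ k ≤ q.m0 tuning n * Params.batch tuning n k) ∧
      q.m0 tuning n ≤ q.m0 tuning n * Params.batch tuning n 1 ∧
      ∀ k, ((q.m0 tuning n * Params.batch tuning n (k + 1) : ℕ) : ℝ) ≤
        2 ^ 18 * 9 * (q.rho * q.s * q.nu * (Real.log n * (Real.log n + q.t))) * 4 ^ k := by
  have hΘ := one_le_dgfMax H.two_le
  refine ⟨fun k => ?_, Nat.le_mul_of_pos_right _ (batch_pos H.two_le 1), fun k => ?_⟩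
  · have h2 := batch_ge n k
    have h3 : (4 : ℝ) ^ k ≤ Params.batch tuning n k := by
      have : (0 : ℝ) < 4 ^ k := by positivity
      nlinarith
    have h4 : 4 ^ k ≤ Params.batch tuning n k := by exact_mod_cast h3
    exact h4.trans (Nat.le_mul_of_pos_left _ (H.m0_pos ht))
  · have hρ := H.rho_pos
    have hs := H.s_pos
    have hν := H.nu_pos
    have h2 := dgfMax_le H.two_le
    have h4 : (1 : ℝ) ≤ 4 ^ (k + 1) := one_le_pow₀ (by norm_num)
    have h3 : (Params.batch tuning n (k + 1) : ℝ) ≤ 2 * (4 * (4 ^ (k + 1) * dgfMax n)) := by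
      refine Nat.ceil_le_two_mul (show (2 : ℝ)⁻¹ ≤ 4 * (4 ^ (k + 1) * dgfMax n) from ?_)
      nlinarith
    have h5 : (Params.batch tuning n (k + 1) : ℝ) ≤ 96 * Real.log n * 4 ^ k := by
      have : 4 ^ k * dgfMax n ≤ 4 ^ k * (3 * Real.log n) := by gcongr
      rw [pow_succ] at h3
      linarith
    have hpos := H.log_add_pos ht
    push_cast
    refine (mul_le_mul (H.m0_le ht) h5 (Nat.cast_nonneg _) (by positivity)).trans_eq ?_
    ring

end Model

end CSMDSR
namespace CSMDSR

/-! ### The law of the observations -/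

theorem integral_dot_sq {n : ℕ} {Ω : Type*} [MeasurableSpace Ω] {P : Measure Ω}
    [IsFiniteMeasure P] {φ : Ω → Fin n → ℝ} (hφ : Measurable φ) {B : ℝ}
    (hB : ∀ᵐ ω ∂P, ∀ j, |φ ω j| ≤ B) (v : Fin n → ℝ) :
    ∫ ω, (φ ω ⬝ᵥ v) ^ 2 ∂P = v ⬝ᵥ ((Matrix.of fun j k => ∫ ω, φ ω j * φ ω k ∂P).mulVec v) := by
  have hi : ∀ j k, Integrable (fun ω => φ ω j * φ ω k) P := by
    intro j k
    refine Integrable.of_bound (by fun_prop) (B * B) ?_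
    filter_upwards [hB] with ω hω
    rw [Real.norm_eq_abs, abs_mul]
    exact mul_le_mul (hω j) (hω k) (abs_nonneg _) ((abs_nonneg _).trans (hω j))
  have e : ∀ ω, (φ ω ⬝ᵥ v) ^ 2 = ∑ j, ∑ k, v j * (v k * (φ ω j * φ ω k)) := by
    intro ω
    rw [sq, dotProduct, Finset.sum_mul_sum]
    exact Finset.sum_congr rfl fun j _ => Finset.sum_congr rfl fun k _ => by ring
  simp only [e]
  rw [integral_finsetSum _ fun j _ => integrable_finsetSum _ fun k _ =>
    ((hi j k).const_mul _).const_mul _]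
  rw [dotProduct]
  refine Finset.sum_congr rfl fun j _ => ?_
  rw [integral_finsetSum _ fun k _ => ((hi j k).const_mul _).const_mul _, Matrix.mulVec, dotProduct,
    Finset.mul_sum]
  refine Finset.sum_congr rfl fun k _ => ?_
  rw [integral_const_mul, integral_const_mul, Matrix.of_apply]
  ring

theorem cov_le_of_posSemidef {n : ℕ} {Ω : Type*} [MeasurableSpace Ω] {P : Measure Ω}
    [IsFiniteMeasure P] {φ : Ω → Fin n → ℝ} (hφ : Measurable φ) {B kap : ℝ}
    (hB : ∀ᵐ ω ∂P, ∀ j, |φ ω j| ≤ B)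
    (h : ((Matrix.of fun j k => ∫ ω, φ ω j * φ ω k ∂P) -
      kap • (1 : Matrix (Fin n) (Fin n) ℝ)).PosSemidef) (v : Fin n → ℝ) :
    kap * (v ⬝ᵥ v) ≤ ∫ ω, (φ ω ⬝ᵥ v) ^ 2 ∂P := by
  rw [integral_dot_sq hφ hB]
  have h1 := h.dotProduct_mulVec_nonneg v
  rw [star_trivial, Matrix.sub_mulVec, dotProduct_sub, Matrix.smul_mulVec, Matrix.one_mulVec,
    dotProduct_smul, smul_eq_mul] at h1
  linarith

end CSMDSR

/-! ### The main theorem. -/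

theorem proposition3 :
    ∃ (a : CSMDSR.Tuning) (c C c₀ : ℝ), 0 < c ∧ 0 < C ∧ 0 < c₀ ∧
      ∀ (Ω : Type*) [MeasurableSpace Ω] (P : Measure Ω) [IsProbabilityMeasure P]
        (n : ℕ) (q : CSMDSR.Params) (X : Set (Fin n → ℝ)) (act : ℝ → ℝ)
        (xs x₀ : Fin n → ℝ) (φ : ℕ → Ω → (Fin n → ℝ)) (ξ η : ℕ → Ω → ℝ),
        -- the deterministic data
        2 ≤ n → 1 ≤ q.s → 0 < q.R → 0 < q.sig → 0 < q.kapSig → 0 < q.rLow →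
        Convex ℝ X → IsClosed X → xs ∈ X → x₀ ∈ X →
        (Finset.univ.filter fun j => xs j ≠ 0).card ≤ q.s →
        CSMDSR.l1 (xs - x₀) ≤ q.R →
        -- the activation function
        Monotone act →
        (∀ u v, |act u - act v| ≤ q.rUp * |u - v|) →
        (∀ u v, q.rLow * |u - v| ≤ |act u - act v|) →
        -- the observations
        (∀ i, Measurable (φ i)) → (∀ i, Measurable (ξ i)) →
        iIndepFun (fun i ω => (φ i ω, ξ i ω)) P →
        (∀ i, IdentDistrib (fun ω => (φ i ω, ξ i ω)) (fun ω => (φ 0 ω, ξ 0 ω)) P P) →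
        (∀ i, IndepFun (φ i) (ξ i) P) →
        (∀ i, ∀ᵐ ω ∂P, ∀ j, |φ i ω j| ≤ q.nuBar) →
        (∀ i, ∫⁻ ω, ENNReal.ofReal (Real.exp (ξ i ω ^ 2)) ∂P ≤ ENNReal.ofReal (Real.exp 1)) →
        (∀ i j, ∫ ω, ξ i ω * φ i ω j ∂P = 0) →
        ((Matrix.of fun j k => ∫ ω, φ 0 ω j * φ 0 ω k ∂P) -
          q.kapSig • (1 : Matrix (Fin n) (Fin n) ℝ)).PosSemidef →
        (∀ i ω, η i ω = act (φ i ω ⬝ᵥ xs) + q.sig * ξ i ω) →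
        -- the confidence level and the sample budget
        c₀ * √(Real.log q.N) ≤ q.t → q.m0 a n ≤ q.N →
        min (Real.log (q.R ^ 2 * q.rUp * q.rLow * q.kapSig / (q.sig ^ 2 * q.s)))
          (CSMDSR.linRate q n) ≤ Real.exp q.t →
        -- the error bounds
        1 - C * Real.exp (-q.t) * Real.log q.N ≤
            P.real {ω | CSMDSR.l1 (CSMDSR.output a q X act x₀ (fun i => (φ i ω, η i ω)) - xs) ≤
              C * (q.R * Real.exp (-c * CSMDSR.linRate q n) +
                q.sig * q.nuBar * q.s / (q.rLow * q.kapSig) *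
                  √((Real.log n + q.t) / q.N))} ∧
        1 - C * Real.exp (-q.t) * Real.log q.N ≤
            P.real {ω | CSMDSR.l1 (CSMDSR.outputMb a q X act x₀ (fun i => (φ i ω, η i ω)) - xs) ≤
              C * (q.R * Real.exp (-c * CSMDSR.linRate q n) +
                q.sig * q.nuBar * q.s / (q.rLow * q.kapSig) *
                  √(Real.log n * (Real.log n + q.t) / q.N))} := by
  refine ⟨CSMDSR.tuning, 1 / 98304, 98304, 1, by norm_num, by norm_num, one_pos, ?_⟩
  intro Ω _ P _ n q X act xs x₀ φ ξ η hn hs hR hsig hkap hrLow hX hXc hxs hx₀ hsparse hxsR hmono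
    hlip hlow hφ hξ hindep hident _ hbound hsubG hmean hcov hη ht hN hmin
  have ht0 : 0 ≤ q.t := le_trans (by positivity) ht
  have hcov' := CSMDSR.cov_le_of_posSemidef (hφ 0) (hbound 0) hcov
  obtain ⟨ω₀, hω₀⟩ := (hbound 0).exists
  have hnu0 : 0 ≤ q.nuBar := (abs_nonneg _).trans (hω₀ ⟨0, by omega⟩)
  -- The covariance bound is tested on a basis vector: κ_Σ is at most the second moment of one
  -- coordinate. This also forces ν̄ > 0.
  have hkapnu : q.kapSig ≤ q.nuBar ^ 2 := by
    have h1 := hcov' (Pi.single ⟨0, by omega⟩ 1)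
    simp only [dotProduct_single, Pi.single_eq_same, mul_one] at h1
    refine h1.trans ?_
    have h2 : ∀ᵐ ω ∂P, ‖φ 0 ω ⟨0, by omega⟩ ^ 2‖ ≤ q.nuBar ^ 2 := by
      filter_upwards [hbound 0] with ω hω
      rw [Real.norm_eq_abs, abs_pow]
      exact pow_le_pow_left₀ (abs_nonneg _) (hω _) 2
    have h3 := norm_integral_le_of_norm_le_const h2
    rw [probReal_univ, mul_one] at h3
    exact (le_abs_self _).trans h3
  have hnu : 0 < q.nuBar := lt_of_le_of_ne hnu0 fun h => by
    rw [← h] at hkapnu; norm_num at hkapnu; linarith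
  have H : CSMDSR.Model q X act xs := ⟨hn, hs, hsig, hkap, hrLow, hnu, hkapnu, hX, hXc, hxs,
    hsparse, hmono, hlip, hlow⟩
  -- The i.i.d. sequence used throughout is that of the pairs (φ, ξ); the observations are functions
  -- of it.
  set U : ℕ → Ω → (Fin n → ℝ) × ℝ := fun i ω => (φ i ω, ξ i ω) with hU
  have hUm : ∀ i, Measurable (U i) := fun i => (hφ i).prodMk (hξ i)
  have hIID : CSMDSR.IsIID P U (P.map (U 0)) := ⟨hUm, hindep, fun i => (hident i).map_eq⟩
  have hlaw : CSMDSR.IsNoiseLaw (P.map (U 0)) q.nuBar q.kapSig := by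
    refine ⟨Measure.isProbabilityMeasure_map (hUm 0).aemeasurable, hnu, ?_, ?_, fun j => ?_,
      fun v => ?_⟩
    · have hset : MeasurableSet {o : (Fin n → ℝ) × ℝ | ∀ j, |o.1 j| ≤ q.nuBar} := by
        simp only [Set.ofPred_forall]
        exact MeasurableSet.iInter fun j => measurableSet_le (by fun_prop) measurable_const
      exact (ae_map_iff (hUm 0).aemeasurable hset).2 (hbound 0)
    · rw [lintegral_map (by fun_prop) (hUm 0)]; exact hsubG 0
    · rw [integral_map (hUm 0).aemeasurable (by fun_prop)]; exact hmean 0 j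
    · rw [integral_map (hUm 0).aemeasurable
        ((CSMDSR.IsNoiseLaw.measurable_dot v).pow_const 2).aestronglyMeasurable]
      exact hcov' v
  have hobs : ∀ ω, (fun i => (φ i ω, η i ω)) =
      CSMDSR.obsSeq act xs q.sig fun i => U i ω := fun ω => by
    funext i; rw [CSMDSR.obsSeq, hη]
  simp only [hobs]
  have hlog0 : 0 ≤ Real.log n := Real.log_natCast_nonneg n
  have hg : 0 < q.rho * q.s * q.nu := mul_pos (mul_pos H.rho_pos H.s_pos) H.nu_pos
  have hl := H.log_add_pos ht0
  constructor
  · obtain ⟨h1, h2, h3⟩ := H.cost_as ht0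
    refine H.error_bound hIID hlaw ht0 hR hx₀ hxsR hN hmin (cost := fun k => q.mAs CSMDSR.tuning n k)
      h1 h2 (by positivity) h3 hl.le ?_
      (D := fun k ω => CSMDSR.asPoint CSMDSR.tuning q X act x₀
        (CSMDSR.obsSeq act xs q.sig fun i => U i ω) k) (fun ω => rfl)
      (fun k => H.measure_asPoint_le hIID hlaw ht0 hR hx₀ k)
    have := mul_pos hg hl
    linarith
  · obtain ⟨h1, h2, h3⟩ := H.cost_mb ht0
    exact H.error_bound hIID hlaw ht0 hR hx₀ hxsR hN hmin
      (cost := fun k => q.m0 CSMDSR.tuning n * CSMDSR.Params.batch CSMDSR.tuning n k)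
      h1 h2 (by positivity) h3 (by positivity) le_rfl
      (D := fun k ω => CSMDSR.mbPoint CSMDSR.tuning q X act x₀
        (CSMDSR.obsSeq act xs q.sig fun i => U i ω) k) (fun ω => rfl)
      (fun k => H.measure_mbPoint_le hIID hlaw ht0 hR hx₀ k)
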